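/- An instance of the node-weighted diameter-optimal augmentation problem (WDOAP) consists of a path $P=(v_1,\dots,v_N)$, $N\ge 2$, with edge weights $\delta(v_i,v_{i+1})>0$; of vertex weights $w(v_i)$ with $0\le w(v_i)\le\min\{d(v_1,v_i),d(v_i,v_N)\}$, where $d$ is the distance in $P$; and of an oracle that reports the weight $c(v_i,v_j)=c(v_j,v_i)\ge 0$ of a queried shortcut in $O(1)$ time, where $c$ is a graph-metric, i.e. $c(u,v)\le c(u,z)+d(z,v)$ for all distinct vertices $u,v,z$ of $P$. The task is to find indices $1\le i^*<j^*\le N$ that minimize $$D(i,j)=\max_{1\le k<h\le N}\bigl\{w(v_k)+d_{i,j}(v_k,v_h)+w(v_h)\bigr\},$$ where $d_{i,j}$ is the distance in the multigraph obtained from $P$ by adding an edge $(v_i,v_j)$ of weight $c(v_i,v_j)$. Theorem. WDOAP can be solved in $O(N\log N)$ time and $O(N)$ space. More precisely, there is a single program for a real RAM (whose unit-time operations are addition, subtraction and comparison of reals, arithmetic on and comparison of words of $O(\log N)$ bits, indirect addressing, and calls of the oracle) that on every instance halts within $O(N\log N)$ steps, uses $O(N)$ memory cells, each holding a real number or a word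 of $O(\log N)$ bits, and outputs an optimal pair $(i^*,j^*)$; the constants in the bounds are absolute. In particular, this holds for the instances whose vertex weights, denoted $\omega$, satisfy in addition the node-triangle inequality $\omega(v_i)\le\omega(v_j)+d(v_i,v_j)$. -/

import Mathlib

/-! ## Edge-weighted undirected multigraphs and their distances -/

namespace WGraph

/-- `WalkLength E u v l`: there is a walk from `u` to `v` of total length `l`, in the multigraph
where `E a b x` says that some edge of weight `x` joins `a` to `b`. -/
inductive WalkLength {V : Type} (E : V → V → ℝ → Prop) : V → V → ℝ → Prop
  | nil (u : V) : WalkLength E u u 0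
  | cons {u v z : V} {a b : ℝ} (e : E u v a) (p : WalkLength E v z b) : WalkLength E u z (a + b)

/-- The distance `d_G(u, v)`: the length of a shortest walk. All graphs below are connected and have
nonnegative edge weights, so that the infimum is attained, and attained by a path. -/
noncomputable def gdist {V : Type} (E : V → V → ℝ → Prop) (u v : V) : ℝ :=
  sInf {l : ℝ | WalkLength E u v l}

/-- The path on the vertices `0, 1, …, n`, where `δ e` is the weight of the edge `(e, e + 1)`. -/
inductive PathEdge {n : ℕ} (δ : Fin n → ℝ) : Fin (n + 1) → Fin (n + 1) → ℝ → Prop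
  | fwd (e : Fin n) : PathEdge δ e.castSucc e.succ (δ e)
  | bwd (e : Fin n) : PathEdge δ e.succ e.castSucc (δ e)

/-- The multigraph `G + (i, j)`: one more edge, of weight `a`, joins `i` and `j`. -/
def AddEdge {V : Type} (E : V → V → ℝ → Prop) (i j : V) (a : ℝ) (u v : V) (b : ℝ) : Prop :=
  E u v b ∨ (u = i ∧ v = j ∧ b = a) ∨ (u = j ∧ v = i ∧ b = a)

/-- `c` is a graph-metric with respect to the graph `E`. -/
def IsGraphMetric {V : Type} (E : V → V → ℝ → Prop) (c : V → V → ℝ) : Prop :=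
  ∀ u v z : V, u ≠ v → u ≠ z → v ≠ z → c u v ≤ c u z + gdist E z v

end WGraph

/-! ## A real RAM with an oracle

Programs are structured (sequencing, conditional, loop). There are registers and arrays that hold
natural numbers (words) and registers and arrays that hold real numbers. A program is a finite
text, so that it mentions only finitely many registers and arrays. The only operations on reals are
addition, subtraction, comparison and the oracle. Every operation takes one unit of time. -/

namespace RealRAM

/-- A memory configuration. Registers and arrays are named by natural numbers. -/
structure State where
  nreg : ℕ → ℕ
  rreg : ℕ → ℝ
  narr : ℕ → ℕ → ℕ
  rarr : ℕ → ℕ → ℝ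

/-- Word expressions. `get a e` is the entry of the word array `a` at the index `e`. -/
inductive NExp where
  | const (k : ℕ)
  | reg (x : ℕ)
  | get (a : ℕ) (e : NExp)
  | add (e f : NExp)
  | sub (e f : NExp)
  | mul (e f : NExp)
  | div (e f : NExp)

/-- Real expressions. `oracle e f` is the answer of the oracle to the query `(e, f)`. -/
inductive RExp where
  | zero
  | reg (x : ℕ)
  | get (a : ℕ) (e : NExp)
  | oracle (e f : NExp)
  | add (e f : RExp)
  | sub (e f : RExp)

/-- Tests. -/
inductive BExp where
  | nle (e f : NExp)
  | rle (e f : RExp)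
  | not (b : BExp)
  | and (b b' : BExp)

/-- Programs. -/
inductive Cmd where
  | skip
  | setN (x : ℕ) (e : NExp)
  | setR (x : ℕ) (e : RExp)
  | storeN (a : ℕ) (i e : NExp)
  | storeR (a : ℕ) (i : NExp) (e : RExp)
  | seq (p q : Cmd)
  | cond (b : BExp) (p q : Cmd)
  | loop (b : BExp) (p : Cmd)

/-- Value of a word expression (truncated subtraction, division rounded down). -/
def NExp.eval (s : State) : NExp → ℕ
  | .const k => k
  | .reg x => s.nreg x
  | .get a e => s.narr a (e.eval s)
  | .add e f => e.eval s + f.eval s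
  | .sub e f => e.eval s - f.eval s
  | .mul e f => e.eval s * f.eval s
  | .div e f => e.eval s / f.eval s

/-- On a machine with arrays of `S` entries and with words that hold the numbers below `W`, the
expression can be evaluated: each index is inside its array, and each value fits into a word. -/
def NExp.ok (S W : ℕ) (s : State) : NExp → Prop
  | .const k => k < W
  | .reg x => s.nreg x < W
  | .get a e => e.ok S W s ∧ e.eval s < S ∧ s.narr a (e.eval s) < W
  | .add e f => e.ok S W s ∧ f.ok S W s ∧ e.eval s + f.eval s < W
  | .sub e f => e.ok S W s ∧ f.ok S W s
  | .mul e f => e.ok S W s ∧ f.ok S W s ∧ e.eval s * f.eval s < W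
  | .div e f => e.ok S W s ∧ f.ok S W s

/-- Number of operations in a word expression. -/
def NExp.cost : NExp → ℕ
  | .const _ => 1
  | .reg _ => 1
  | .get _ e => e.cost + 1
  | .add e f => e.cost + f.cost + 1
  | .sub e f => e.cost + f.cost + 1
  | .mul e f => e.cost + f.cost + 1
  | .div e f => e.cost + f.cost + 1

/-- Value of a real expression, where `c` is the oracle. -/
def RExp.eval (c : ℕ → ℕ → ℝ) (s : State) : RExp → ℝ
  | .zero => 0
  | .reg x => s.rreg x
  | .get a e => s.rarr a (e.eval s)
  | .oracle e f => c (e.eval s) (f.eval s)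
  | .add e f => e.eval c s + f.eval c s
  | .sub e f => e.eval c s - f.eval c s

/-- As `NExp.ok`; real values are not limited. -/
def RExp.ok (S W : ℕ) (s : State) : RExp → Prop
  | .zero => True
  | .reg _ => True
  | .get _ e => e.ok S W s ∧ e.eval s < S
  | .oracle e f => e.ok S W s ∧ f.ok S W s
  | .add e f => e.ok S W s ∧ f.ok S W s
  | .sub e f => e.ok S W s ∧ f.ok S W s

/-- Number of operations in a real expression. -/
def RExp.cost : RExp → ℕ
  | .zero => 1
  | .reg _ => 1
  | .get _ e => e.cost + 1
  | .oracle e f => e.cost + f.cost + 1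
  | .add e f => e.cost + f.cost + 1
  | .sub e f => e.cost + f.cost + 1

/-- The test succeeds. -/
def BExp.holds (c : ℕ → ℕ → ℝ) (s : State) : BExp → Prop
  | .nle e f => e.eval s ≤ f.eval s
  | .rle e f => e.eval c s ≤ f.eval c s
  | .not b => ¬ b.holds c s
  | .and b b' => b.holds c s ∧ b'.holds c s

/-- The test can be evaluated; the second part of a conjunction is looked at only if the first part
succeeds. -/
def BExp.ok (c : ℕ → ℕ → ℝ) (S W : ℕ) (s : State) : BExp → Prop
  | .nle e f => e.ok S W s ∧ f.ok S W s
  | .rle e f => e.ok S W s ∧ f.ok S W s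
  | .not b => b.ok c S W s
  | .and b b' => b.ok c S W s ∧ (b.holds c s → b'.ok c S W s)

/-- Number of operations in a test. -/
def BExp.cost : BExp → ℕ
  | .nle e f => e.cost + f.cost + 1
  | .rle e f => e.cost + f.cost + 1
  | .not b => b.cost + 1
  | .and b b' => b.cost + b'.cost + 1

/-- Write a word register. -/
def State.putN (s : State) (x v : ℕ) : State :=
  { s with nreg := Function.update s.nreg x v }

/-- Write a real register. -/
def State.putR (s : State) (x : ℕ) (v : ℝ) : State :=
  { s with rreg := Function.update s.rreg x v }

/-- Write entry `i` of the word array `a`. -/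
def State.putNA (s : State) (a i v : ℕ) : State :=
  { s with narr := Function.update s.narr a (Function.update (s.narr a) i v) }

/-- Write entry `i` of the real array `a`. -/
def State.putRA (s : State) (a i : ℕ) (v : ℝ) : State :=
  { s with rarr := Function.update s.rarr a (Function.update (s.rarr a) i v) }

/-- `Exec c S W p s t s'`: started in the state `s`, on a machine with oracle `c`, with arrays of
`S` entries and with words that hold the numbers below `W`, the program `p` halts after `t` steps
in the state `s'`, and it never leaves the bounds of an array or overflows a word. -/
inductive Exec (c : ℕ → ℕ → ℝ) (S W : ℕ) : Cmd → State → ℕ → State → Prop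
  | skip (s : State) : Exec c S W .skip s 1 s
  | setN {x : ℕ} {e : NExp} {s : State} (he : e.ok S W s) :
      Exec c S W (.setN x e) s (e.cost + 1) (s.putN x (e.eval s))
  | setR {x : ℕ} {e : RExp} {s : State} (he : e.ok S W s) :
      Exec c S W (.setR x e) s (e.cost + 1) (s.putR x (e.eval c s))
  | storeN {a : ℕ} {i e : NExp} {s : State} (hi : i.ok S W s) (hb : i.eval s < S)
      (he : e.ok S W s) :
      Exec c S W (.storeN a i e) s (i.cost + e.cost + 1) (s.putNA a (i.eval s) (e.eval s))
  | storeR {a : ℕ} {i : NExp} {e : RExp} {s : State} (hi : i.ok S W s) (hb : i.eval s < S)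
      (he : e.ok S W s) :
      Exec c S W (.storeR a i e) s (i.cost + e.cost + 1) (s.putRA a (i.eval s) (e.eval c s))
  | seq {p q : Cmd} {s s₁ s₂ : State} {t₁ t₂ : ℕ} (hp : Exec c S W p s t₁ s₁)
      (hq : Exec c S W q s₁ t₂ s₂) : Exec c S W (.seq p q) s (t₁ + t₂) s₂
  | condTrue {b : BExp} {p q : Cmd} {s s₁ : State} {t : ℕ} (hok : b.ok c S W s)
      (hb : b.holds c s) (hp : Exec c S W p s t s₁) :
      Exec c S W (.cond b p q) s (b.cost + 1 + t) s₁
  | condFalse {b : BExp} {p q : Cmd} {s s₁ : State} {t : ℕ} (hok : b.ok c S W s)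
      (hb : ¬ b.holds c s) (hq : Exec c S W q s t s₁) :
      Exec c S W (.cond b p q) s (b.cost + 1 + t) s₁
  | loopDone {b : BExp} {p : Cmd} {s : State} (hok : b.ok c S W s) (hb : ¬ b.holds c s) :
      Exec c S W (.loop b p) s (b.cost + 1) s
  | loopStep {b : BExp} {p : Cmd} {s s₁ s₂ : State} {t₁ t₂ : ℕ} (hok : b.ok c S W s)
      (hb : b.holds c s) (hp : Exec c S W p s t₁ s₁) (hl : Exec c S W (.loop b p) s₁ t₂ s₂) :
      Exec c S W (.loop b p) s (b.cost + 1 + t₁ + t₂) s₂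

/-- All names of registers and arrays in the expression are below this number. -/
def NExp.width : NExp → ℕ
  | .const _ => 0
  | .reg x => x + 1
  | .get a e => max (a + 1) e.width
  | .add e f => max e.width f.width
  | .sub e f => max e.width f.width
  | .mul e f => max e.width f.width
  | .div e f => max e.width f.width

/-- All names of registers and arrays in the expression are below this number. -/
def RExp.width : RExp → ℕ
  | .zero => 0
  | .reg x => x + 1
  | .get a e => max (a + 1) e.width
  | .oracle e f => max e.width f.width
  | .add e f => max e.width f.width
  | .sub e f => max e.width f.width

/-- All names of registers and arrays in the test are below this number. -/
def BExp.width : BExp → ℕ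
  | .nle e f => max e.width f.width
  | .rle e f => max e.width f.width
  | .not b => b.width
  | .and b b' => max b.width b'.width

/-- All names of registers and arrays in the program are below this number. -/
def Cmd.width : Cmd → ℕ
  | .skip => 0
  | .setN x e => max (x + 1) e.width
  | .setR x e => max (x + 1) e.width
  | .storeN a i e => max (a + 1) (max i.width e.width)
  | .storeR a i e => max (a + 1) (max i.width e.width)
  | .seq p q => max p.width q.width
  | .cond b p q => max b.width (max p.width q.width)
  | .loop b p => max b.width p.width

/-- Number of memory cells that a program needs if its arrays have `S` entries: at most `width`
registers and `width` arrays of each of the two kinds. -/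
def Cmd.space (p : Cmd) (S : ℕ) : ℕ := 2 * (p.width * (S + 1))

end RealRAM

/-! ## The node-weighted diameter-optimal augmentation problem -/

/-- An instance on a path with the `n + 1` vertices `0, 1, …, n`. -/
structure WDoap (n : ℕ) where
  /-- edge weights -/
  δ : Fin n → ℝ
  /-- vertex weights -/
  w : Fin (n + 1) → ℝ
  /-- shortcut weights -/
  c : Fin (n + 1) → Fin (n + 1) → ℝ
  δ_pos : ∀ e, 0 < δ e
  w_nonneg : ∀ k, 0 ≤ w k
  w_le_first : ∀ k, w k ≤ WGraph.gdist (WGraph.PathEdge δ) 0 k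
  w_le_last : ∀ k, w k ≤ WGraph.gdist (WGraph.PathEdge δ) k (Fin.last n)
  c_nonneg : ∀ i j, 0 ≤ c i j
  c_symm : ∀ i j, c i j = c j i
  c_graphMetric : WGraph.IsGraphMetric (WGraph.PathEdge δ) c

namespace WDoap

variable {n : ℕ}

/-- The distance `d_{i,j}(k, h)` in the path with the shortcut `(i, j)` added. -/
noncomputable def augDist (I : WDoap n) (i j k h : Fin (n + 1)) : ℝ :=
  WGraph.gdist (WGraph.AddEdge (WGraph.PathEdge I.δ) i j (I.c i j)) k h

/-- The objective `D(i, j)`, a maximum over the pairs `k < h`. -/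
noncomputable def D (I : WDoap n) (i j : Fin (n + 1)) : ℝ :=
  ⨆ p : {p : Fin (n + 1) × Fin (n + 1) // p.1 < p.2},
    I.w p.1.1 + I.augDist i j p.1.1 p.1.2 + I.w p.1.2

/-- The pair `(a, b)` is an optimal solution. -/
def IsOptimal (I : WDoap n) (a b : ℕ) : Prop :=
  ∃ i j : Fin (n + 1), (i : ℕ) = a ∧ (j : ℕ) = b ∧ i < j ∧
    ∀ i' j' : Fin (n + 1), i' < j' → I.D i j ≤ I.D i' j'

/-- The oracle for the shortcut weights. -/
noncomputable def oracle (I : WDoap n) (a b : ℕ) : ℝ :=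
  if h : a < n + 1 ∧ b < n + 1 then I.c ⟨a, h.1⟩ ⟨b, h.2⟩ else 0

/-- The input: word register `0` holds the number of vertices, real array `0` holds the edge
weights, real array `1` holds the vertex weights, and everything else is `0`. The shortcut weights
are not part of the memory. -/
noncomputable def start (I : WDoap n) : RealRAM.State where
  nreg := fun x => if x = 0 then n + 1 else 0
  rreg := fun _ => 0
  narr := fun _ _ => 0
  rarr := fun a k =>
    if a = 0 then (if h : k < n then I.δ ⟨k, h⟩ else 0)
    else if a = 1 then (if h : k < n + 1 then I.w ⟨k, h⟩ else 0)
    else 0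

end WDoap

/-! Let `x` be the distance from the first vertex. Once a shortcut `(i, j)` with `i < j` is added, a
pair `k < h` is joined either along the path, at cost `w k + w h + (x h - x k)`, or through the
shortcut from `i` to `j`, at cost `w k + w h + |x k - x i| + c i j + |x h - x j|`; the opposite
direction is never shorter (`add_augDist_le_iff`). Replacing `w` by its 1-Lipschitz hull `v` does
not affect whether `D i j ≤ μ` (`D_le_iff_detoursLe`). The upper bounds on `w` enter here, through
`2 w ≤ D` (`two_mul_weight_le`). Now `p = v + x` is nondecreasing, `q = v - x` is nonincreasing, the
path cost is `q k + p h`, and `D i j ≤ μ` says that every pair with `q k + p h > μ` has a detour of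
cost at most `μ`.

Fix a threshold `lam` and call `(k, h)` critical if `q k + p h > lam`. The critical `h` of a given
`k` form a final segment whose start moves up with `k`, so two pointers find, in linear time, the
maxima of `p k + q h`, `q k + p h`, `p k + p h` and `q k + q h` over the critical pairs. These
determine the worst detour of every `(i, j)` (`pairCost_le_iff`). In row `i` that cost is the
maximum of two terms, of which, since `c` is a graph-metric, one is nondecreasing in `j` and the
other nonincreasing. They cross at a column that does not involve `c` and that moves monotonically
with `i`. A sweep with one pointer thus finds the best shortcut at the threshold with `O(N)` oracle
calls (`solve_run`), and comparing its cost with `lam` decides whether `lam` is feasible.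

The critical set changes only at values `q k + p h`, the entries of a matrix that is sorted along
rows and columns. A bracket of an infeasible `lo` and a feasible `hi` is narrowed on grids of step
`2 ^ K, …, 2, 1`. On each grid the entries inside the bracket are listed and sorted, and four
feasibility tests divide their number by 16. Halving the step multiplies it by at most 8, up to a
linear term (`card_candidates_le`), so there are always `O(N / g)` entries at step `g`. In all this
takes `O(log N)` tests of cost `O(N)` and sorting of cost `O(∑ (N / g) log N)`, that is, `O(N log
N)`. When no entry is left strictly between `lo` and `hi`, the critical set is constant on `[lo,
hi)`, and one more sweep at `lo` gives the optimum (`finish_run`). -/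

namespace RealRAM

/-! ### Total correctness with a time budget -/

section Logic

variable {c : ℕ → ℕ → ℝ} {S W : ℕ}

/-- Started in `s`, the program `p` halts within `b` steps, in a state that satisfies `Q`. -/
def Run (c : ℕ → ℕ → ℝ) (S W : ℕ) (p : Cmd) (b : ℕ) (s : State) (Q : State → Prop) : Prop :=
  ∃ t s', Exec c S W p s t s' ∧ t ≤ b ∧ Q s'

/-- Word registers written by a program. -/
def Cmd.wn : Cmd → List ℕ
  | .setN x _ => [x]
  | .seq p q => p.wn ++ q.wn
  | .cond _ p q => p.wn ++ q.wn
  | .loop _ p => p.wn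
  | _ => []

/-- Real registers written by a program. -/
def Cmd.wr : Cmd → List ℕ
  | .setR x _ => [x]
  | .seq p q => p.wr ++ q.wr
  | .cond _ p q => p.wr ++ q.wr
  | .loop _ p => p.wr
  | _ => []

/-- Real arrays written by a program. -/
def Cmd.wra : Cmd → List ℕ
  | .storeR a _ _ => [a]
  | .seq p q => p.wra ++ q.wra
  | .cond _ p q => p.wra ++ q.wra
  | .loop _ p => p.wra
  | _ => []

/-- The two states agree on everything that `p` does not write (word arrays aside). -/
structure Same (p : Cmd) (s s' : State) : Prop where
  nreg : ∀ x, x ∉ p.wn → s'.nreg x = s.nreg x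
  rreg : ∀ x, x ∉ p.wr → s'.rreg x = s.rreg x
  rarr : ∀ a, a ∉ p.wra → s'.rarr a = s.rarr a

theorem Same.refl (p : Cmd) (s : State) : Same p s s := ⟨fun _ _ => rfl, fun _ _ => rfl, fun _ _ => rfl⟩

theorem Same.trans {p : Cmd} {s s' s'' : State} (h : Same p s s') (h' : Same p s' s'') :
    Same p s s'' :=
  ⟨fun x hx => (h'.nreg x hx).trans (h.nreg x hx), fun x hx => (h'.rreg x hx).trans (h.rreg x hx),
    fun x hx => (h'.rarr x hx).trans (h.rarr x hx)⟩

theorem Same.mono {p q : Cmd} {s s' : State} (h : Same p s s') (hn : p.wn ⊆ q.wn)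
    (hr : p.wr ⊆ q.wr) (ha : p.wra ⊆ q.wra) : Same q s s' :=
  ⟨fun x hx => h.nreg x fun h' => hx (hn h'), fun x hx => h.rreg x fun h' => hx (hr h'),
    fun x hx => h.rarr x fun h' => hx (ha h')⟩

theorem Exec.same {p : Cmd} {s s' : State} {t : ℕ} (h : Exec c S W p s t s') : Same p s s' := by
  induction h with
  | skip s => exact Same.refl _ _
  | setN he =>
    refine ⟨fun y hy => ?_, fun _ _ => rfl, fun _ _ => rfl⟩
    simp only [Cmd.wn, List.mem_singleton] at hy
    simp [State.putN, hy]
  | setR he =>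
    refine ⟨fun _ _ => rfl, fun y hy => ?_, fun _ _ => rfl⟩
    simp only [Cmd.wr, List.mem_singleton] at hy
    simp [State.putR, hy]
  | storeN hi hb he => exact ⟨fun _ _ => rfl, fun _ _ => rfl, fun _ _ => rfl⟩
  | storeR hi hb he =>
    refine ⟨fun _ _ => rfl, fun _ _ => rfl, fun y hy => ?_⟩
    simp only [Cmd.wra, List.mem_singleton] at hy
    simp [State.putRA, hy]
  | seq hp hq ihp ihq =>
    exact (ihp.mono (by simp [Cmd.wn]) (by simp [Cmd.wr]) (by simp [Cmd.wra])).trans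
      (ihq.mono (by simp [Cmd.wn]) (by simp [Cmd.wr]) (by simp [Cmd.wra]))
  | condTrue hok hb hp ihp =>
    exact ihp.mono (by simp [Cmd.wn]) (by simp [Cmd.wr]) (by simp [Cmd.wra])
  | condFalse hok hb hp ihp =>
    exact ihp.mono (by simp [Cmd.wn]) (by simp [Cmd.wr]) (by simp [Cmd.wra])
  | loopDone hok hb => exact Same.refl _ _
  | loopStep hok hb hp hl ihp ihl =>
    exact (ihp.mono (by simp [Cmd.wn]) (by simp [Cmd.wr]) (by simp [Cmd.wra])).trans ihl

theorem Run.mono {p : Cmd} {b b' : ℕ} {s : State} {Q Q' : State → Prop}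
    (h : Run c S W p b s Q) (hb : b ≤ b') (hQ : ∀ s', Q s' → Same p s s' → Q' s') :
    Run c S W p b' s Q' := by
  obtain ⟨t, s', he, ht, hq⟩ := h
  exact ⟨t, s', he, ht.trans hb, hQ s' hq he.same⟩

theorem Run.seq {p q : Cmd} {b b' : ℕ} {s : State} {R Q : State → Prop}
    (hp : Run c S W p b s R) (hq : ∀ s', R s' → Same p s s' → Run c S W q b' s' Q) :
    Run c S W (.seq p q) (b + b') s Q := by
  obtain ⟨t, s', he, ht, hr⟩ := hp
  obtain ⟨t', s'', he', ht', hQ⟩ := hq s' hr he.same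
  exact ⟨t + t', s'', .seq he he', by omega, hQ⟩

theorem Run.cond {g : BExp} {p q : Cmd} {b : ℕ} {s : State} {Q : State → Prop}
    (hok : g.ok c S W s) (hp : g.holds c s → Run c S W p b s Q)
    (hq : ¬ g.holds c s → Run c S W q b s Q) : Run c S W (.cond g p q) (g.cost + 1 + b) s Q := by
  by_cases h : g.holds c s
  · obtain ⟨t, s', he, ht, hQ⟩ := hp h
    exact ⟨_, s', .condTrue hok h he, by omega, hQ⟩
  · obtain ⟨t, s', he, ht, hQ⟩ := hq h
    exact ⟨_, s', .condFalse hok h he, by omega, hQ⟩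

/-- The rule for loops: `Inv` is invariant and the potential `Φ` pays for each round. -/
theorem Run.loop_potential {g : BExp} {p : Cmd} {s₀ : State} (Inv : State → Prop) (Φ κ : State → ℕ)
    (h₀ : Inv s₀)
    (hstep : ∀ s, Inv s → Same (.loop g p) s₀ s → g.ok c S W s ∧ (g.holds c s →
      Run c S W p (κ s) s (fun s' => Inv s' ∧ κ s + g.cost + 1 + Φ s' ≤ Φ s))) :
    Run c S W (.loop g p) (Φ s₀ + g.cost + 1) s₀ (fun s' => Inv s' ∧ ¬ g.holds c s') := by
  have key : ∀ N s, Φ s ≤ N → Inv s → Same (.loop g p) s₀ s →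
      Run c S W (.loop g p) (Φ s + g.cost + 1) s (fun s' => Inv s' ∧ ¬ g.holds c s') := by
    intro N
    induction N with
    | zero =>
      intro s hN hI hs
      obtain ⟨hok, hb⟩ := hstep s hI hs
      by_cases h : g.holds c s
      · obtain ⟨t, s', he, ht, hI', hΦ⟩ := hb h
        omega
      · exact ⟨_, s, .loopDone hok h, by omega, hI, h⟩
    | succ N ih =>
      intro s hN hI hs
      obtain ⟨hok, hb⟩ := hstep s hI hs
      by_cases h : g.holds c s
      · obtain ⟨t, s', he, ht, hI', hΦ⟩ := hb h
        have hs' : Same (.loop g p) s s' :=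
          he.same.mono (by simp [Cmd.wn]) (by simp [Cmd.wr]) (by simp [Cmd.wra])
        obtain ⟨t', s'', he', ht', hQ⟩ := ih s' (by omega) hI' (hs.trans hs')
        exact ⟨_, s'', .loopStep hok h he he', by omega, hQ⟩
      · exact ⟨_, s, .loopDone hok h, by omega, hI, h⟩
  exact key _ s₀ le_rfl h₀ (Same.refl _ _)

/-- The rule for loops whose rounds cost at most `κ` each and decrease `μ`. -/
theorem Run.loop {g : BExp} {p : Cmd} {s₀ : State} (Inv : State → Prop) (μ : State → ℕ) (κ : ℕ)
    (h₀ : Inv s₀)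
    (hstep : ∀ s, Inv s → Same (.loop g p) s₀ s → g.ok c S W s ∧ (g.holds c s →
      Run c S W p κ s (fun s' => Inv s' ∧ μ s' < μ s))) :
    Run c S W (.loop g p) (μ s₀ * (κ + g.cost + 1) + g.cost + 1) s₀
      (fun s' => Inv s' ∧ ¬ g.holds c s') := by
  refine Run.loop_potential Inv (fun s => μ s * (κ + g.cost + 1)) (fun _ => κ) h₀ ?_
  intro s hI hs
  refine ⟨(hstep s hI hs).1, fun h => ((hstep s hI hs).2 h).mono le_rfl ?_⟩
  rintro s' ⟨hI', hlt⟩ -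
  refine ⟨hI', ?_⟩
  calc κ + g.cost + 1 + μ s' * (κ + g.cost + 1) = (μ s' + 1) * (κ + g.cost + 1) := by ring
    _ ≤ μ s * (κ + g.cost + 1) := Nat.mul_le_mul_right _ hlt

/-- Weakest precondition of a loop-free program. -/
def wp (c : ℕ → ℕ → ℝ) (S W : ℕ) : Cmd → (State → Prop) → State → Prop
  | .skip, Q, s => Q s
  | .setN x e, Q, s => e.ok S W s ∧ Q (s.putN x (e.eval s))
  | .setR x e, Q, s => e.ok S W s ∧ Q (s.putR x (e.eval c s))
  | .storeN a i e, Q, s => i.ok S W s ∧ i.eval s < S ∧ e.ok S W s ∧ Q (s.putNA a (i.eval s) (e.eval s))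
  | .storeR a i e, Q, s =>
    i.ok S W s ∧ i.eval s < S ∧ e.ok S W s ∧ Q (s.putRA a (i.eval s) (e.eval c s))
  | .seq p q, Q, s => wp c S W p (wp c S W q Q) s
  | .cond b p q, Q, s =>
    b.ok c S W s ∧ (b.holds c s → wp c S W p Q s) ∧ (¬ b.holds c s → wp c S W q Q s)
  | .loop _ _, _, _ => False

/-- The largest number of steps of a loop-free program. -/
def Cmd.maxCost : Cmd → ℕ
  | .skip => 1
  | .setN _ e => e.cost + 1
  | .setR _ e => e.cost + 1
  | .storeN _ i e => i.cost + e.cost + 1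
  | .storeR _ i e => i.cost + e.cost + 1
  | .seq p q => p.maxCost + q.maxCost
  | .cond b p q => b.cost + 1 + max p.maxCost q.maxCost
  | .loop _ _ => 0

/-- Loop bodies without inner loops are verified by unfolding `wp`, while their cost is a number
that depends on the program text alone. -/
theorem Run.of_wp {p : Cmd} {s : State} {Q : State → Prop} {b : ℕ} (h : wp c S W p Q s)
    (hb : p.maxCost ≤ b) : Run c S W p b s Q := by
  refine Run.mono (b := p.maxCost) ?_ hb fun _ h _ => h
  clear hb
  induction p generalizing s Q with
  | skip => exact ⟨_, s, .skip s, le_rfl, h⟩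
  | setN x e => exact ⟨_, _, .setN h.1, le_rfl, h.2⟩
  | setR x e => exact ⟨_, _, .setR h.1, le_rfl, h.2⟩
  | storeN a i e => exact ⟨_, _, .storeN h.1 h.2.1 h.2.2.1, le_rfl, h.2.2.2⟩
  | storeR a i e => exact ⟨_, _, .storeR h.1 h.2.1 h.2.2.1, le_rfl, h.2.2.2⟩
  | seq p q ihp ihq => exact Run.seq (ihp h) fun s' hs' _ => ihq hs'
  | cond b p q ihp ihq =>
    exact Run.cond h.1 (fun hb => (ihp (h.2.1 hb)).mono (le_max_left _ _) fun _ h _ => h)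
      (fun hb => (ihq (h.2.2 hb)).mono (le_max_right _ _) fun _ h _ => h)
  | loop b p ih => exact h.elim

theorem wp.mono {p : Cmd} {s : State} {R Q : State → Prop} (h : wp c S W p R s)
    (hQ : ∀ s', R s' → Same p s s' → Q s') : wp c S W p Q s := by
  induction p generalizing s R Q with
  | skip => exact hQ _ h (Same.refl _ _)
  | setN x e => exact ⟨h.1, hQ _ h.2 (Exec.same (.setN (c := c) h.1))⟩
  | setR x e => exact ⟨h.1, hQ _ h.2 (Exec.same (.setR h.1))⟩
  | storeN a i e => exact ⟨h.1, h.2.1, h.2.2.1, hQ _ h.2.2.2 ⟨fun _ _ => rfl, fun _ _ => rfl, fun _ _ => rfl⟩⟩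
  | storeR a i e =>
    exact ⟨h.1, h.2.1, h.2.2.1, hQ _ h.2.2.2 (Exec.same (.storeR h.1 h.2.1 h.2.2.1))⟩
  | seq p q ihp ihq =>
    refine ihp h fun s' h' hs => ihq h' fun s'' h'' hs' => hQ _ h'' ?_
    exact (hs.mono (by simp [Cmd.wn]) (by simp [Cmd.wr]) (by simp [Cmd.wra])).trans
      (hs'.mono (by simp [Cmd.wn]) (by simp [Cmd.wr]) (by simp [Cmd.wra]))
  | cond b p q ihp ihq =>
    refine ⟨h.1, fun hb => ihp (h.2.1 hb) fun s' h' hs => hQ _ h' ?_,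
      fun hb => ihq (h.2.2 hb) fun s' h' hs => hQ _ h' ?_⟩
    · exact hs.mono (by simp [Cmd.wn]) (by simp [Cmd.wr]) (by simp [Cmd.wra])
    · exact hs.mono (by simp [Cmd.wn]) (by simp [Cmd.wr]) (by simp [Cmd.wra])
  | loop b p ih => exact h.elim

theorem wp.seq {p q : Cmd} {s : State} {R Q : State → Prop} (h : wp c S W p R s)
    (hQ : ∀ s', R s' → Same p s s' → wp c S W q Q s') : wp c S W (.seq p q) Q s :=
  h.mono hQ

/-- Replace a real register by the maximum of its value and the value of `e`. -/
def maxR (r : ℕ) (e : RExp) : Cmd := .cond (.rle (.reg r) e) (.setR r e) .skip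

theorem wp_maxR {r : ℕ} {e : RExp} {Q : State → Prop} {s : State} :
    wp c S W (maxR r e) Q s ↔ e.ok S W s ∧ Q (s.putR r (max (s.rreg r) (e.eval c s))) := by
  have hself : s.putR r (s.rreg r) = s := by simp [State.putR]
  simp only [maxR, wp, BExp.ok, BExp.holds, RExp.ok, RExp.eval]
  rcases le_total (s.rreg r) (e.eval c s) with h | h
  · simp only [h, max_eq_right]; tauto
  · rw [max_eq_left h, hself]
    constructor
    · rintro ⟨⟨-, h1⟩, h2, h3⟩
      refine ⟨h1, ?_⟩
      by_cases h' : s.rreg r ≤ e.eval c s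
      · have := (h2 h').2
        rwa [← le_antisymm h' h, hself] at this
      · exact h3 h'
    · rintro ⟨h1, h2⟩
      refine ⟨⟨trivial, h1⟩, fun h' => ⟨h1, ?_⟩, fun _ => h2⟩
      rwa [← le_antisymm h' h, hself]

end Logic

end RealRAM

/-! ### Extremal sums over the critical pairs at a threshold -/

namespace RealRAM

/-- The data that stay fixed during the search: the last vertex, and the arrays of the positions `x`
and of `p = w + x` and `q = w - x`. -/
structure Holds (n : ℕ) (x p q : ℕ → ℝ) (s : State) : Prop where
  hn : s.nreg 2 = n
  hx : ∀ i ≤ n, s.rarr 2 i = x i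
  hp : ∀ i ≤ n, s.rarr 3 i = p i
  hq : ∀ i ≤ n, s.rarr 4 i = q i

theorem Holds.of_same {n : ℕ} {x p q : ℕ → ℝ} {r : Cmd} {s s' : State} (h : Holds n x p q s)
    (hs : Same r s s') (h2 : 2 ∉ r.wn) (ha2 : 2 ∉ r.wra) (ha3 : 3 ∉ r.wra) (ha4 : 4 ∉ r.wra) :
    Holds n x p q s' :=
  ⟨by rw [hs.nreg 2 h2, h.hn], by rw [hs.rarr 2 ha2]; exact h.hx, by rw [hs.rarr 3 ha3]; exact h.hp,
    by rw [hs.rarr 4 ha4]; exact h.hq⟩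

/-- `a` is attained by `f` on a pair with `q k + p h > lam`, and it bounds `f` on those with `k < m`. -/
def PairMax (n : ℕ) (p q : ℕ → ℝ) (lam : ℝ) (f : ℕ → ℕ → ℝ) (m : ℕ) (a : ℝ) : Prop :=
  (∀ k < m, ∀ h ≤ n, lam < q k + p h → f k h ≤ a) ∧ ∃ k ≤ n, ∃ h ≤ n, lam < q k + p h ∧ f k h = a

/-- With `p` nondecreasing and `q` nonincreasing, `(0, n)` is critical as soon as any pair is. It
serves as the initial value, so that no artificial `-∞` is needed. -/
theorem PairMax.init {n : ℕ} {p q : ℕ → ℝ} {lam : ℝ} {f : ℕ → ℕ → ℝ} (h : lam < q 0 + p n) :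
    PairMax n p q lam f 0 (f 0 n) :=
  ⟨fun k hk => absurd hk (Nat.not_lt_zero k), 0, Nat.zero_le n, n, le_rfl, h, rfl⟩

theorem PairMax.succ {n m h₀ : ℕ} {p q : ℕ → ℝ} {lam a : ℝ} {f : ℕ → ℕ → ℝ}
    (h : PairMax n p q lam f m a) (hm : m ≤ n) (hh : h₀ ≤ n) (hlt : lam < q m + p h₀)
    (hf : ∀ h ≤ n, lam < q m + p h → f m h ≤ f m h₀) :
    PairMax n p q lam f (m + 1) (max a (f m h₀)) := by
  refine ⟨fun k hk h' hh' hl => ?_, ?_⟩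
  · rcases Nat.lt_succ_iff_lt_or_eq.1 hk with hk | rfl
    · exact (h.1 k hk h' hh' hl).trans (le_max_left _ _)
    · exact (hf h' hh' hl).trans (le_max_right _ _)
  · rcases max_choice a (f m h₀) with he | he
    · rw [he]; exact h.2
    · exact ⟨m, hm, h₀, hh, hlt, he.symm⟩

theorem PairMax.skip {n m : ℕ} {p q : ℕ → ℝ} {lam a : ℝ} {f : ℕ → ℕ → ℝ}
    (h : PairMax n p q lam f m a) (hf : ∀ h ≤ n, q m + p h ≤ lam) :
    PairMax n p q lam f (m + 1) a := by
  refine ⟨fun k hk h' hh' hl => ?_, h.2⟩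
  rcases Nat.lt_succ_iff_lt_or_eq.1 hk with hk | rfl
  · exact h.1 k hk h' hh' hl
  · exact absurd hl (not_lt.2 (hf h' hh'))

/-- One round of `scanPairs`. -/
def scanPairsBody : Cmd :=
  .cond (.and (.nle (.reg 7) (.reg 2)) (.rle (.add (.get 4 (.reg 6)) (.get 3 (.reg 7))) (.reg 0)))
    (.setN 7 (.add (.reg 7) (.const 1)))
    (.seq
      (.cond (.nle (.reg 7) (.reg 2))
        (.seq (maxR 1 (.add (.get 3 (.reg 6)) (.get 4 (.reg 7)))) <|
          .seq (maxR 2 (.add (.get 4 (.reg 6)) (.get 3 (.reg 2)))) <|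
          .seq (maxR 3 (.add (.get 3 (.reg 6)) (.get 3 (.reg 2)))) <|
          maxR 4 (.add (.get 4 (.reg 6)) (.get 4 (.reg 7))))
        .skip)
      (.setN 6 (.add (.reg 6) (.const 1))))

/-- Initialization of `scanPairs`. -/
def scanPairsInit : Cmd :=
  .seq (.setN 6 (.const 0)) <| .seq (.setN 7 (.const 0)) <|
  .seq (.setR 1 (.add (.get 3 (.const 0)) (.get 4 (.reg 2)))) <|
  .seq (.setR 2 (.add (.get 4 (.const 0)) (.get 3 (.reg 2)))) <|
  .seq (.setR 3 (.add (.get 3 (.const 0)) (.get 3 (.reg 2)))) <|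
  .setR 4 (.add (.get 4 (.const 0)) (.get 4 (.reg 2)))

/-- Compute, over the pairs with `q k + p h > lam`, the maxima of `p k + q h`, `q k + p h`,
`p k + p h` and `q k + q h`. -/
def scanPairs : Cmd := .seq scanPairsInit (.loop (.nle (.reg 6) (.reg 2)) scanPairsBody)

/-- The invariant of `scanPairs`, at the pair `(k, h)`. -/
structure ScanInv (n : ℕ) (p q : ℕ → ℝ) (lam : ℝ) (s : State) : Prop where
  k_le : s.nreg 6 ≤ n + 1
  h_le : s.nreg 7 ≤ n + 1
  below : ∀ h < s.nreg 7, s.nreg 6 ≤ n → q (s.nreg 6) + p h ≤ lam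
  m1 : PairMax n p q lam (fun k h => p k + q h) (s.nreg 6) (s.rreg 1)
  m2 : PairMax n p q lam (fun k h => q k + p h) (s.nreg 6) (s.rreg 2)
  m3 : PairMax n p q lam (fun k h => p k + p h) (s.nreg 6) (s.rreg 3)
  m4 : PairMax n p q lam (fun k h => q k + q h) (s.nreg 6) (s.rreg 4)

variable {c : ℕ → ℕ → ℝ} {S W n : ℕ} {x p q : ℕ → ℝ}

/-- The critical `h` of row `k` run from the pointer to `n`; there `p` is largest at `n` and `q` at
the pointer. Passing to the next row lowers `q k`, so what lies below the pointer stays uncritical.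
Every round advances `k` or the pointer. -/
theorem scanPairsBody_run (hp : MonotoneOn p (Set.Iic n)) (hq : AntitoneOn q (Set.Iic n))
    (hS : n < S) (hW : n + 2 < W) {s : State} (hd : Holds n x p q s)
    (hI : ScanInv n p q (s.rreg 0) s) (hk : s.nreg 6 ≤ n) :
    Run c S W scanPairsBody 100 s (fun s' => ScanInv n p q (s.rreg 0) s' ∧
      (n + 1 - s'.nreg 6) + (n + 1 - s'.nreg 7) < (n + 1 - s.nreg 6) + (n + 1 - s.nreg 7)) := by
  refine Run.of_wp ?_ (by decide)
  obtain ⟨h1, h2, h3, m1, m2, m3, m4⟩ := hI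
  have e := hd.hn
  by_cases hh : s.nreg 7 ≤ n
  · have e1 := hd.hq _ hk
    have e2 := hd.hp _ hk
    have e3 := hd.hq _ hh
    have e4 := hd.hp _ hh
    have e5 := hd.hp n le_rfl
    have hp' : ∀ h ≤ n, s.nreg 7 ≤ h → p (s.nreg 7) ≤ p h := fun h hh' hl =>
      hp (Set.mem_Iic.2 hh) (Set.mem_Iic.2 hh') hl
    have hq' : ∀ h ≤ n, s.nreg 7 ≤ h → q h ≤ q (s.nreg 7) := fun h hh' hl =>
      hq (Set.mem_Iic.2 hh) (Set.mem_Iic.2 hh') hl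
    have hpn : ∀ h ≤ n, p h ≤ p n := fun h hh' => hp (Set.mem_Iic.2 hh') (Set.mem_Iic.2 le_rfl) hh'
    simp [scanPairsBody, wp, wp_maxR, BExp.ok, BExp.holds, NExp.ok, NExp.eval, RExp.ok, RExp.eval,
      State.putN, State.putR, e, hh, e1, e2, e3, e4, e5]
    refine ⟨by omega, fun hle => ⟨by omega, ⟨h1, by simpa using hh, ?_, m1, m2, m3, m4⟩, ?_⟩,
      fun hlt => ⟨by omega, by omega, by omega, by omega, by omega, ⟨by simpa using hk, h2, ?_, ?_, ?_, ?_, ?_⟩, ?_⟩⟩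
    · intro h hlt _
      rcases Nat.lt_succ_iff_lt_or_eq.1 hlt with h' | rfl
      · exact h3 h h' hk
      · exact hle
    · omega
    · intro h hlt' hk'
      refine le_trans ?_ (h3 h hlt' hk)
      have := hq (Set.mem_Iic.2 hk) (Set.mem_Iic.2 hk') (Nat.le_succ _)
      simpa using this
    · have := m1.succ hk hh hlt ?_
      · simpa using this
      · intro h hh' hl
        have : s.nreg 7 ≤ h := by
          by_contra hc
          exact absurd (h3 h (not_le.1 hc) hk) (not_le.2 hl)
        have := hq' h hh' this
        simpa using this
    · have := m2.succ hk le_rfl (hlt.trans_le (by simpa using hpn _ hh))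
        (fun h hh' _ => by simpa using hpn h hh')
      simpa using this
    · have := m3.succ hk le_rfl (hlt.trans_le (by simpa using hpn _ hh))
        (fun h hh' _ => by simpa using hpn h hh')
      simpa using this
    · have := m4.succ hk hh hlt ?_
      · simpa using this
      · intro h hh' hl
        have : s.nreg 7 ≤ h := by
          by_contra hc
          exact absurd (h3 h (not_le.1 hc) hk) (not_le.2 hl)
        have := hq' h hh' this
        simpa using this
    · omega
  · simp [scanPairsBody, wp, wp_maxR, BExp.ok, BExp.holds, NExp.ok, NExp.eval, RExp.ok, RExp.eval,
      State.putN, State.putR, e, hh]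
    have hall : ∀ h ≤ n, q (s.nreg 6) + p h ≤ s.rreg 0 := fun h hh' => h3 h (by omega) hk
    refine ⟨by omega, by omega, ⟨by simpa using hk, h2, ?_, ?_, ?_, ?_, ?_⟩, ?_⟩
    · intro h hlt' hk'
      refine le_trans ?_ (h3 h hlt' hk)
      have := hq (Set.mem_Iic.2 hk) (Set.mem_Iic.2 hk') (Nat.le_succ _)
      simpa using this
    · simpa using m1.skip hall
    · simpa using m2.skip hall
    · simpa using m3.skip hall
    · simpa using m4.skip hall
    · omega

theorem scanPairs_run (hp : MonotoneOn p (Set.Iic n)) (hq : AntitoneOn q (Set.Iic n))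
    (hS : n < S) (hW : n + 2 < W) {s : State} (hd : Holds n x p q s)
    (hlam : s.rreg 0 < q 0 + p n) :
    Run c S W scanPairs (500 * (n + 1)) s (fun s' =>
      PairMax n p q (s.rreg 0) (fun k h => p k + q h) (n + 1) (s'.rreg 1) ∧
      PairMax n p q (s.rreg 0) (fun k h => q k + p h) (n + 1) (s'.rreg 2) ∧
      PairMax n p q (s.rreg 0) (fun k h => p k + p h) (n + 1) (s'.rreg 3) ∧
      PairMax n p q (s.rreg 0) (fun k h => q k + q h) (n + 1) (s'.rreg 4)) := by
  have e := hd.hn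
  have e1 := hd.hp 0 (Nat.zero_le n)
  have e2 := hd.hp n le_rfl
  have e3 := hd.hq 0 (Nat.zero_le n)
  have e4 := hd.hq n le_rfl
  refine (Run.seq (b := 100) (b' := 2 * (n + 1) * (100 + 3 + 1) + 3 + 1) (R := fun s' =>
    ScanInv n p q (s.rreg 0) s' ∧ s'.nreg 6 = 0 ∧ s'.nreg 7 = 0) (Run.of_wp ?_ (by decide)) ?_).mono
    (b := 100 + (2 * (n + 1) * (100 + 3 + 1) + 3 + 1)) (Q := fun s' =>
      ScanInv n p q (s.rreg 0) s' ∧ n < s'.nreg 6) (by omega) ?_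
  · simp [scanPairsInit, wp, NExp.ok, NExp.eval, RExp.ok, RExp.eval, State.putN, State.putR, e, e1,
      e2, e3, e4]
    refine ⟨by omega, ⟨⟨by omega, by omega⟩, by omega, by omega⟩, ?_⟩
    exact ⟨by simp, by simp, by simp, by simpa using PairMax.init (f := fun k h => p k + q h) hlam,
      by simpa using PairMax.init (f := fun k h => q k + p h) hlam,
      by simpa using PairMax.init (f := fun k h => p k + p h) hlam,
      by simpa using PairMax.init (f := fun k h => q k + q h) hlam⟩
  · rintro s₀ ⟨hI, h6, h7⟩ hs₀
    have hd₀ := hd.of_same hs₀ (by decide) (by decide) (by decide) (by decide)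
    have h0 := hs₀.rreg 0 (by decide)
    refine (Run.loop (fun s' => ScanInv n p q (s.rreg 0) s')
      (fun s => (n + 1 - s.nreg 6) + (n + 1 - s.nreg 7)) 100 hI ?_).mono ?_ ?_
    · intro s₁ hI₁ hs₁
      have hd₁ := hd₀.of_same hs₁ (by decide) (by decide) (by decide) (by decide)
      have h0' : s₁.rreg 0 = s.rreg 0 := by rw [hs₁.rreg 0 (by decide), h0]
      have hk1 := hI₁.k_le
      refine ⟨by simp [BExp.ok, NExp.ok, hd₁.hn]; omega, fun hb => ?_⟩
      have hk : s₁.nreg 6 ≤ n := by simpa [BExp.holds, NExp.eval, hd₁.hn] using hb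
      rw [← h0'] at hI₁ ⊢
      exact scanPairsBody_run hp hq hS hW hd₁ hI₁ hk
    · simp [h6, h7, BExp.cost, NExp.cost]; omega
    · rintro s₁ ⟨hI₁, hb⟩ hs₁
      have hd₁ := hd₀.of_same hs₁ (by decide) (by decide) (by decide) (by decide)
      exact ⟨hI₁, by simpa [BExp.holds, NExp.eval, hd₁.hn] using hb⟩
  · rintro s' ⟨hI, hk⟩ -
    have : s'.nreg 6 = n + 1 := le_antisymm hI.k_le hk
    have m1 := hI.m1
    have m2 := hI.m2
    have m3 := hI.m3
    have m4 := hI.m4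
    rw [this] at m1 m2 m3 m4
    exact ⟨m1, m2, m3, m4⟩

end RealRAM

/-! ### The best shortcut at a fixed threshold, by monotone sweeps -/

namespace RealRAM

/-- Slope term of the increasing part of a row. -/
noncomputable def rowInc (a₁ a₄ : ℝ) (x : ℕ → ℝ) (i : ℕ) : ℝ := max (a₁ - x i) (a₄ + x i)

/-- Slope term of the decreasing part of a row. -/
noncomputable def rowDec (a₂ a₃ : ℝ) (x : ℕ → ℝ) (i : ℕ) : ℝ := max (a₂ + x i) (a₃ - x i)

/-- The objective that a set of critical pairs with maxima `a₁, …, a₄` gives. -/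
noncomputable def pairCost (c : ℕ → ℕ → ℝ) (a₁ a₂ a₃ a₄ : ℝ) (x : ℕ → ℝ) (i j : ℕ) : ℝ :=
  max (c i j + (rowInc a₁ a₄ x i + x j)) (c i j + (rowDec a₂ a₃ x i - x j))

/-- From the crossing `J` on, the maximum is the nondecreasing term, and before it the nonincreasing
one. So the row minimum over `j > i` is at the first admissible column from `J` on, or just before
it. If there is no crossing before `n`, then `J = n`, and no column lies to the right of `j₁`. -/
theorem le_pairCost_of_crossing {c : ℕ → ℕ → ℝ} {a₁ a₂ a₃ a₄ : ℝ} {x : ℕ → ℝ} {n i j J j₁ : ℕ} {r : ℝ}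
    (hx : MonotoneOn x (Set.Iic n))
    (hinc : ∀ i j j', i < j → j ≤ j' → j' ≤ n → c i j + x j ≤ c i j' + x j')
    (hdec : ∀ i j j', i < j → j ≤ j' → j' ≤ n → c i j' - x j' ≤ c i j - x j)
    (hJ : ∀ j' < J, rowInc a₁ a₄ x i + x j' < rowDec a₂ a₃ x i - x j')
    (hJ' : J < n → rowDec a₂ a₃ x i - x J ≤ rowInc a₁ a₄ x i + x J) (hJn : J ≤ n)
    (hj₁ : j₁ = max J (i + 1)) (hij : i < j) (hj : j ≤ n)
    (h₁ : r ≤ pairCost c a₁ a₂ a₃ a₄ x i j₁)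
    (h₂ : i + 2 ≤ j₁ → r ≤ pairCost c a₁ a₂ a₃ a₄ x i (j₁ - 1)) :
    r ≤ pairCost c a₁ a₂ a₃ a₄ x i j := by
  rcases le_or_gt j₁ j with hle | hlt
  · rcases eq_or_lt_of_le hle with rfl | hlt
    · exact h₁
    · have hJn' : J < n := by omega
      have hc : rowDec a₂ a₃ x i - x j₁ ≤ rowInc a₁ a₄ x i + x j₁ := by
        have := hx (Set.mem_Iic.2 hJn'.le) (Set.mem_Iic.2 (hle.trans hj)) (show J ≤ j₁ by omega)
        linarith [hJ' hJn']
      refine h₁.trans ?_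
      have h3 := hinc i j₁ j (by omega) hle hj
      unfold pairCost
      rw [max_eq_left (by linarith)]
      exact le_max_of_le_left (by linarith)
  · have hJ1 : j₁ = J := by omega
    refine (h₂ (by omega)).trans ?_
    have hc := hJ (j₁ - 1) (by omega)
    have h3 := hdec i j (j₁ - 1) hij (by omega) (by omega)
    unfold pairCost
    rw [max_eq_right (by linarith)]
    exact le_max_of_le_right (by linarith)

/-- Compare the pair in the registers `8`, `9` with the best pair so far. -/
def tryPair : Cmd :=
  .seq (.setR 6 (.add (.oracle (.reg 8) (.reg 9)) (.add (.reg 7) (.get 2 (.reg 9))))) <|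
  .seq (maxR 6 (.add (.oracle (.reg 8) (.reg 9)) (.sub (.reg 8) (.get 2 (.reg 9))))) <|
  .cond (.rle (.reg 5) (.reg 6)) .skip <|
    .seq (.setR 5 (.reg 6)) <| .seq (.setN 10 (.reg 8)) (.setN 11 (.reg 9))

/-- The best pair so far and its cost. -/
structure BestPair (f : ℕ → ℕ → ℝ) (n : ℕ) (s : State) : Prop where
  lt : s.nreg 10 < s.nreg 11
  le : s.nreg 11 ≤ n
  eq : s.rreg 5 = f (s.nreg 10) (s.nreg 11)

variable {c : ℕ → ℕ → ℝ} {S W n : ℕ} {x p q : ℕ → ℝ}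

theorem tryPair_wp {a₁ a₂ a₃ a₄ : ℝ} {s : State} (hS : n < S) (hW : n + 2 < W)
    (hx : ∀ i ≤ n, s.rarr 2 i = x i) (hb : BestPair (pairCost c a₁ a₂ a₃ a₄ x) n s)
    (hlt : s.nreg 8 < s.nreg 9) (hle : s.nreg 9 ≤ n) (h7 : s.rreg 7 = rowInc a₁ a₄ x (s.nreg 8))
    (h8 : s.rreg 8 = rowDec a₂ a₃ x (s.nreg 8)) :
    wp c S W tryPair (fun s' => BestPair (pairCost c a₁ a₂ a₃ a₄ x) n s' ∧
      s'.rreg 5 ≤ pairCost c a₁ a₂ a₃ a₄ x (s.nreg 8) (s.nreg 9) ∧ s'.rreg 5 ≤ s.rreg 5) s := by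
  have e := hx _ hle
  obtain ⟨b1, b2, b3⟩ := hb
  simp [tryPair, wp, wp_maxR, BExp.ok, BExp.holds, NExp.ok, NExp.eval, RExp.ok, RExp.eval,
      State.putN, State.putR, e, h7, h8]
  refine ⟨⟨⟨by omega, by omega⟩, by omega, by omega⟩, ?_, ?_⟩
  · intro h
    refine ⟨⟨b1, b2, by simpa using b3⟩, ?_⟩
    rw [pairCost, le_max_iff]
    exact h
  · intro h1 h2
    refine ⟨by omega, by omega, ⟨by simpa using hlt, by simpa using hle, by simp [pairCost]⟩, ?_, ?_⟩
    · simp [pairCost]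
    · exact ⟨h1.le, h2.le⟩

/-- One round of `sweep`. -/
def sweepBody (e : NExp) : Cmd :=
  .seq (.seq (.setN 8 e) <|
    .seq (.setR 7 (.sub (.reg 1) (.get 2 (.reg 8)))) <|
    .seq (maxR 7 (.add (.reg 4) (.get 2 (.reg 8)))) <|
    .seq (.setR 8 (.add (.reg 2) (.get 2 (.reg 8)))) <|
    maxR 8 (.sub (.reg 3) (.get 2 (.reg 8)))) <|
  .cond (.and (.nle (.add (.reg 7) (.const 1)) (.reg 2))
      (.not (.rle (.sub (.reg 8) (.get 2 (.reg 7))) (.add (.reg 7) (.get 2 (.reg 7))))))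
    (.setN 7 (.add (.reg 7) (.const 1))) <|
  .seq (.seq (.setN 9 (.reg 7)) (.cond (.nle (.reg 9) (.reg 8)) (.setN 9 (.add (.reg 8) (.const 1))) .skip)) <|
  .seq tryPair <|
  .seq (.cond (.nle (.add (.reg 8) (.const 2)) (.reg 9))
    (.seq (.setN 9 (.sub (.reg 9) (.const 1))) tryPair) .skip)
  (.setN 6 (.add (.reg 6) (.const 1)))

/-- Visit the rows in the order that the expression `e` gives, with a pointer that moves only up. -/
def sweep (e : NExp) : Cmd :=
  .seq (.seq (.setN 6 (.const 0)) (.setN 7 (.const 0)))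
    (.loop (.nle (.add (.reg 6) (.const 1)) (.reg 2)) (sweepBody e))

/-- The rows are visited in an order in which the crossing moves up. -/
def SweepMono (n : ℕ) (ι : ℕ → ℕ) (a₁ a₂ a₃ a₄ : ℝ) (x : ℕ → ℝ) : Prop :=
  ∀ k k', k ≤ k' → k' < n → rowDec a₂ a₃ x (ι k) - rowInc a₁ a₄ x (ι k) ≤
    rowDec a₂ a₃ x (ι k') - rowInc a₁ a₄ x (ι k')

/-- The invariant of `sweep`. -/
structure SweepInv (c : ℕ → ℕ → ℝ) (n : ℕ) (ι : ℕ → ℕ) (a₁ a₂ a₃ a₄ : ℝ) (x : ℕ → ℝ) (v : ℝ)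
    (s : State) : Prop where
  k_le : s.nreg 6 ≤ n
  j_le : s.nreg 7 ≤ n
  best : BestPair (pairCost c a₁ a₂ a₃ a₄ x) n s
  best_le : s.rreg 5 ≤ v
  before : SweepMono n ι a₁ a₂ a₃ a₄ x → s.nreg 6 < n → ∀ j < s.nreg 7,
    rowInc a₁ a₄ x (ι (s.nreg 6)) + x j < rowDec a₂ a₃ x (ι (s.nreg 6)) - x j
  done : SweepMono n ι a₁ a₂ a₃ a₄ x → ∀ k < s.nreg 6, ∀ j ≤ n, ι k < j →
    s.rreg 5 ≤ pairCost c a₁ a₂ a₃ a₄ x (ι k) j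

/-- A round either advances the pointer or settles a row. That the rows are searched exhaustively is
asserted under `SweepMono` only, whereas the recorded pair and its cost are right in any order of
the rows. This makes it harmless to run a sweep in the wrong direction. -/
theorem sweepBody_run {e : NExp} {ι : ℕ → ℕ} {a₁ a₂ a₃ a₄ v : ℝ} (hS : n < S) (hW : n + 2 < W)
    (he : ∀ s, s.nreg 2 = n → s.nreg 6 < n → e.ok S W s ∧ e.eval s = ι (s.nreg 6))
    (hcost : e.cost ≤ 5) (hι : ∀ k < n, ι k < n) (hx : MonotoneOn x (Set.Iic n))
    (hinc : ∀ i j j', i < j → j ≤ j' → j' ≤ n → c i j + x j ≤ c i j' + x j')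
    (hdec : ∀ i j j', i < j → j ≤ j' → j' ≤ n → c i j' - x j' ≤ c i j - x j)
    {s : State} (hd : Holds n x p q s) (h1 : s.rreg 1 = a₁) (h2 : s.rreg 2 = a₂) (h3 : s.rreg 3 = a₃)
    (h4 : s.rreg 4 = a₄) (hI : SweepInv c n ι a₁ a₂ a₃ a₄ x v s) (hk : s.nreg 6 < n) :
    Run c S W (sweepBody e) 200 s (fun s' => SweepInv c n ι a₁ a₂ a₃ a₄ x v s' ∧
      (n - s'.nreg 6) + (n - s'.nreg 7) < (n - s.nreg 6) + (n - s.nreg 7)) := by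
  refine Run.of_wp ?_ (by simp [sweepBody, Cmd.maxCost, tryPair, maxR, RExp.cost, NExp.cost, BExp.cost]; omega)
  obtain ⟨i1, i2, i3, i4, i5, i6⟩ := hI
  obtain ⟨he1, he2⟩ := he s hd.hn hk
  have hιk := hι _ hk
  have ex := hd.hx (ι (s.nreg 6)) hιk.le
  have ex7 := hd.hx _ i2
  have en := hd.hn
  refine wp.seq (R := fun s' => s'.nreg 8 = ι (s.nreg 6) ∧ s'.rreg 7 = rowInc a₁ a₄ x (ι (s.nreg 6)) ∧
    s'.rreg 8 = rowDec a₂ a₃ x (ι (s.nreg 6)) ∧ BestPair (pairCost c a₁ a₂ a₃ a₄ x) n s') ?_ ?_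
  · obtain ⟨b1, b2, b3⟩ := i3
    simp [wp, wp_maxR, NExp.ok, NExp.eval, RExp.ok, RExp.eval, State.putN, State.putR, he1, he2, ex,
      h1, h2, h3, h4, rowInc, rowDec]
    exact ⟨by omega, ⟨by simpa using b1, by simpa using b2, by simpa using b3⟩⟩
  rintro s₁ ⟨j8, j7, j8', hb⟩ hs₁
  have hd₁ := hd.hx
  rw [← hs₁.rarr 2 (by simp [maxR, Cmd.wra])] at hd₁
  have k6 := hs₁.nreg 6 (by simp [maxR, Cmd.wn])
  have k7 := hs₁.nreg 7 (by simp [maxR, Cmd.wn])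
  have k2 := hs₁.nreg 2 (by simp [maxR, Cmd.wn])
  have k5 := hs₁.rreg 5 (by simp [maxR, Cmd.wr])
  have ex7' := hd₁ _ i2
  rw [← k6] at i1 i5 i6 hιk j7 j8 j8' hk
  rw [← k7] at i2 i5 ex7'
  rw [← k5] at i4 i6
  rw [← k6, ← k7]
  refine ⟨?_, ?_, ?_⟩
  · simp [BExp.ok, NExp.ok, NExp.eval, RExp.ok, BExp.holds, k2, en]
    omega
  · simp [BExp.holds, NExp.eval, RExp.eval, k2, en, ex7', j7, j8', wp, NExp.ok, State.putN]
    intro hjn hc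
    refine ⟨by omega, ⟨by simpa using i1, by simpa using hjn, ?_, i4, ?_, ?_⟩, ?_⟩
    · obtain ⟨b1, b2, b3⟩ := hb
      exact ⟨by simpa using b1, by simpa using b2, by simpa using b3⟩
    · intro hM _ j hj
      simp at hj ⊢
      rcases Nat.lt_or_eq_of_le hj with h | rfl
      · exact i5 hM hk j h
      · linarith
    · simpa using i6
    · omega
  · simp only [BExp.holds, NExp.eval, RExp.eval, k2, en, ex7', j7, j8']
    intro hc
    -- The pointer has reached the crossing or `n`. Only columns `j ≥ i + 1` are admissible, whence
    -- the maximum.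
    refine wp.seq (R := fun s' => s'.nreg 9 = max (s₁.nreg 7) (ι (s₁.nreg 6) + 1)) ?_ ?_
    · simp [wp, BExp.ok, BExp.holds, NExp.ok, NExp.eval, State.putN, j8]
      omega
    rintro s₂ h9 hs₂
    have m6 := hs₂.nreg 6 (by simp [Cmd.wn])
    have m7 := hs₂.nreg 7 (by simp [Cmd.wn])
    have m8 := hs₂.nreg 8 (by simp [Cmd.wn])
    have m10 := hs₂.nreg 10 (by simp [Cmd.wn])
    have m11 := hs₂.nreg 11 (by simp [Cmd.wn])
    have r7 := hs₂.rreg 7 (by simp [Cmd.wr])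
    have r8 := hs₂.rreg 8 (by simp [Cmd.wr])
    have r5 := hs₂.rreg 5 (by simp [Cmd.wr])
    have hx₂ := hd₁
    rw [← hs₂.rarr 2 (by simp [Cmd.wra])] at hx₂
    have hb₂ : BestPair (pairCost c a₁ a₂ a₃ a₄ x) n s₂ := by
      obtain ⟨b1, b2, b3⟩ := hb
      exact ⟨by rw [m10, m11]; exact b1, by rw [m11]; exact b2, by rw [r5, m10, m11]; exact b3⟩
    rw [← m8] at j8
    rw [← r7] at j7
    rw [← r8] at j8'
    refine wp.seq (tryPair_wp hS hW hx₂ hb₂ (by omega) (by omega) (by rw [j8]; exact j7)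
      (by rw [j8]; exact j8')) ?_
    rintro s₃ ⟨hb₃, hle₃, hle₃'⟩ hs₃
    have u6 := hs₃.nreg 6 (by decide)
    have u7 := hs₃.nreg 7 (by decide)
    have u8 := hs₃.nreg 8 (by decide)
    have u9 := hs₃.nreg 9 (by decide)
    have t7 := hs₃.rreg 7 (by decide)
    have t8 := hs₃.rreg 8 (by decide)
    have hx₃ := hx₂
    rw [← hs₃.rarr 2 (by decide)] at hx₃
    refine wp.seq (R := fun s' => BestPair (pairCost c a₁ a₂ a₃ a₄ x) n s' ∧ s'.rreg 5 ≤ s₃.rreg 5 ∧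
      (ι (s₁.nreg 6) + 2 ≤ max (s₁.nreg 7) (ι (s₁.nreg 6) + 1) → s'.rreg 5 ≤ pairCost c a₁ a₂ a₃ a₄ x (ι (s₁.nreg 6))
        (max (s₁.nreg 7) (ι (s₁.nreg 6) + 1) - 1))) ?_ ?_
    · refine ⟨?_, ?_, ?_⟩
      · simp [BExp.ok, NExp.ok, NExp.eval]
        omega
      · simp only [BExp.holds, NExp.eval]
        intro hlt
        refine ⟨by simp [NExp.ok]; omega, ?_⟩
        simp only [NExp.eval]
        have hb' : BestPair (pairCost c a₁ a₂ a₃ a₄ x) n (s₃.putN 9 (s₃.nreg 9 - 1)) := by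
          obtain ⟨b1, b2, b3⟩ := hb₃
          exact ⟨by simpa [State.putN] using b1, by simpa [State.putN] using b2,
            by simpa [State.putN] using b3⟩
        refine (tryPair_wp (s := s₃.putN 9 (s₃.nreg 9 - 1)) hS hW hx₃ hb' ?_ ?_ ?_ ?_).mono ?_
        · simp [State.putN]; omega
        · simp [State.putN]; omega
        · simp [State.putN, t7, j7, u8, j8]
        · simp [State.putN, t8, j8', u8, j8]
        · rintro s₄ ⟨hb₄, hle₄, hle₄'⟩ hs₄
          simp [State.putN, u8, j8, u9, h9] at hle₄ hle₄'
          exact ⟨hb₄, hle₄', fun _ => by simpa using hle₄⟩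
      · simp only [BExp.holds, NExp.eval, wp]
        intro hlt
        refine ⟨hb₃, le_rfl, fun h => ?_⟩
        omega
    · rintro s₄ ⟨hb₄, hle₄, hrow⟩ hs₄
      have v6 := hs₄.nreg 6 (by simp [Cmd.wn, tryPair, maxR])
      have v7 := hs₄.nreg 7 (by simp [Cmd.wn, tryPair, maxR])
      rw [j8, h9] at hle₃
      have hle5 : s₄.rreg 5 ≤ s₁.rreg 5 := (hle₄.trans hle₃').trans r5.le
      have e6 : s₄.nreg 6 = s₁.nreg 6 := by rw [v6, u6, m6]
      have e7 : s₄.nreg 7 = s₁.nreg 7 := by rw [v7, u7, m7]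
      simp [wp, NExp.ok, NExp.eval, State.putN, e6]
      refine ⟨by omega, ⟨by simpa using hk, by simpa [e7] using i2, ?_, hle5.trans i4, ?_, ?_⟩, ?_⟩
      · obtain ⟨b1, b2, b3⟩ := hb₄
        exact ⟨by simpa using b1, by simpa using b2, by simpa using b3⟩
      · simp [e7]
        intro hM hk' j hj
        have h1 := i5 hM hk j hj
        have h2 := hM _ _ (Nat.le_succ (s₁.nreg 6)) hk'
        simp at h2
        linarith
      · simp
        intro hM k hk' j hj hij
        rcases Nat.lt_or_eq_of_le hk' with hk' | rfl
        · exact hle5.trans (i6 hM k hk' j hj hij)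
        · refine le_pairCost_of_crossing hx hinc hdec (i5 hM hk) ?_ i2 rfl hij hj
            (hle₄.trans hle₃) hrow
          intro hJ
          by_contra hcc
          exact hc ⟨hJ, hcc⟩
      · simp [e7]; omega

theorem sweep_run {e : NExp} {ι : ℕ → ℕ} {a₁ a₂ a₃ a₄ : ℝ} (hS : n < S) (hW : n + 2 < W)
    (he : ∀ s, s.nreg 2 = n → s.nreg 6 < n → e.ok S W s ∧ e.eval s = ι (s.nreg 6))
    (hcost : e.cost ≤ 5) (hι : ∀ k < n, ι k < n) (hx : MonotoneOn x (Set.Iic n))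
    (hinc : ∀ i j j', i < j → j ≤ j' → j' ≤ n → c i j + x j ≤ c i j' + x j')
    (hdec : ∀ i j j', i < j → j ≤ j' → j' ≤ n → c i j' - x j' ≤ c i j - x j)
    {s : State} (hd : Holds n x p q s) (h1 : s.rreg 1 = a₁) (h2 : s.rreg 2 = a₂) (h3 : s.rreg 3 = a₃)
    (h4 : s.rreg 4 = a₄) (hb : BestPair (pairCost c a₁ a₂ a₃ a₄ x) n s) :
    Run c S W (sweep e) (1000 * (n + 1)) s (fun s' => BestPair (pairCost c a₁ a₂ a₃ a₄ x) n s' ∧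
      s'.rreg 5 ≤ s.rreg 5 ∧ (SweepMono n ι a₁ a₂ a₃ a₄ x → ∀ k < n, ∀ j ≤ n, ι k < j →
        s'.rreg 5 ≤ pairCost c a₁ a₂ a₃ a₄ x (ι k) j)) := by
  refine (Run.seq (b := 100) (b' := 2 * n * (200 + 5 + 1) + 5 + 1) (R := fun s' =>
    SweepInv c n ι a₁ a₂ a₃ a₄ x (s.rreg 5) s' ∧ s'.nreg 6 = 0 ∧ s'.nreg 7 = 0)
    (Run.of_wp ?_ (by decide)) ?_).mono (b := 100 + (2 * n * (200 + 5 + 1) + 5 + 1)) (Q := fun s' =>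
      SweepInv c n ι a₁ a₂ a₃ a₄ x (s.rreg 5) s' ∧ n ≤ s'.nreg 6) (by omega) ?_
  · obtain ⟨b1, b2, b3⟩ := hb
    simp [wp, NExp.ok, NExp.eval, State.putN]
    exact ⟨by omega, ⟨by simp, by simp, ⟨by simpa using b1, by simpa using b2, by simpa using b3⟩,
      by simp, by simp, by simp⟩⟩
  · rintro s₀ ⟨hI, h6, h7⟩ hs₀
    refine (Run.loop (SweepInv c n ι a₁ a₂ a₃ a₄ x (s.rreg 5))
      (fun s => (n - s.nreg 6) + (n - s.nreg 7)) 200 hI ?_).mono ?_ ?_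
    · intro s₁ hI₁ hs₁
      have hn : ∀ y, y ∉ [8, 7, 9, 10, 11, 6] → s₁.nreg y = s.nreg y := by
        intro y hy
        simp at hy
        rw [hs₁.nreg y (by simp [sweepBody, tryPair, maxR, Cmd.wn]; omega),
          hs₀.nreg y (by simp [Cmd.wn]; omega)]
      have hr : ∀ y, y ∉ [5, 6, 7, 8] → s₁.rreg y = s.rreg y := by
        intro y hy
        simp at hy
        rw [hs₁.rreg y (by simp [sweepBody, tryPair, maxR, Cmd.wr]; omega),
          hs₀.rreg y (by simp [Cmd.wr])]
      have ha : s₁.rarr = s.rarr := by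
        funext y
        rw [hs₁.rarr y (by simp [sweepBody, tryPair, maxR, Cmd.wra]),
          hs₀.rarr y (by simp [Cmd.wra])]
      have hd₁ : Holds n x p q s₁ :=
        ⟨by rw [hn 2 (by decide), hd.hn], by rw [ha]; exact hd.hx, by rw [ha]; exact hd.hp,
          by rw [ha]; exact hd.hq⟩
      have hk1 := hI₁.k_le
      refine ⟨by simp [BExp.ok, NExp.ok, NExp.eval, hd₁.hn]; omega, fun hb => ?_⟩
      have hk : s₁.nreg 6 < n := by simpa [BExp.holds, NExp.eval, hd₁.hn] using hb
      exact sweepBody_run hS hW he hcost hι hx hinc hdec hd₁ (by rw [hr 1 (by decide), h1])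
        (by rw [hr 2 (by decide), h2]) (by rw [hr 3 (by decide), h3]) (by rw [hr 4 (by decide), h4])
        hI₁ hk
    · simp [h6, h7, BExp.cost, NExp.cost]; omega
    · rintro s₁ ⟨hI₁, hb⟩ hs₁
      have h2 : s₁.nreg 2 = n := by
        rw [hs₁.nreg 2 (by simp [sweepBody, tryPair, maxR, Cmd.wn]), hs₀.nreg 2 (by simp [Cmd.wn]), hd.hn]
      exact ⟨hI₁, by simpa [BExp.holds, NExp.eval, h2] using hb⟩
  · rintro s' ⟨hI, hk⟩ -
    have : s'.nreg 6 = n := le_antisymm hI.k_le hk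
    have hdone := hI.done
    rw [this] at hdone
    exact ⟨hI.best, hI.best_le, hdone⟩

/-- Compute the pair of smallest cost for the critical pairs at the threshold in real register `0`. -/
def solve : Cmd :=
  .seq scanPairs <|
  .seq (.seq (.seq (.setN 8 (.const 0)) (.setN 9 (.const 1))) <|
    .seq (.seq (.setR 7 (.sub (.reg 1) (.get 2 (.reg 8)))) <|
      .seq (maxR 7 (.add (.reg 4) (.get 2 (.reg 8)))) <|
      .seq (.setR 8 (.add (.reg 2) (.get 2 (.reg 8)))) <|
      maxR 8 (.sub (.reg 3) (.get 2 (.reg 8)))) <|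
    .seq (.seq (.setR 6 (.add (.oracle (.reg 8) (.reg 9)) (.add (.reg 7) (.get 2 (.reg 9))))) <|
      maxR 6 (.add (.oracle (.reg 8) (.reg 9)) (.sub (.reg 8) (.get 2 (.reg 9))))) <|
    .seq (.setR 5 (.reg 6)) <| .seq (.setN 10 (.reg 8)) (.setN 11 (.reg 9))) <|
  .seq (sweep (.reg 6)) (sweep (.sub (.sub (.reg 2) (.const 1)) (.reg 6)))

/-- Both maxima are V-shaped with slopes `-1` and `1`, and their kinks are at `(a₃ - a₂) / 2` and
`(a₁ - a₄) / 2`. Their difference is constant outside the interval between the kinks; inside, its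
slope is `2` or `-2`, according to which kink comes first. -/
theorem rowDec_sub_rowInc_mono {a₁ a₂ a₃ a₄ y z : ℝ} (h : a₃ - a₂ ≤ a₁ - a₄) (hyz : y ≤ z) :
    max (a₂ + y) (a₃ - y) - max (a₁ - y) (a₄ + y) ≤ max (a₂ + z) (a₃ - z) - max (a₁ - z) (a₄ + z) := by
  rcases max_cases (a₂ + y) (a₃ - y) with h1 | h1 <;> rcases max_cases (a₁ - y) (a₄ + y) with h2 | h2 <;>
  rcases max_cases (a₂ + z) (a₃ - z) with h3 | h3 <;> rcases max_cases (a₁ - z) (a₄ + z) with h4 | h4 <;>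
  linarith [h1.1, h2.1, h3.1, h4.1, h1.2, h2.2, h3.2, h4.2]

theorem rowDec_sub_rowInc_anti {a₁ a₂ a₃ a₄ y z : ℝ} (h : a₁ - a₄ ≤ a₃ - a₂) (hyz : y ≤ z) :
    max (a₂ + z) (a₃ - z) - max (a₁ - z) (a₄ + z) ≤ max (a₂ + y) (a₃ - y) - max (a₁ - y) (a₄ + y) := by
  rcases max_cases (a₂ + y) (a₃ - y) with h1 | h1 <;> rcases max_cases (a₁ - y) (a₄ + y) with h2 | h2 <;>
  rcases max_cases (a₂ + z) (a₃ - z) with h3 | h3 <;> rcases max_cases (a₁ - z) (a₄ + z) with h4 | h4 <;>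
  linarith [h1.1, h2.1, h3.1, h4.1, h1.2, h2.2, h3.2, h4.2]

/-- Cost of the shortcut `(i, j)` for the pair `(k, h)` if its detour uses the shortcut. -/
noncomputable def detour (c : ℕ → ℕ → ℝ) (x p q : ℕ → ℝ) (i j k h : ℕ) : ℝ :=
  c i j + max (p k - x i) (q k + x i) + max (p h - x j) (q h + x j)

/-- All pairs `(k, h)` with `q k + p h > lam` have a detour of cost at most `r`. -/
def DetoursLe (c : ℕ → ℕ → ℝ) (n : ℕ) (x p q : ℕ → ℝ) (lam r : ℝ) (i j : ℕ) : Prop :=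
  ∀ k ≤ n, ∀ h ≤ n, lam < q k + p h → detour c x p q i j k h ≤ r

theorem pairCost_le_iff_forms {a₁ a₂ a₃ a₄ r : ℝ} {i j : ℕ} :
    pairCost c a₁ a₂ a₃ a₄ x i j ≤ r ↔
      (c i j + (a₁ - x i) + x j ≤ r ∧ c i j + (a₄ + x i) + x j ≤ r) ∧
      c i j + (a₂ + x i) - x j ≤ r ∧ c i j + (a₃ - x i) - x j ≤ r := by
  unfold pairCost rowInc rowDec
  constructor
  · intro h
    obtain ⟨h1, h2⟩ := max_le_iff.1 h
    refine ⟨⟨?_, ?_⟩, ?_, ?_⟩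
    · linarith [le_max_left (a₁ - x i) (a₄ + x i)]
    · linarith [le_max_right (a₁ - x i) (a₄ + x i)]
    · linarith [le_max_left (a₂ + x i) (a₃ - x i)]
    · linarith [le_max_right (a₂ + x i) (a₃ - x i)]
  · rintro ⟨⟨h1, h2⟩, h3, h4⟩
    refine max_le ?_ ?_
    · rcases max_cases (a₁ - x i) (a₄ + x i) with h | h <;> linarith [h.1]
    · rcases max_cases (a₂ + x i) (a₃ - x i) with h | h <;> linarith [h.1]

/-- The two maxima in a detour expand into four forms, each the sum of a term in `(k, h)` and a term
in `(i, j)`, so only the largest value of each term in `(k, h)` counts. For the converse, each of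
these values is attained at a critical pair, whose detour dominates the corresponding form. -/
theorem pairCost_le_iff {a₁ a₂ a₃ a₄ lam r : ℝ} {i j : ℕ}
    (m₁ : PairMax n p q lam (fun k h => p k + q h) (n + 1) a₁)
    (m₂ : PairMax n p q lam (fun k h => q k + p h) (n + 1) a₂)
    (m₃ : PairMax n p q lam (fun k h => p k + p h) (n + 1) a₃)
    (m₄ : PairMax n p q lam (fun k h => q k + q h) (n + 1) a₄) :
    pairCost c a₁ a₂ a₃ a₄ x i j ≤ r ↔ DetoursLe c n x p q lam r i j := by
  constructor
  · intro h k hk l hl hlt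
    have h1 := m₁.1 k (by omega) l hl hlt
    have h2 := m₂.1 k (by omega) l hl hlt
    have h3 := m₃.1 k (by omega) l hl hlt
    have h4 := m₄.1 k (by omega) l hl hlt
    obtain ⟨⟨h5, h6⟩, h7, h8⟩ := pairCost_le_iff_forms.1 h
    simp only at h1 h2 h3 h4
    unfold detour
    rcases max_cases (p k - x i) (q k + x i) with h9 | h9 <;>
      rcases max_cases (p l - x j) (q l + x j) with h10 | h10 <;> linarith [h9.1, h10.1]
  · intro h
    obtain ⟨-, k1, hk1, l1, hl1, hlt1, e1⟩ := m₁
    obtain ⟨-, k2, hk2, l2, hl2, hlt2, e2⟩ := m₂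
    obtain ⟨-, k3, hk3, l3, hl3, hlt3, e3⟩ := m₃
    obtain ⟨-, k4, hk4, l4, hl4, hlt4, e4⟩ := m₄
    have g1 := h k1 hk1 l1 hl1 hlt1
    have g2 := h k2 hk2 l2 hl2 hlt2
    have g3 := h k3 hk3 l3 hl3 hlt3
    have g4 := h k4 hk4 l4 hl4 hlt4
    unfold detour at g1 g2 g3 g4
    simp only at e1 e2 e3 e4
    refine pairCost_le_iff_forms.2 ⟨⟨?_, ?_⟩, ?_, ?_⟩
    · linarith [le_max_left (p k1 - x i) (q k1 + x i), le_max_right (p l1 - x j) (q l1 + x j)]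
    · linarith [le_max_right (p k4 - x i) (q k4 + x i), le_max_right (p l4 - x j) (q l4 + x j)]
    · linarith [le_max_right (p k2 - x i) (q k2 + x i), le_max_left (p l2 - x j) (q l2 + x j)]
    · linarith [le_max_left (p k3 - x i) (q k3 + x i), le_max_left (p l3 - x j) (q l3 + x j)]

/-- The threshold `lam` and the cost `r` are kept apart: a feasibility test compares the least `r`
with `lam`, whereas the last step of the search fixes `lam` and lets `r` vary. -/
theorem solve_run (hn : 1 ≤ n) (hp : MonotoneOn p (Set.Iic n)) (hq : AntitoneOn q (Set.Iic n))
    (hS : n < S) (hW : n + 2 < W) (hx : MonotoneOn x (Set.Iic n))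
    (hinc : ∀ i j j', i < j → j ≤ j' → j' ≤ n → c i j + x j ≤ c i j' + x j')
    (hdec : ∀ i j j', i < j → j ≤ j' → j' ≤ n → c i j' - x j' ≤ c i j - x j)
    {s : State} (hd : Holds n x p q s) (hlam : s.rreg 0 < q 0 + p n) :
    Run c S W solve (3000 * (n + 1)) s (fun s' => s'.nreg 10 < s'.nreg 11 ∧ s'.nreg 11 ≤ n ∧
      DetoursLe c n x p q (s.rreg 0) (s'.rreg 5) (s'.nreg 10) (s'.nreg 11) ∧
      ∀ i j r, i < j → j ≤ n → DetoursLe c n x p q (s.rreg 0) r i j → s'.rreg 5 ≤ r) := by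
  refine (Run.seq (scanPairs_run hp hq hS hW hd hlam) (b' := 100 + (1000 * (n + 1) + 1000 * (n + 1))) ?_).mono
    (by omega) fun _ h _ => h
  rintro s₁ ⟨m1, m2, m3, m4⟩ hs₁
  have hd₁ := hd.of_same hs₁ (by decide) (by decide) (by decide) (by decide)
  refine Run.seq (R := fun s' => BestPair (pairCost c (s₁.rreg 1) (s₁.rreg 2) (s₁.rreg 3) (s₁.rreg 4) x) n s')
    (Run.of_wp ?_ (by decide)) ?_
  · have e0 := hd₁.hx 0 (Nat.zero_le n)
    have e1 := hd₁.hx 1 hn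
    simp [wp, wp_maxR, NExp.ok, NExp.eval, RExp.ok, RExp.eval, State.putN, State.putR, e0, e1]
    refine ⟨by omega, by omega, ⟨by omega, by omega⟩, ⟨⟨by omega, by omega⟩, by omega, by omega⟩,
      by omega, by omega, ⟨by simp, by simpa using hn, by simp [pairCost, rowInc, rowDec]⟩⟩
  rintro s₂ hb₂ hs₂
  have hd₂ := hd₁.of_same hs₂ (by decide) (by decide) (by decide) (by decide)
  have hr₂ : ∀ y, 1 ≤ y → y ≤ 4 → s₂.rreg y = s₁.rreg y := fun y h1 h4 =>
    hs₂.rreg y (by simp [Cmd.wr, maxR]; omega)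
  refine Run.seq (sweep_run (ι := fun k => k) hS hW ?_ (by decide) (fun k hk => hk) hx hinc hdec hd₂
    (hr₂ 1 (by omega) (by omega)) (hr₂ 2 (by omega) (by omega)) (hr₂ 3 (by omega) (by omega))
    (hr₂ 4 (by omega) (by omega)) hb₂) ?_
  · intro s _ h6
    simp [NExp.ok, NExp.eval]
    omega
  rintro s₃ ⟨hb₃, -, hr₃⟩ hs₃
  have hd₃ := hd₂.of_same hs₃ (by decide) (by decide) (by decide) (by decide)
  have hr₃' : ∀ y, 1 ≤ y → y ≤ 4 → s₃.rreg y = s₁.rreg y := fun y h1 h4 => by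
    rw [← hr₂ y h1 h4]
    exact hs₃.rreg y (by simp [sweep, sweepBody, tryPair, Cmd.wr, maxR]; omega)
  refine (sweep_run (ι := fun k => n - 1 - k) hS hW ?_ (by decide) (fun k hk => by omega) hx hinc hdec hd₃
    (hr₃' 1 (by omega) (by omega)) (hr₃' 2 (by omega) (by omega)) (hr₃' 3 (by omega) (by omega))
    (hr₃' 4 (by omega) (by omega)) hb₃).mono le_rfl ?_
  · intro s h2 h6
    simp [NExp.ok, NExp.eval, h2]
    omega
  rintro s₄ ⟨hb₄, hle₄, hr₄⟩ -
  refine ⟨hb₄.lt, hb₄.le, (pairCost_le_iff m1 m2 m3 m4).1 hb₄.eq.ge, fun i j r hij hj hD => ?_⟩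
  refine le_trans ?_ ((pairCost_le_iff m1 m2 m3 m4).2 hD)
  -- The order of the two kinks decides whether the crossing moves up with `i` or down. The
  -- ascending sweep is exhaustive in the first case, the descending sweep in the second.
  rcases le_total (s₁.rreg 3 - s₁.rreg 2) (s₁.rreg 1 - s₁.rreg 4) with h | h
  · refine hle₄.trans (hr₃ ?_ i (by omega) j hj hij)
    intro k k' hkk hk'
    exact rowDec_sub_rowInc_mono h (hx (Set.mem_Iic.2 (by dsimp only; omega)) (Set.mem_Iic.2 (by dsimp only; omega)) hkk)
  · have := hr₄ ?_ (n - 1 - i) (by omega) j hj (by omega)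
    · rwa [show n - 1 - (n - 1 - i) = i by omega] at this
    intro k k' hkk hk'
    exact rowDec_sub_rowInc_anti h (hx (Set.mem_Iic.2 (by dsimp only; omega))
      (Set.mem_Iic.2 (by dsimp only; omega)) (by dsimp only; omega))

end RealRAM

/-! ### Listing the grid entries inside a bracket -/

namespace RealRAM

/-- The pairs of multiples of `g` whose value `q k + p h` lies strictly between `lo` and `hi`. -/
noncomputable def candidates (n : ℕ) (p q : ℕ → ℝ) (g : ℕ) (lo hi : ℝ) : Finset (ℕ × ℕ) :=
  (Finset.range (n / g + 1) ×ˢ Finset.range (n / g + 1)).filter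
    fun ab => lo < q (ab.1 * g) + p (ab.2 * g) ∧ q (ab.1 * g) + p (ab.2 * g) < hi

theorem mem_candidates {n g a b : ℕ} {p q : ℕ → ℝ} {lo hi : ℝ} (hg : 0 < g) :
    (a, b) ∈ candidates n p q g lo hi ↔ a * g ≤ n ∧ b * g ≤ n ∧
      lo < q (a * g) + p (b * g) ∧ q (a * g) + p (b * g) < hi := by
  simp [candidates, Nat.le_div_iff_mul_le hg, and_assoc]

/-- The candidates before `(a, b)` in the lexicographic order. -/
noncomputable def candidatesBefore (n : ℕ) (p q : ℕ → ℝ) (g : ℕ) (lo hi : ℝ) (a b : ℕ) :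
    Finset (ℕ × ℕ) :=
  (candidates n p q g lo hi).filter fun ab => ab.1 < a ∨ ab.1 = a ∧ ab.2 < b

/-- The multiset of the first `m` entries of an array. -/
def entries (f : ℕ → ℝ) (m : ℕ) : Multiset ℝ := (Multiset.range m).map f

theorem entries_succ (f : ℕ → ℝ) (m : ℕ) : entries f (m + 1) = f m ::ₘ entries f m := by
  simp [entries, Multiset.range_succ]

theorem entries_congr {f f' : ℕ → ℝ} {m : ℕ} (h : ∀ i < m, f i = f' i) : entries f m = entries f' m :=
  Multiset.map_congr rfl fun i hi => h i (Multiset.mem_range.1 hi)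

theorem card_entries (f : ℕ → ℝ) (m : ℕ) : (entries f m).card = m := by simp [entries]

/-- The value `q k + p h` at the registers `24`, `26`. -/
def candExp : RExp := .add (.get 4 (.reg 24)) (.get 3 (.reg 26))

/-- One round of `build`. -/
def buildBody : Cmd :=
  .cond (.and (.nle (.reg 26) (.reg 2)) (.not (.rle (.reg 10) candExp)))
    (.seq
      (.cond (.rle candExp (.reg 9)) (.setN 25 (.add (.reg 26) (.reg 3)))
        (.seq (.storeR 5 (.reg 5) candExp) (.setN 5 (.add (.reg 5) (.const 1)))))
      (.setN 26 (.add (.reg 26) (.reg 3))))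
    (.seq (.setN 24 (.add (.reg 24) (.reg 3))) (.setN 26 (.reg 25)))

/-- List the candidates for the step in register `3` in the array `5`. -/
def build : Cmd :=
  .seq (.seq (.setN 5 (.const 0)) <| .seq (.setN 24 (.const 0)) <| .seq (.setN 25 (.const 0))
    (.setN 26 (.const 0)))
  (.loop (.nle (.reg 24) (.reg 2)) buildBody)

variable {c : ℕ → ℕ → ℝ} {S W n : ℕ} {x p q : ℕ → ℝ}

/-- The invariant of `build`. -/
structure BuildInv (n : ℕ) (p q : ℕ → ℝ) (g : ℕ) (lo hi : ℝ) (a b₀ b : ℕ) (s : State) : Prop where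
  h24 : s.nreg 24 = a * g
  h25 : s.nreg 25 = b₀ * g
  h26 : s.nreg 26 = b * g
  a_le : a ≤ n / g + 1
  b₀_le : b₀ ≤ b
  b_le : b ≤ n / g + 1
  below : a * g ≤ n → ∀ b' < b₀, q (a * g) + p (b' * g) ≤ lo
  list : entries (s.rarr 5) (s.nreg 5) =
    (candidatesBefore n p q g lo hi a b).val.map fun ab => q (ab.1 * g) + p (ab.2 * g)

theorem candidatesBefore_succ {g a b : ℕ} {lo hi : ℝ} (hg : 0 < g) (ha : a * g ≤ n) (hb : b * g ≤ n)
    (h : lo < q (a * g) + p (b * g)) (h' : q (a * g) + p (b * g) < hi) :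
    (a, b) ∉ candidatesBefore n p q g lo hi a b ∧ candidatesBefore n p q g lo hi a (b + 1) =
      insert (a, b) (candidatesBefore n p q g lo hi a b) := by
  refine ⟨by simp [candidatesBefore], ?_⟩
  have hab : (a, b) ∈ candidates n p q g lo hi := (mem_candidates hg).2 ⟨ha, hb, h, h'⟩
  ext ⟨u, v⟩
  simp only [candidatesBefore, Finset.mem_filter, Finset.mem_insert, Prod.mk.injEq]
  constructor
  · rintro ⟨h1, h2⟩
    by_cases huv : u = a ∧ v = b
    · exact Or.inl huv
    · exact Or.inr ⟨h1, by omega⟩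
  · rintro (⟨rfl, rfl⟩ | ⟨h1, h2⟩)
    · exact ⟨hab, by omega⟩
    · exact ⟨h1, by omega⟩

theorem candidatesBefore_skip {g a b a' b' : ℕ} {lo hi : ℝ}
    (h : ∀ u v, (u, v) ∈ candidates n p q g lo hi → ((u < a ∨ u = a ∧ v < b) ↔ (u < a' ∨ u = a' ∧ v < b'))) :
    candidatesBefore n p q g lo hi a b = candidatesBefore n p q g lo hi a' b' := by
  ext ⟨u, v⟩
  simp only [candidatesBefore, Finset.mem_filter]
  exact and_congr_right fun hm => h u v hm

/-- Row `a` is scanned from `b₀`, as all earlier entries are at most `lo`; since `q` decreases, this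
remains true in the next row. The scan of a row stops at the first entry that is at least `hi`. Each
round lists a candidate or advances `a` or `b₀`, which bounds the number of rounds. -/
theorem buildBody_run (hp : MonotoneOn p (Set.Iic n)) (hq : AntitoneOn q (Set.Iic n)) {g a b₀ b : ℕ}
    {lo hi : ℝ} (hg : 0 < g) (hS : n < S) (hC : (candidates n p q g lo hi).card < S)
    (hW : n + 2 * g + 2 < W) (hSW : S < W) {s : State} (hd : Holds n x p q s) (h3 : s.nreg 3 = g)
    (h9 : s.rreg 9 = lo) (h10 : s.rreg 10 = hi) (hI : BuildInv n p q g lo hi a b₀ b s)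
    (hk : s.nreg 24 ≤ n) :
    Run c S W buildBody 100 s (fun s' => (∃ a' b₀' b', BuildInv n p q g lo hi a' b₀' b' s') ∧
      ((candidates n p q g lo hi).card - s'.nreg 5) + (2 * (n / g + 1) - (s'.nreg 24 + s'.nreg 25) / g) <
      ((candidates n p q g lo hi).card - s.nreg 5) + (2 * (n / g + 1) - (s.nreg 24 + s.nreg 25) / g)) := by
  refine Run.of_wp ?_ (by decide)
  obtain ⟨i24, i25, i26, ia, ib₀, ib, ibelow, ilist⟩ := hI
  have hdiv : ∀ u v : ℕ, (u * g + v * g) / g = u + v := fun u v => by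
    rw [← Nat.add_mul, Nat.mul_div_cancel _ hg]
  rw [i24] at hk
  have en := hd.hn
  have ha' : a ≤ n / g := (Nat.le_div_iff_mul_le hg).2 hk
  have hmg : n / g * g ≤ n := Nat.div_mul_le_self n g
  have hng : ∀ u, u ≤ n / g + 1 → u * g ≤ n + g := fun u hu =>
    (Nat.mul_le_mul_right g hu).trans (by rw [Nat.add_mul]; omega)
  have hbg := hng b ib
  have hbg₀ := hng b₀ (ib₀.trans ib)
  have hag := hng a ia
  have hcard : s.nreg 5 = (candidatesBefore n p q g lo hi a b).card := by
    have := congrArg Multiset.card ilist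
    simpa [card_entries] using this
  have hsub : candidatesBefore n p q g lo hi a b ⊆ candidates n p q g lo hi := Finset.filter_subset _ _
  have hcle : s.nreg 5 ≤ (candidates n p q g lo hi).card := hcard ▸ Finset.card_le_card hsub
  have ea := hd.hq _ hk
  -- The end of a row, reached at an entry that is at least `hi` or behind the last column.
  have hrow : (∀ v, b ≤ v → (a, v) ∉ candidates n p q g lo hi) → wp c S W
      (.seq (.setN 24 (.add (.reg 24) (.reg 3))) (.setN 26 (.reg 25)))
      (fun s' => (∃ a' b₀' b', BuildInv n p q g lo hi a' b₀' b' s') ∧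
      ((candidates n p q g lo hi).card - s'.nreg 5) + (2 * (n / g + 1) - (s'.nreg 24 + s'.nreg 25) / g) <
      ((candidates n p q g lo hi).card - s.nreg 5) + (2 * (n / g + 1) - (s.nreg 24 + s.nreg 25) / g)) s := by
    intro hno
    have e1 := hdiv a b₀
    have e2 := hdiv (a + 1) b₀
    have e3 : a * g + g = (a + 1) * g := by ring
    simp only [wp, NExp.ok, NExp.eval, State.putN, Function.update_apply, i24, i25, h3, e3]
    simp [e1, e2]
    refine ⟨⟨by omega, by omega, by omega⟩, by omega, ⟨a + 1, b₀, b₀, ⟨by simp, by simpa using i25, by simp,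
      by omega, le_rfl, by omega, ?_, ?_⟩⟩, by omega⟩
    · intro hk' b' hb'
      refine le_trans ?_ (ibelow hk b' hb')
      have := hq (Set.mem_Iic.2 hk) (Set.mem_Iic.2 hk') (Nat.mul_le_mul_right g (Nat.le_succ a))
      linarith
    · rw [← candidatesBefore_skip (a := a) (b := b)]
      · simpa using ilist
      · intro u v huv
        have h1 : u = a → v < b := by
          rintro rfl
          by_contra hv
          exact hno v (not_lt.1 hv) huv
        have h2 : u = a + 1 → b₀ ≤ v := by
          rintro rfl
          by_contra hv
          rw [mem_candidates hg] at huv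
          have h3 := ibelow hk v (not_le.1 hv)
          have := hq (Set.mem_Iic.2 hk) (Set.mem_Iic.2 huv.1) (Nat.mul_le_mul_right g (Nat.le_succ a))
          linarith [huv.2.2.1]
        omega
  rw [buildBody, wp]
  by_cases hb : b * g ≤ n
  · have eb := hd.hp _ hb
    have hb' : b ≤ n / g := (Nat.le_div_iff_mul_le hg).2 hb
    refine ⟨?_, ?_, ?_⟩
    · simp [BExp.ok, NExp.ok, NExp.eval, RExp.ok, BExp.holds, candExp, i24, i26, en]
      omega
    · simp [BExp.holds, NExp.eval, RExp.eval, candExp, i24, i26, en, ea, eb, wp, BExp.ok, NExp.ok, RExp.ok,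
        State.putN, State.putRA, h9, h10, h3]
      intro _ hlt
      refine ⟨by omega, fun hle => ?_, fun hlo => ?_⟩
      · have e1 := hdiv a b₀
        have e2 := hdiv a (b + 1)
        have e3 : b * g + g = (b + 1) * g := by ring
        rw [e3, i25, e1, e2]
        refine ⟨⟨by omega, by omega, by omega⟩, ⟨a, b + 1, b + 1, ⟨by simpa using i24, by simp, by simp, ia, by omega, by omega, ?_, ?_⟩⟩, ?_⟩
        · intro _ b' hb'
          refine le_trans ?_ hle
          have := hp (Set.mem_Iic.2 ((Nat.mul_le_mul_right g (Nat.lt_succ_iff.1 hb')).trans hb))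
            (Set.mem_Iic.2 hb) (Nat.mul_le_mul_right g (Nat.lt_succ_iff.1 hb'))
          linarith
        · rw [← candidatesBefore_skip (a := a) (b := b)]
          · simpa using ilist
          · intro u v huv
            rw [mem_candidates hg] at huv
            by_cases h : u = a ∧ v = b
            · obtain ⟨rfl, rfl⟩ := h
              exact absurd hle (not_le.2 huv.2.2.1)
            · omega
        · omega
      · obtain ⟨hnot, hins⟩ := candidatesBefore_succ (p := p) (q := q) hg hk hb hlo hlt
        have hc1 : s.nreg 5 + 1 ≤ (candidates n p q g lo hi).card := by
          have h1 : candidatesBefore n p q g lo hi a (b + 1) ⊆ candidates n p q g lo hi :=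
            Finset.filter_subset _ _
          have := Finset.card_le_card h1
          rw [hins, Finset.card_insert_of_notMem hnot] at this
          omega
        refine ⟨by omega, by omega, ⟨⟨by omega, by omega⟩, by omega, by omega⟩,
          ⟨by omega, by omega, by omega⟩, ⟨by omega, by omega, by omega⟩, ⟨a, b₀, b + 1, ⟨by simpa using i24, by simpa using i25, by simp; ring, ia, by omega, by omega, ibelow, ?_⟩⟩, ?_⟩
        · simp [hins, Finset.insert_val_of_notMem hnot, entries_succ]
          rw [← ilist]
          exact entries_congr fun i hi => by simp [hi.ne]
        · omega
    · intro hnot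
      refine hrow fun v hv hmem => hnot ?_
      rw [mem_candidates hg] at hmem
      simp only [BExp.holds, NExp.eval, RExp.eval, candExp, i24, i26, en, ea, eb, h10, not_le]
      refine ⟨hb, lt_of_le_of_lt ?_ hmem.2.2.2⟩
      have := hp (Set.mem_Iic.2 hb) (Set.mem_Iic.2 hmem.2.1) (Nat.mul_le_mul_right g hv)
      linarith
  · refine ⟨?_, ?_, fun _ => hrow fun v hv hmem => hb ?_⟩
    · simp [BExp.ok, NExp.ok, NExp.eval, BExp.holds, candExp, i26, en, hb]
      omega
    · intro h
      simp [BExp.holds, NExp.eval, i26, en, hb] at h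
    · rw [mem_candidates hg] at hmem
      exact (Nat.mul_le_mul_right g hv).trans hmem.2.1

/-- `build` lists the candidates. -/
theorem build_run (hp : MonotoneOn p (Set.Iic n)) (hq : AntitoneOn q (Set.Iic n)) {g : ℕ}
    {lo hi : ℝ} (hg : 0 < g) (hS : n < S) (hC : (candidates n p q g lo hi).card < S)
    (hW : n + 2 * g + 2 < W) (hSW : S < W) {s : State} (hd : Holds n x p q s) (h3 : s.nreg 3 = g)
    (h9 : s.rreg 9 = lo) (h10 : s.rreg 10 = hi) :
    Run c S W build (200 * ((candidates n p q g lo hi).card + 2 * (n / g + 1) + 1)) s (fun s' =>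
      entries (s'.rarr 5) (s'.nreg 5) =
        (candidates n p q g lo hi).val.map fun ab => q (ab.1 * g) + p (ab.2 * g)) := by
  refine (Run.seq (b := 100) (b' := ((candidates n p q g lo hi).card + 2 * (n / g + 1)) * (100 + 3 + 1) + 3 + 1)
    (R := fun s' => BuildInv n p q g lo hi 0 0 0 s' ∧ s'.nreg 5 = 0) (Run.of_wp ?_ (by decide)) ?_).mono
    (b := 100 + (((candidates n p q g lo hi).card + 2 * (n / g + 1)) * (100 + 3 + 1) + 3 + 1)) (Q := fun s' =>
      (∃ a b₀ b, BuildInv n p q g lo hi a b₀ b s') ∧ n < s'.nreg 24) (by omega) ?_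
  · simp [wp, NExp.ok, NExp.eval, State.putN]
    exact ⟨by omega, ⟨by simp, by simp, by simp, Nat.zero_le _, Nat.zero_le _, Nat.zero_le _, by simp,
      by simp [entries, candidatesBefore]⟩⟩
  · rintro s₀ ⟨hI, h5⟩ hs₀
    have hd₀ := hd.of_same hs₀ (by decide) (by decide) (by decide) (by decide)
    refine (Run.loop (fun s' => ∃ a b₀ b, BuildInv n p q g lo hi a b₀ b s')
      (fun s => ((candidates n p q g lo hi).card - s.nreg 5) +
        (2 * (n / g + 1) - (s.nreg 24 + s.nreg 25) / g)) 100 ⟨0, 0, 0, hI⟩ ?_).mono ?_ ?_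
    · rintro s₁ ⟨a, b₀, b, hI₁⟩ hs₁
      have hd₁ := hd₀.of_same hs₁ (by decide) (by decide) (by decide) (by decide)
      have h24 := hI₁.h24
      have hag : a * g ≤ n + g := by
        have h1 := Nat.mul_le_mul_right g hI₁.a_le
        have h2 := Nat.div_mul_le_self n g
        rw [Nat.add_mul] at h1
        omega
      refine ⟨by simp [BExp.ok, NExp.ok, hd₁.hn]; omega, fun hb => ?_⟩
      have hk : s₁.nreg 24 ≤ n := by simpa [BExp.holds, NExp.eval, hd₁.hn] using hb
      exact buildBody_run hp hq hg hS hC hW hSW hd₁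
        (by rw [hs₁.nreg 3 (by decide), hs₀.nreg 3 (by decide), h3])
        (by rw [hs₁.rreg 9 (by decide), hs₀.rreg 9 (by decide), h9])
        (by rw [hs₁.rreg 10 (by decide), hs₀.rreg 10 (by decide), h10]) hI₁ hk
    · have h24 := hI.h24
      have h25 := hI.h25
      simp [h5, h24, h25, BExp.cost, NExp.cost]
    · rintro s₁ ⟨hI₁, hb⟩ hs₁
      have hd₁ := hd₀.of_same hs₁ (by decide) (by decide) (by decide) (by decide)
      exact ⟨hI₁, by simpa [BExp.holds, NExp.eval, hd₁.hn] using hb⟩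
  · rintro s' ⟨⟨a, b₀, b, hI⟩, hk⟩ -
    rw [hI.list]
    congr 2
    -- The scan has stopped with `n < a * g`, so all candidates lie in earlier rows.
    refine Finset.filter_true_of_mem ?_
    rintro ⟨u, v⟩ huv
    rw [mem_candidates hg] at huv
    left
    rw [hI.h24] at hk
    exact lt_of_mul_lt_mul_right (huv.1.trans_lt hk) (Nat.zero_le g)

end RealRAM

/-! ### Bottom-up merge sort -/

namespace RealRAM

/-- The first `m` entries are sorted within each block of length `w`. -/
def BlockSorted (f : ℕ → ℝ) (w m : ℕ) : Prop :=
  ∀ a b, a ≤ b → b < m → a / w = b / w → f a ≤ f b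

/-- The multiset of the entries in `[a, b)`. -/
def segment (f : ℕ → ℝ) (a b : ℕ) : Multiset ℝ := (Finset.Ico a b).val.map f

theorem segment_succ {f : ℕ → ℝ} {a b : ℕ} (h : a ≤ b) : segment f a (b + 1) = f b ::ₘ segment f a b := by
  rw [segment, Nat.Ico_succ_right_eq_insert_Ico h, Finset.insert_val_of_notMem (by simp)]
  simp [segment]

theorem entries_add_segment {f : ℕ → ℝ} {a b : ℕ} (h : a ≤ b) : entries f a + segment f a b = entries f b := by
  induction b, h using Nat.le_induction with
  | base => simp [segment]
  | succ b hb ih => rw [segment_succ hb, entries_succ, ← ih, Multiset.add_cons]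

/-- The block that starts at `base` is being merged from `f` to `f'`: the next entries of its halves
are at `i` and `j`, and the next free place is `o`. -/
structure Merging (f f' : ℕ → ℝ) (N w base i j o : ℕ) : Prop where
  dvd : 2 * w ∣ base
  base_le : base ≤ i
  i_le : i ≤ min (base + w) N
  le_j : min (base + w) N ≤ j
  j_le : j ≤ min (base + 2 * w) N
  o_eq : o + min (base + w) N = i + j
  perm : entries f' o = entries f i + segment f (min (base + w) N) j
  sorted : BlockSorted f' (2 * w) o
  bound : ∀ a, base ≤ a → a < o → ∀ y, (i ≤ y ∧ y < min (base + w) N ∨ j ≤ y ∧ y < min (base + 2 * w) N) →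
    f' a ≤ f y

section

variable {f f' : ℕ → ℝ} {N w base i j o : ℕ}

/-- As `base = 2 * t * w`, the left half is contained in the block of number `2 * t` and width `w`.
-/
theorem Merging.sorted_left (h : Merging f f' N w base i j o) (hf : BlockSorted f w N) {y z : ℕ}
    (hy : base ≤ y) (hyz : y ≤ z) (hz : z < min (base + w) N) : f y ≤ f z := by
  obtain ⟨t, ht⟩ := h.dvd
  have h1 : ∀ u, base ≤ u → u < base + w → u / w = 2 * t := fun u hu hu' => by
    rw [Nat.div_eq_iff (by omega)]
    have : base = 2 * t * w := by rw [ht]; ring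
    constructor <;> omega
  exact hf y z hyz (by omega) (by rw [h1 y hy (by omega), h1 z (by omega) (by omega)])

theorem Merging.sorted_right (h : Merging f f' N w base i j o) (hf : BlockSorted f w N) {y z : ℕ}
    (hy : min (base + w) N ≤ y) (hyz : y ≤ z) (hz : z < min (base + 2 * w) N) : f y ≤ f z := by
  obtain ⟨t, ht⟩ := h.dvd
  have h1 : ∀ u, base + w ≤ u → u < base + 2 * w → u / w = 2 * t + 1 := fun u hu hu' => by
    rw [Nat.div_eq_iff (by omega)]
    have : base = 2 * t * w := by rw [ht]; ring
    rw [Nat.add_mul]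
    constructor <;> omega
  exact hf y z hyz (by omega) (by rw [h1 y (by omega) (by omega), h1 z (by omega) (by omega)])

theorem Merging.place (h : Merging f f' N w base i j o) (ho : o < min (base + 2 * w) N) {v : ℝ}
    (hv : ∀ a, base ≤ a → a < o → f' a ≤ v) :
    entries (Function.update f' o v) (o + 1) = v ::ₘ entries f' o ∧
    BlockSorted (Function.update f' o v) (2 * w) (o + 1) := by
  constructor
  · rw [entries_succ, Function.update_self]
    congr 1
    exact entries_congr fun a ha => Function.update_of_ne ha.ne _ _
  · intro a b hab hb hdiv
    rcases Nat.lt_or_eq_of_le (Nat.lt_succ_iff.1 hb) with hb | rfl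
    · rw [Function.update_of_ne (by omega), Function.update_of_ne (by omega)]
      exact h.sorted a b hab hb hdiv
    · rcases Nat.lt_or_eq_of_le hab with hab | rfl
      · rw [Function.update_of_ne (by omega), Function.update_self]
        refine hv a ?_ hab
        obtain ⟨t, ht⟩ := h.dvd
        have h1 := h.base_le
        have h2 := h.o_eq
        have h3 := h.le_j
        have hw : 0 < 2 * w := by omega
        have hdb : b / (2 * w) = t := by
          rw [Nat.div_eq_iff hw]
          have : base = t * (2 * w) := by rw [ht]; ring
          constructor <;> omega
        rw [hdb, Nat.div_eq_iff hw] at hdiv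
        have : base = t * (2 * w) := by rw [ht]; ring
        omega
      · exact le_rfl

/-- Both halves are sorted, so the smaller head is a lower bound for all that remains; this restores
`bound`. In turn, `bound` puts the head above everything already written to the block. -/
theorem Merging.left (h : Merging f f' N w base i j o) (hf : BlockSorted f w N)
    (hi : i < min (base + w) N) (hle : j < min (base + 2 * w) N → f i ≤ f j) :
    Merging f (Function.update f' o (f i)) N w base (i + 1) j (o + 1) := by
  have h1 := h.base_le
  have h2 := h.o_eq
  have h3 := h.le_j
  have h4 := h.j_le
  have ho : o < min (base + 2 * w) N := by omega
  obtain ⟨hperm, hsort⟩ := h.place ho (v := f i) fun a ha hao => h.bound a ha hao i (Or.inl ⟨le_rfl, hi⟩)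
  refine ⟨h.dvd, by omega, hi, h3, h4, by omega, ?_, hsort, ?_⟩
  · rw [hperm, h.perm, entries_succ, Multiset.cons_add]
  · intro a ha hao y hy
    rcases Nat.lt_or_eq_of_le (Nat.lt_succ_iff.1 hao) with hao | rfl
    · rw [Function.update_of_ne hao.ne]
      exact h.bound a ha hao y (by omega)
    · rw [Function.update_self]
      rcases hy with hy | hy
      · exact h.sorted_left hf h1 (by omega) hy.2
      · exact (hle (by omega)).trans (h.sorted_right hf h3 hy.1 hy.2)

theorem Merging.right (h : Merging f f' N w base i j o) (hf : BlockSorted f w N)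
    (hj : j < min (base + 2 * w) N) (hle : i < min (base + w) N → f j ≤ f i) :
    Merging f (Function.update f' o (f j)) N w base i (j + 1) (o + 1) := by
  have h1 := h.base_le
  have h2 := h.o_eq
  have h3 := h.le_j
  have h4 := h.i_le
  have ho : o < min (base + 2 * w) N := by omega
  obtain ⟨hperm, hsort⟩ := h.place ho (v := f j) fun a ha hao => h.bound a ha hao j (Or.inr ⟨le_rfl, hj⟩)
  refine ⟨h.dvd, h1, h4, by omega, hj, by omega, ?_, hsort, ?_⟩
  · rw [hperm, h.perm, segment_succ h3, Multiset.add_cons]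
  · intro a ha hao y hy
    rcases Nat.lt_or_eq_of_le (Nat.lt_succ_iff.1 hao) with hao | rfl
    · rw [Function.update_of_ne hao.ne]
      exact h.bound a ha hao y (by omega)
    · rw [Function.update_self]
      rcases hy with hy | hy
      · exact (hle (by omega)).trans (h.sorted_left hf h1 hy.1 hy.2)
      · exact h.sorted_right hf h3 (by omega) hy.2

end

/-- Replace the word register `r` by the minimum of its value and that of `r'`. -/
def minN (r r' : ℕ) : Cmd := .cond (.nle (.reg r) (.reg r')) .skip (.setN r (.reg r'))

theorem wp_minN {c : ℕ → ℕ → ℝ} {S W r r' : ℕ} {Q : State → Prop} {s : State} :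
    wp c S W (minN r r') Q s ↔
      (s.nreg r < W ∧ s.nreg r' < W) ∧ Q (s.putN r (min (s.nreg r) (s.nreg r'))) := by
  have hself : s.putN r (s.nreg r) = s := by simp [State.putN]
  simp only [minN, wp, BExp.ok, BExp.holds, NExp.ok, NExp.eval]
  rcases Nat.lt_or_ge (s.nreg r') (s.nreg r) with h | h
  · have := not_le.2 h
    simp only [min_eq_right h.le]
    tauto
  · rw [min_eq_left h, hself]
    tauto

/-- Start a new block if the current one is exhausted. -/
def mergeNext : Cmd :=
  .cond (.nle (.reg 23) (.reg 19))
    (.seq (.setN 20 (.reg 19)) <| .seq (.setN 22 (.add (.reg 19) (.reg 18))) <|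
      .seq (minN 22 5) <| .seq (.setN 21 (.reg 22)) <|
      .seq (.setN 23 (.add (.reg 22) (.reg 18))) (minN 23 5))
    .skip

/-- Write the next entry of the merged block. -/
def mergeStep : Cmd :=
  .seq
    (.cond (.and (.not (.nle (.reg 22) (.reg 20)))
        (.not (.and (.not (.nle (.reg 23) (.reg 21))) (.not (.rle (.get 5 (.reg 20)) (.get 5 (.reg 21)))))))
      (.seq (.storeR 6 (.reg 19) (.get 5 (.reg 20))) (.setN 20 (.add (.reg 20) (.const 1))))
      (.seq (.storeR 6 (.reg 19) (.get 5 (.reg 21))) (.setN 21 (.add (.reg 21) (.const 1)))))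
    (.setN 19 (.add (.reg 19) (.const 1)))

/-- Merge the blocks of length `w` of the array `5` in pairs into the array `6`. -/
def mergePass : Cmd :=
  .seq (.seq (.setN 19 (.const 0)) (.setN 23 (.const 0)))
    (.loop (.not (.nle (.reg 5) (.reg 19))) (.seq mergeNext mergeStep))

/-- Copy the array `6` to the array `5`. -/
def copyBack : Cmd :=
  .seq (.setN 19 (.const 0)) (.loop (.not (.nle (.reg 5) (.reg 19)))
    (.seq (.storeR 5 (.reg 19) (.get 6 (.reg 19))) (.setN 19 (.add (.reg 19) (.const 1)))))

/-- Sort the array `5`. -/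
def mergeSort : Cmd :=
  .seq (.setN 18 (.const 1)) (.loop (.not (.nle (.reg 5) (.reg 18)))
    (.seq mergePass (.seq copyBack (.setN 18 (.add (.reg 18) (.reg 18))))))

variable {c : ℕ → ℕ → ℝ} {S W : ℕ}

/-- The registers describe a block that is being merged. -/
structure InBlock (f : ℕ → ℝ) (N w base : ℕ) (s : State) : Prop where
  merging : Merging f (s.rarr 6) N w base (s.nreg 20) (s.nreg 21) (s.nreg 19)
  mid : s.nreg 22 = min (base + w) N
  last : s.nreg 23 = min (base + 2 * w) N

/-- All blocks before the place `o` are merged. -/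
structure BetweenBlocks (f : ℕ → ℝ) (N w : ℕ) (s : State) : Prop where
  last_le : s.nreg 23 ≤ s.nreg 19
  o_le : s.nreg 19 ≤ N
  dvd : s.nreg 19 < N → 2 * w ∣ s.nreg 19
  perm : entries (s.rarr 6) (s.nreg 19) = entries f (s.nreg 19)
  sorted : BlockSorted (s.rarr 6) (2 * w) (s.nreg 19)

/-- The invariant of `mergePass`. -/
def PassInv (f : ℕ → ℝ) (N w : ℕ) (s : State) : Prop :=
  BetweenBlocks f N w s ∨ ∃ base, InBlock f N w base s ∧ s.nreg 19 < s.nreg 23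

theorem InBlock.passInv {f : ℕ → ℝ} {N w base : ℕ} {s : State} (h : InBlock f N w base s) :
    PassInv f N w s := by
  have h1 := h.merging.o_eq
  have h2 := h.merging.i_le
  have h3 := h.merging.j_le
  have h4 := h.merging.le_j
  have h5 := h.last
  by_cases ho : s.nreg 19 < s.nreg 23
  · exact Or.inr ⟨base, h, ho⟩
  · refine Or.inl ⟨by omega, by omega, ?_, ?_, h.merging.sorted⟩
    · intro hlt
      -- A block that ends before `N` has not been cut off, so it has the full length `2 * w`.
      have : s.nreg 19 = base + 2 * w := by omega
      rw [this]
      exact dvd_add h.merging.dvd dvd_rfl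
    · rw [h.merging.perm, show s.nreg 20 = min (base + w) N by omega, entries_add_segment h4]
      congr 1
      omega

theorem mergeNext_wp {f : ℕ → ℝ} {N w : ℕ} {s : State} (hw : 0 < w) (hW : N + 2 * w < W) (h5 : s.nreg 5 = N)
    (h18 : s.nreg 18 = w) (hI : PassInv f N w s) (ho : s.nreg 19 < N) :
    wp c S W mergeNext (fun s' => ∃ base, InBlock f N w base s' ∧ s'.nreg 19 < s'.nreg 23) s := by
  rcases hI with hI | ⟨base, hI, hlt⟩
  · obtain ⟨h1, h2, h3, h4, h6⟩ := hI
    have hI' : ∀ s' : State, s'.rarr = s.rarr → s'.nreg 19 = s.nreg 19 → s'.nreg 20 = s.nreg 19 →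
        s'.nreg 22 = min (s.nreg 19 + w) N → s'.nreg 21 = min (s.nreg 19 + w) N →
        s'.nreg 23 = min (s.nreg 19 + 2 * w) N →
        ∃ base, InBlock f N w base s' ∧ s'.nreg 19 < s'.nreg 23 := by
      intro s' e e19 e20 e22 e21 e23
      refine ⟨s.nreg 19, ⟨⟨h3 ho, by omega, by omega, by omega, by omega, by omega, ?_, ?_, ?_⟩, e22, e23⟩, by omega⟩
      · rw [e, e19, e20, e21, h4]
        simp [segment]
      · rw [e, e19]; exact h6
      · intro a ha hao
        omega
    simp [mergeNext, wp, wp_minN, BExp.ok, BExp.holds, NExp.ok, NExp.eval, State.putN, h1, h5, h18]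
    refine ⟨by omega, by omega, by omega, by omega, by omega, by omega, by omega, ?_⟩
    obtain ⟨base, hB, -⟩ := hI' (((((s.putN 20 (s.nreg 19)).putN 22 (min (s.nreg 19 + w) N)).putN 21
      (min (s.nreg 19 + w) N)).putN 23 (min (min (s.nreg 19 + w) N + w) N))) rfl (by simp [State.putN])
      (by simp [State.putN]) (by simp [State.putN]) (by simp [State.putN]) (by simp [State.putN]; omega)
    exact ⟨⟨base, hB⟩, by omega, ho⟩
  · simp only [mergeNext, wp, BExp.ok, BExp.holds, NExp.ok, NExp.eval]
    have := hI.last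
    exact ⟨by omega, fun h => absurd hlt (not_lt.2 h), fun _ => ⟨base, hI, hlt⟩⟩

theorem mergeStep_wp {f : ℕ → ℝ} {N w base : ℕ} {s : State} (hW : N + 2 * w < W) (hSW : S < W) (hN : N ≤ S)
    (hf : BlockSorted f w N) (h5 : s.rarr 5 = f)
    (hI : InBlock f N w base s) (ho : s.nreg 19 < s.nreg 23) :
    wp c S W mergeStep (fun s' => PassInv f N w s' ∧ s'.nreg 19 = s.nreg 19 + 1) s := by
  obtain ⟨hm, hmid, hlast⟩ := hI
  have h1 := hm.o_eq
  have h2 := hm.i_le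
  have h3 := hm.j_le
  have h4 := hm.le_j
  refine wp.seq (R := fun s' => Merging f (s'.rarr 6) N w base (s'.nreg 20) (s'.nreg 21) (s'.nreg 19 + 1)) ?_ ?_
  · refine ⟨?_, ?_, ?_⟩
    · simp [BExp.ok, BExp.holds, NExp.ok, NExp.eval, RExp.ok]
      omega
    · simp [BExp.holds, NExp.eval, RExp.eval, wp, NExp.ok, RExp.ok, State.putN, State.putRA, h5]
      intro hi hle
      and_intros
      all_goals try omega
      exact hm.left hf (by omega) fun hj => hle (by omega)
    · simp [BExp.holds, NExp.eval, RExp.eval, wp, NExp.ok, RExp.ok, State.putN, State.putRA, h5]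
      intro hc
      have hj : s.nreg 21 < min (base + 2 * w) N := by
        by_cases hi : s.nreg 20 < s.nreg 22
        · have := (hc hi).1
          omega
        · omega
      and_intros
      all_goals try omega
      exact hm.right hf hj fun hi => (hc (by omega)).2.le
  · intro s' hm' hs'
    have e22 := hs'.nreg 22 (by simp [Cmd.wn])
    have e23 := hs'.nreg 23 (by simp [Cmd.wn])
    have e19 := hs'.nreg 19 (by simp [Cmd.wn])
    refine ⟨by simp [NExp.ok, NExp.eval]; omega, ?_, by simp [State.putN, NExp.eval, e19]⟩
    exact InBlock.passInv (base := base) ⟨by simpa [State.putN, NExp.eval] using hm',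
      by simpa [State.putN, NExp.eval, e22] using hmid, by simpa [State.putN, NExp.eval, e23] using hlast⟩

theorem mergePass_run {f : ℕ → ℝ} {N w : ℕ} {s : State} (hw : 0 < w) (hW : N + 2 * w < W) (hSW : S < W)
    (hN : N ≤ S) (hf : BlockSorted f w N) (h5 : s.nreg 5 = N) (h18 : s.nreg 18 = w) (ha : s.rarr 5 = f) :
    Run c S W mergePass (200 * (N + 1)) s (fun s' => entries (s'.rarr 6) N = entries f N ∧
      BlockSorted (s'.rarr 6) (2 * w) N) := by
  refine (Run.seq (b := 100) (b' := N * (100 + 4 + 1) + 4 + 1)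
    (R := fun s' => PassInv f N w s' ∧ s'.nreg 19 = 0) (Run.of_wp ?_ (by decide)) ?_).mono
    (b := 100 + (N * (100 + 4 + 1) + 4 + 1)) (Q := fun s' => PassInv f N w s' ∧ N ≤ s'.nreg 19) (by omega) ?_
  · simp [wp, NExp.ok, NExp.eval, State.putN]
    exact ⟨by omega, Or.inl ⟨by simp, by simp, by simp, by simp [entries], fun a b _ hb => by simp at hb⟩⟩
  · rintro s₀ ⟨hI, h19⟩ hs₀
    refine (Run.loop (PassInv f N w) (fun s => N - s.nreg 19) 100 hI ?_).mono ?_ ?_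
    · intro s₁ hI₁ hs₁
      have e5 : s₁.nreg 5 = N := by rw [hs₁.nreg 5 (by decide), hs₀.nreg 5 (by decide), h5]
      have e18 : s₁.nreg 18 = w := by rw [hs₁.nreg 18 (by decide), hs₀.nreg 18 (by decide), h18]
      have ea : s₁.rarr 5 = f := by rw [hs₁.rarr 5 (by decide), hs₀.rarr 5 (by decide), ha]
      have hle : s₁.nreg 19 ≤ N := by
        rcases hI₁ with h | ⟨base, h, h'⟩
        · exact h.o_le
        · have := h.last
          omega
      refine ⟨by simp [BExp.ok, NExp.ok, e5]; omega, fun hb => ?_⟩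
      have hk : s₁.nreg 19 < N := by simpa [BExp.holds, NExp.eval, e5] using hb
      refine Run.of_wp (wp.seq (mergeNext_wp hw hW e5 e18 hI₁ hk) ?_) (by decide)
      rintro s₂ ⟨base, hI₂, hlt⟩ hs₂
      have ea₂ : s₂.rarr 5 = f := by rw [hs₂.rarr 5 (by decide), ea]
      have e19 := hs₂.nreg 19 (by decide)
      refine (mergeStep_wp hW hSW hN hf ea₂ hI₂ hlt).mono ?_
      rintro s₃ ⟨hI₃, h19'⟩ -
      exact ⟨hI₃, by omega⟩
    · simp [h19, BExp.cost, NExp.cost]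
    · rintro s₁ ⟨hI₁, hb⟩ hs₁
      have e5 : s₁.nreg 5 = N := by rw [hs₁.nreg 5 (by decide), hs₀.nreg 5 (by decide), h5]
      exact ⟨hI₁, by simpa [BExp.holds, NExp.eval, e5] using hb⟩
  · rintro s' ⟨hI, hk⟩ -
    rcases hI with hI | ⟨base, hI, hlt⟩
    · have : s'.nreg 19 = N := le_antisymm hI.o_le hk
      have h1 := hI.perm
      have h2 := hI.sorted
      rw [this] at h1 h2
      exact ⟨h1, h2⟩
    · have := hI.last
      omega

theorem copyBack_run {N : ℕ} {s : State} (hW : N + 2 < W) (hSW : S < W)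
    (hN : N ≤ S) (h5 : s.nreg 5 = N) :
    Run c S W copyBack (200 * (N + 1)) s (fun s' => ∀ a < N, s'.rarr 5 a = s.rarr 6 a) := by
  refine (Run.seq (b := 100) (b' := N * (100 + 4 + 1) + 4 + 1)
    (R := fun s' => s'.nreg 19 = 0) (Run.of_wp ?_ (by decide)) ?_).mono
    (b := 100 + (N * (100 + 4 + 1) + 4 + 1)) (Q := fun s' =>
      (s'.nreg 19 ≤ N ∧ ∀ a < s'.nreg 19, s'.rarr 5 a = s.rarr 6 a) ∧ N ≤ s'.nreg 19) (by omega) ?_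
  · simp [wp, NExp.ok, NExp.eval, State.putN]
    omega
  · rintro s₀ h19 hs₀
    refine (Run.loop (fun s' => s'.nreg 19 ≤ N ∧ ∀ a < s'.nreg 19, s'.rarr 5 a = s.rarr 6 a)
      (fun s => N - s.nreg 19) 100 (by simp [h19]) ?_).mono ?_ ?_
    · rintro s₁ ⟨hle, hI₁⟩ hs₁
      have e5 : s₁.nreg 5 = N := by rw [hs₁.nreg 5 (by decide), hs₀.nreg 5 (by decide), h5]
      have ea : s₁.rarr 6 = s.rarr 6 := by rw [hs₁.rarr 6 (by decide), hs₀.rarr 6 (by decide)]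
      refine ⟨by simp [BExp.ok, NExp.ok, e5]; omega, fun hb => ?_⟩
      have hk : s₁.nreg 19 < N := by simpa [BExp.holds, NExp.eval, e5] using hb
      refine Run.of_wp ?_ (by decide)
      simp [wp, NExp.ok, NExp.eval, RExp.ok, RExp.eval, State.putN, State.putRA, ea]
      and_intros
      all_goals try omega
      intro a ha
      rcases Nat.lt_or_eq_of_le ha with h | rfl
      · rw [Function.update_of_ne h.ne, hI₁ a h]
      · simp
    · simp [h19, BExp.cost, NExp.cost]
    · rintro s₁ ⟨hI₁, hb⟩ hs₁
      have e5 : s₁.nreg 5 = N := by rw [hs₁.nreg 5 (by decide), hs₀.nreg 5 (by decide), h5]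
      exact ⟨hI₁, by simpa [BExp.holds, NExp.eval, e5] using hb⟩
  · rintro s' ⟨⟨hle, hI⟩, hk⟩ -
    exact fun a ha => hI a (by omega)

/-- `mergeSort` sorts the first `N ≤ 2 ^ T` entries within `O(N T)` steps. -/
theorem mergeSort_run {N T : ℕ} {s : State} (hT : N ≤ 2 ^ T) (hW : 3 * N + 5 < W) (hSW : S < W)
    (hN : N ≤ S) (h5 : s.nreg 5 = N) :
    Run c S W mergeSort (500 * ((N + 1) * (T + 1))) s (fun s' =>
      entries (s'.rarr 5) N = entries (s.rarr 5) N ∧ ∀ a b, a ≤ b → b < N → s'.rarr 5 a ≤ s'.rarr 5 b) := by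
  have hbig : 2 + (T * (200 * (N + 1) + (200 * (N + 1) + 4) + 4 + 1) + 4 + 1) ≤ 500 * ((N + 1) * (T + 1)) := by
    have e : 500 * ((N + 1) * (T + 1)) = 500 * (T * (N + 1)) + 500 * (N + 1) := by ring
    have e' : T * (200 * (N + 1) + (200 * (N + 1) + 4) + 4 + 1) = 400 * (T * (N + 1)) + 9 * T := by ring
    have : T ≤ T * (N + 1) := Nat.le_mul_of_pos_right _ (Nat.succ_pos N)
    omega
  refine (Run.seq (b := 2) (b' := T * (200 * (N + 1) + (200 * (N + 1) + 4) + 4 + 1) + 4 + 1)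
    (R := fun s' => s'.nreg 18 = 1) (Run.of_wp ?_ (by decide)) ?_).mono
    (b := 2 + (T * (200 * (N + 1) + (200 * (N + 1) + 4) + 4 + 1) + 4 + 1)) (Q := fun s' =>
      (∃ k ≤ T, 2 ^ k ≤ 2 * N + 1 ∧ s'.nreg 18 = 2 ^ k ∧ entries (s'.rarr 5) N = entries (s.rarr 5) N ∧
        BlockSorted (s'.rarr 5) (2 ^ k) N) ∧ N ≤ s'.nreg 18) hbig ?_
  · simp [wp, NExp.ok, NExp.eval, State.putN]
    omega
  · rintro s₀ h18 hs₀
    have ha₀ := hs₀.rarr 5 (by decide)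
    -- A round begins only if `2 ^ k < N ≤ 2 ^ T`, so there are at most `T` of them. The bound `2 *
    -- N + 1` keeps the width within a word; its `+ 1` covers `N = 0`, since the width starts at
    -- `1`.
    refine (Run.loop_potential (fun s' => ∃ k ≤ T, 2 ^ k ≤ 2 * N + 1 ∧ s'.nreg 18 = 2 ^ k ∧
        entries (s'.rarr 5) N = entries (s.rarr 5) N ∧ BlockSorted (s'.rarr 5) (2 ^ k) N)
      (fun s' => (T - Nat.log 2 (s'.nreg 18)) * (200 * (N + 1) + (200 * (N + 1) + 4) + 4 + 1))
      (fun _ => 200 * (N + 1) + (200 * (N + 1) + 4)) ⟨0, Nat.zero_le _, by simp, by simpa using h18, by rw [ha₀], ?_⟩ ?_).mono ?_ ?_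
    · intro a b _ hb h
      simp at h
      rw [h]
    · rintro s₁ ⟨k, hk, hk2, hwk, hperm, hsort⟩ hs₁
      have e5 : s₁.nreg 5 = N := by rw [hs₁.nreg 5 (by decide), hs₀.nreg 5 (by decide), h5]
      have hkpos : 0 < 2 ^ k := by positivity
      have hle : s₁.nreg 18 < W := by omega
      refine ⟨by simp [BExp.ok, NExp.ok, e5]; omega, fun hb => ?_⟩
      have hlt : 2 ^ k < N := by simpa [BExp.holds, NExp.eval, e5, hwk] using hb
      have hkT : k < T := (Nat.pow_lt_pow_iff_right (by norm_num : 1 < 2)).1 (hlt.trans_le hT)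
      refine (Run.seq (mergePass_run hkpos (by omega) hSW hN hsort e5 hwk rfl) (b' := 200 * (N + 1) + 4) ?_).mono le_rfl
        (Q := fun s' => s'.nreg 18 = 2 ^ (k + 1) ∧
        entries (s'.rarr 5) N = entries (s.rarr 5) N ∧ BlockSorted (s'.rarr 5) (2 ^ (k + 1)) N) ?_
      · rintro s₂ ⟨hp₂, hso₂⟩ hs₂
        have e5₂ : s₂.nreg 5 = N := by rw [hs₂.nreg 5 (by decide), e5]
        have e18₂ : s₂.nreg 18 = 2 ^ k := by rw [hs₂.nreg 18 (by decide), hwk]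
        refine Run.seq (copyBack_run (by omega) hSW hN e5₂) ?_
        intro s₃ hc hs₃
        have e18₃ : s₃.nreg 18 = 2 ^ k := by rw [hs₃.nreg 18 (by decide), e18₂]
        refine Run.of_wp ?_ (by decide)
        simp [wp, NExp.ok, NExp.eval, State.putN, e18₃]
        refine ⟨by omega, by ring, ?_, ?_⟩
        · rw [entries_congr hc, hp₂, hperm]
        · intro a b hab hb h
          rw [hc a (by omega), hc b hb]
          rw [pow_succ'] at h
          exact hso₂ a b hab hb h
      · rintro s₄ ⟨h18', h6, h7⟩ -
        refine ⟨⟨k + 1, hkT, by rw [pow_succ']; omega, h18', h6, h7⟩, ?_⟩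
        rw [h18', hwk, Nat.log_pow (by norm_num), Nat.log_pow (by norm_num), show T - k = T - (k + 1) + 1 by omega]
        simp only [BExp.cost, NExp.cost]
        rw [Nat.add_mul]
        omega
    · simp [h18, BExp.cost, NExp.cost]
    · rintro s₁ ⟨hI₁, hb⟩ hs₁
      have e5 : s₁.nreg 5 = N := by rw [hs₁.nreg 5 (by decide), hs₀.nreg 5 (by decide), h5]
      exact ⟨hI₁, by simpa [BExp.holds, NExp.eval, e5] using hb⟩
  · rintro s' ⟨⟨k, hk, -, h18, hperm, hsort⟩, hle⟩ -
    refine ⟨hperm, fun a b hab hb => hsort a b hab hb ?_⟩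
    rw [Nat.div_eq_of_lt (by omega), Nat.div_eq_of_lt (by omega)]

end RealRAM

/-! ### Refinement of the grid, and binary search by feasibility tests -/

namespace RealRAM

variable {c : ℕ → ℕ → ℝ} {S W n : ℕ} {x p q : ℕ → ℝ}

/-- Refining the grid multiplies the number of candidates by a constant, up to a linear term. -/
theorem card_candidates_le (hp : MonotoneOn p (Set.Iic n)) (hq : AntitoneOn q (Set.Iic n)) {g : ℕ}
    (hg : 0 < g) {lo hi : ℝ} (hlohi : lo < hi) :
    (candidates n p q g lo hi).card ≤
      8 * (candidates n p q (2 * g) lo hi).card + 8 * (n / (2 * g) + 1) := by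
  classical
  have hg2 : 0 < 2 * g := by omega
  set F := candidates n p q g lo hi with hF
  set C := candidates n p q (2 * g) lo hi with hC
  set φ : ℕ × ℕ → ℕ × ℕ := fun ab => (ab.1 / 2, ab.2 / 2) with hφ
  have hfib : F.card ≤ 4 * (F.image φ).card := by
    refine Finset.card_le_mul_card_image F 4 ?_
    rintro ⟨A, B⟩ -
    refine (Finset.card_le_card (t := ({2 * A, 2 * A + 1} : Finset ℕ) ×ˢ {2 * B, 2 * B + 1}) ?_).trans ?_
    · rintro ⟨a, b⟩ h
      simp only [Finset.mem_filter, hφ, Prod.mk.injEq] at h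
      simp only [Finset.mem_product, Finset.mem_insert, Finset.mem_singleton]
      omega
    · rw [Finset.card_product]
      exact Nat.mul_le_mul Finset.card_le_two Finset.card_le_two
  -- The largest value of the cell `(A, B)` is at the corner `(A, B + 1)`, the smallest at `(A + 1,
  -- B)`. The cells with one of these corners in `C` number at most `2 * C.card`. In the remaining
  -- cells each corner that lies on the grid is outside the bracket: the first is at least `hi`, the
  -- second at most `lo`.
  set U₁ := C.image fun ab => (ab.1, ab.2 - 1)
  set U₂ := C.image fun ab => (ab.1 - 1, ab.2)
  set X := (F.image φ).filter fun ab => (ab.1, ab.2 + 1) ∉ C ∧ (ab.1 + 1, ab.2) ∉ C with hX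
  have hcover : F.image φ ⊆ U₁ ∪ U₂ ∪ X := by
    rintro ⟨A, B⟩ h
    simp only [Finset.mem_union]
    by_cases h1 : (A, B + 1) ∈ C
    · exact Or.inl (Or.inl (Finset.mem_image.2 ⟨_, h1, rfl⟩))
    · by_cases h2 : (A + 1, B) ∈ C
      · exact Or.inl (Or.inr (Finset.mem_image.2 ⟨_, h2, rfl⟩))
      · exact Or.inr (Finset.mem_filter.2 ⟨h, h1, h2⟩)
  have hXprop : ∀ A B, (A, B) ∈ X → A * (2 * g) ≤ n ∧ B * (2 * g) ≤ n ∧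
      ((B + 1) * (2 * g) ≤ n → hi ≤ q (A * (2 * g)) + p ((B + 1) * (2 * g))) ∧
      ((A + 1) * (2 * g) ≤ n → q ((A + 1) * (2 * g)) + p (B * (2 * g)) ≤ lo) := by
    intro A B h
    rw [hX, Finset.mem_filter] at h
    obtain ⟨him, h1, h2⟩ := h
    obtain ⟨⟨a, b⟩, hab, he⟩ := Finset.mem_image.1 him
    rw [hF, mem_candidates hg] at hab
    obtain ⟨ha, hb, hlo, hhi⟩ := hab
    simp only [hφ, Prod.mk.injEq] at he
    have hA : A * (2 * g) ≤ a * g := by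
      rw [← mul_assoc]; exact Nat.mul_le_mul_right g (by omega)
    have hB : B * (2 * g) ≤ b * g := by
      rw [← mul_assoc]; exact Nat.mul_le_mul_right g (by omega)
    have hA' : a * g ≤ (A + 1) * (2 * g) := by
      rw [← mul_assoc]; exact Nat.mul_le_mul_right g (by omega)
    have hB' : b * g ≤ (B + 1) * (2 * g) := by
      rw [← mul_assoc]; exact Nat.mul_le_mul_right g (by omega)
    refine ⟨hA.trans ha, hB.trans hb, fun hn => ?_, fun hn => ?_⟩
    · by_contra hlt
      refine h1 ?_
      simp only [hC]
      rw [mem_candidates hg2]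
      refine ⟨hA.trans ha, hn, ?_, not_le.1 hlt⟩
      have e1 := hq (Set.mem_Iic.2 (hA.trans ha)) (Set.mem_Iic.2 ha) hA
      have e2 := hp (Set.mem_Iic.2 hb) (Set.mem_Iic.2 hn) hB'
      linarith
    · by_contra hlt
      refine h2 ?_
      simp only [hC]
      rw [mem_candidates hg2]
      refine ⟨hn, hB.trans hb, not_le.1 hlt, ?_⟩
      have e1 := hq (Set.mem_Iic.2 ha) (Set.mem_Iic.2 hn) hA'
      have e2 := hp (Set.mem_Iic.2 (hB.trans hb)) (Set.mem_Iic.2 hb) hB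
      linarith
  -- At most one remaining cell per antidiagonal. If `A' < A` and `B < B'`, the small corner `(A' +
  -- 1, B')` of one cell dominates the large corner `(A, B + 1)` of the other, so that `hi ≤ lo`.
  have hcross : ∀ A B A' B', (A, B) ∈ X → (A', B') ∈ X → A + B = A' + B' → ¬ A' < A := by
    intro A B A' B' h h' he hlt
    obtain ⟨h1, h2, h3, h4⟩ := hXprop A B h
    obtain ⟨h1', h2', h3', h4'⟩ := hXprop A' B' h'
    have l1 : (A' + 1) * (2 * g) ≤ A * (2 * g) := Nat.mul_le_mul_right _ hlt
    have l2 : (B + 1) * (2 * g) ≤ B' * (2 * g) := Nat.mul_le_mul_right _ (by omega)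
    have e1 := h4' (l1.trans h1)
    have e2 := h3 (l2.trans h2')
    have e3 := hq (Set.mem_Iic.2 (l1.trans h1)) (Set.mem_Iic.2 h1) l1
    have e4 := hp (Set.mem_Iic.2 (l2.trans h2')) (Set.mem_Iic.2 h2') l2
    linarith
  have hXcard : X.card ≤ 2 * (n / (2 * g)) + 1 := by
    have : X.card ≤ (Finset.range (2 * (n / (2 * g)) + 1)).card := by
      refine Finset.card_le_card_of_injOn (fun ab => ab.1 + ab.2) ?_ ?_
      · rintro ⟨A, B⟩ h
        obtain ⟨h1, h2, -⟩ := hXprop A B h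
        have h1 := (Nat.le_div_iff_mul_le hg2).2 h1
        have h2 := (Nat.le_div_iff_mul_le hg2).2 h2
        simp
        omega
      · rintro ⟨A, B⟩ h ⟨A', B'⟩ h' he
        simp only at he
        have h1 := hcross A B A' B' h h' he
        have h2 := hcross A' B' A B h' h he.symm
        simp only [Prod.mk.injEq]
        omega
    simpa using this
  have h1 : U₁.card ≤ C.card := Finset.card_image_le
  have h2 : U₂.card ≤ C.card := Finset.card_image_le
  have h3 := Finset.card_le_card hcover
  have h4 := Finset.card_union_le (U₁ ∪ U₂) X
  have h5 := Finset.card_union_le U₁ U₂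
  omega

/-- `lo` is infeasible, `hi` is feasible, and the registers `12`, `13` hold a pair that shows it. -/
structure Bracket (c : ℕ → ℕ → ℝ) (n : ℕ) (x p q : ℕ → ℝ) (lo hi : ℝ) (s : State) : Prop where
  h9 : s.rreg 9 = lo
  h10 : s.rreg 10 = hi
  hi_le : hi ≤ q 0 + p n
  infeasible : ∀ i j, i < j → j ≤ n → ¬ DetoursLe c n x p q lo lo i j
  lt : s.nreg 12 < s.nreg 13
  le : s.nreg 13 ≤ n
  feasible : DetoursLe c n x p q hi hi (s.nreg 12) (s.nreg 13)

/-- A larger threshold leaves fewer critical pairs, and a larger `r` allows longer detours. Hence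
the feasible thresholds form an upper set, and binary search applies. -/
theorem DetoursLe.mono {lam lam' r r' : ℝ} {i j : ℕ} (h : DetoursLe c n x p q lam r i j)
    (hl : lam ≤ lam') (hr : r ≤ r') : DetoursLe c n x p q lam' r' i j :=
  fun k hk l hl' hlt => (h k hk l hl' (hl.trans_lt hlt)).trans hr

theorem Bracket.lo_lt_hi {lo hi : ℝ} {s : State} (h : Bracket c n x p q lo hi s) : lo < hi := by
  by_contra hc
  exact h.infeasible _ _ h.lt h.le (h.feasible.mono (not_lt.1 hc) (not_lt.1 hc))

/-- Test the feasibility of the middle entry of the list. -/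
def probe : Cmd :=
  .seq (.seq (.setN 17 (.div (.add (.reg 14) (.reg 15)) (.const 2))) (.setR 0 (.get 5 (.reg 17)))) <|
  .seq solve <|
  .cond (.rle (.reg 5) (.reg 0))
    (.seq (.setR 10 (.reg 0)) <| .seq (.setN 15 (.reg 17)) <| .seq (.setN 12 (.reg 10)) (.setN 13 (.reg 11)))
    (.seq (.setR 9 (.reg 0)) (.setN 14 (.add (.reg 17) (.const 1))))

/-- One round of `bisect`. -/
def bisectBody : Cmd :=
  .seq (.cond (.nle (.reg 15) (.reg 14)) .skip probe) (.setN 16 (.sub (.reg 16) (.const 1)))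

/-- Binary search in the sorted list, with the number of rounds in the word register `16`. -/
def bisect : Cmd :=
  .seq (.seq (.setN 14 (.const 0)) (.setN 15 (.reg 5))) (.loop (.nle (.const 1) (.reg 16)) bisectBody)

/-- The invariant of `bisect`. -/
structure BisectInv (c : ℕ → ℕ → ℝ) (n : ℕ) (x p q : ℕ → ℝ) (f : ℕ → ℝ) (N B : ℕ) (lo₀ hi₀ lo hi : ℝ)
    (s : State) : Prop where
  bracket : Bracket c n x p q lo hi s
  l_le : s.nreg 14 ≤ s.nreg 15
  h_le : s.nreg 15 ≤ N
  lo_le : lo₀ ≤ lo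
  hi_le : hi ≤ hi₀
  below : ∀ a < s.nreg 14, f a ≤ lo
  above : ∀ a, s.nreg 15 ≤ a → a < N → hi ≤ f a
  b_le : s.nreg 16 ≤ B
  halved : (s.nreg 15 - s.nreg 14) * 2 ^ B ≤ N * 2 ^ s.nreg 16

/-- The assumptions under which `solve` works. -/
structure Solvable (c : ℕ → ℕ → ℝ) (S W n : ℕ) (x p q : ℕ → ℝ) : Prop where
  one_le : 1 ≤ n
  p_mono : MonotoneOn p (Set.Iic n)
  q_anti : AntitoneOn q (Set.Iic n)
  x_mono : MonotoneOn x (Set.Iic n)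
  c_inc : ∀ i j j', i < j → j ≤ j' → j' ≤ n → c i j + x j ≤ c i j' + x j'
  c_dec : ∀ i j j', i < j → j ≤ j' → j' ≤ n → c i j' - x j' ≤ c i j - x j
  size : S = 16 * (n + 1) + 1
  word : 100 * (n + 1) ≤ W

/-- The threshold `f m` is feasible iff the least cost of a shortcut at it is at most `f m`.
Depending on the outcome it becomes the new `hi` or the new `lo`, and at most half of the window
remains. -/
theorem probe_run (hs : Solvable c S W n x p q) {f : ℕ → ℝ} {N B : ℕ} {lo₀ hi₀ lo hi : ℝ}
    (hN : N < S) (hf : ∀ a b, a ≤ b → b < N → f a ≤ f b) (hf' : ∀ a < N, lo₀ < f a ∧ f a < hi₀)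
    (hhi₀ : hi₀ ≤ q 0 + p n) {s : State}
    (hd : Holds n x p q s) (ha : s.rarr 5 = f) (hI : BisectInv c n x p q f N B lo₀ hi₀ lo hi s)
    (hlt : s.nreg 14 < s.nreg 15) (hb : 1 ≤ s.nreg 16) :
    Run c S W probe (3000 * (n + 1) + 50) s (fun s' => s'.nreg 16 = s.nreg 16 ∧
      ∃ lo hi, BisectInv c n x p q f N B lo₀ hi₀ lo hi (s'.putN 16 (s.nreg 16 - 1))) := by
  have hS := hs.size
  have hW := hs.word
  obtain ⟨i1, i2, i3, i4, i5, i6, i7, i8, i9⟩ := hI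
  set m := (s.nreg 14 + s.nreg 15) / 2 with hm
  have hmN : m < N := by omega
  refine (Run.seq (b := 15) (b' := 3000 * (n + 1) + 20) (R := fun s' => s'.nreg 17 = m ∧ s'.rreg 0 = f m)
    (Run.of_wp ?_ (by decide)) ?_).mono (by omega) fun _ h _ => h
  · simp [wp, NExp.ok, NExp.eval, RExp.ok, RExp.eval, State.putN, State.putR, ha, ← hm]
    omega
  rintro s₁ ⟨h17, h0⟩ hs₁
  have hd₁ := hd.of_same hs₁ (by decide) (by decide) (by decide) (by decide)
  refine Run.seq (solve_run hs.one_le hs.p_mono hs.q_anti (by omega) (by omega) hs.x_mono hs.c_inc hs.c_dec hd₁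
    (by rw [h0]; exact (hf' m hmN).2.trans_le hhi₀)) ?_
  rintro s₂ ⟨hlt₂, hle₂, hD₂, hopt₂⟩ hs₂
  rw [h0] at hD₂ hopt₂
  have hreg : ∀ y, y ∉ [6, 7, 8, 9, 10, 11, 17] → s₂.nreg y = s.nreg y := by
    intro y hy
    rw [hs₂.nreg y ?_, hs₁.nreg y ?_]
    · simp [Cmd.wn] at hy ⊢; tauto
    · simp [solve, scanPairs, scanPairsInit, scanPairsBody, sweep, sweepBody, tryPair, maxR, Cmd.wn] at hy ⊢
      tauto
  have e17 : s₂.nreg 17 = m := by rw [hs₂.nreg 17 (by decide), h17]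
  have e0 : s₂.rreg 0 = f m := by rw [hs₂.rreg 0 (by decide), h0]
  have e9 : s₂.rreg 9 = lo := by rw [hs₂.rreg 9 (by decide), hs₁.rreg 9 (by decide), i1.h9]
  have e10 : s₂.rreg 10 = hi := by rw [hs₂.rreg 10 (by decide), hs₁.rreg 10 (by decide), i1.h10]
  have e12 := hreg 12 (by decide)
  have e13 := hreg 13 (by decide)
  have e14 := hreg 14 (by decide)
  have e15 := hreg 15 (by decide)
  have e16 := hreg 16 (by decide)
  have hpow : 2 ^ s.nreg 16 = 2 * 2 ^ (s.nreg 16 - 1) := by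
    rw [← pow_succ', Nat.sub_add_cancel hb]
  refine Run.of_wp ?_ (b := 20) (by decide)
  refine ⟨by simp [BExp.ok, RExp.ok], ?_, ?_⟩
  · simp only [BExp.holds, RExp.eval, e0]
    intro hfeas
    have hfe : DetoursLe c n x p q (f m) (f m) (s₂.nreg 10) (s₂.nreg 11) := hD₂.mono le_rfl hfeas
    simp [wp, NExp.ok, NExp.eval, RExp.ok, RExp.eval, State.putN, State.putR, e0, e17, e16]
    refine ⟨by omega, by omega, by omega, lo, f m, ⟨⟨by simp [e9], by simp, (hf' m hmN).2.le.trans hhi₀, i1.infeasible,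
      by simpa using hlt₂, by simpa using hle₂, by simpa using hfe⟩, by simp [e14]; omega, by simp; omega, i4, (hf' m hmN).2.le, by simpa [e14] using i6, ?_,
      by simp; omega, ?_⟩⟩
    · simp
      exact fun a ha haN => hf m a ha haN
    · simp [e14]
      have h1 : (m - s.nreg 14) * 2 ≤ s.nreg 15 - s.nreg 14 := by omega
      have h2 := Nat.mul_le_mul_right (2 ^ B) h1
      rw [hpow] at i9
      nlinarith
  · simp only [BExp.holds, RExp.eval, e0]
    intro hinf
    have hinfe : ∀ i j, i < j → j ≤ n → ¬ DetoursLe c n x p q (f m) (f m) i j := fun i j hij hj hD =>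
      hinf (hopt₂ i j _ hij hj hD)
    simp [wp, NExp.ok, NExp.eval, RExp.ok, RExp.eval, State.putN, State.putR, e0, e17, e16]
    refine ⟨⟨by omega, by omega, by omega⟩, f m, hi, ⟨⟨by simp, by simp [e10], i1.hi_le, hinfe,
      by simpa [e12, e13] using i1.lt, by simpa [e13] using i1.le, by simpa [e12, e13] using i1.feasible⟩,
      by simp [e15]; omega, by simpa [e15] using i3, (hf' m hmN).1.le, i5, ?_, by simpa [e15] using i7,
      by simp; omega, ?_⟩⟩
    · simp
      exact fun a ha => hf a m (by omega) hmN
    · simp [e15]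
      have h1 : (s.nreg 15 - (m + 1)) * 2 ≤ s.nreg 15 - s.nreg 14 := by omega
      have h2 := Nat.mul_le_mul_right (2 ^ B) h1
      rw [hpow] at i9
      nlinarith

theorem bisectBody_run (hs : Solvable c S W n x p q) {f : ℕ → ℝ} {N B : ℕ} {lo₀ hi₀ lo hi : ℝ}
    (hN : N < S) (hB : B < W) (hf : ∀ a b, a ≤ b → b < N → f a ≤ f b) (hf' : ∀ a < N, lo₀ < f a ∧ f a < hi₀)
    (hhi₀ : hi₀ ≤ q 0 + p n) {s : State}
    (hd : Holds n x p q s) (ha : s.rarr 5 = f) (hI : BisectInv c n x p q f N B lo₀ hi₀ lo hi s)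
    (hb : 1 ≤ s.nreg 16) :
    Run c S W bisectBody (3000 * (n + 1) + 60) s (fun s' =>
      (∃ lo hi, BisectInv c n x p q f N B lo₀ hi₀ lo hi s') ∧ s'.nreg 16 < s.nreg 16) := by
  have hS := hs.size
  have hW := hs.word
  have hbl := hI.b_le
  have h14 := hI.l_le
  have h15 := hI.h_le
  refine (Run.seq (b := 3 + 1 + (3000 * (n + 1) + 50)) (b' := 4) (R := fun s' => s'.nreg 16 = s.nreg 16 ∧
    ∃ lo hi, BisectInv c n x p q f N B lo₀ hi₀ lo hi (s'.putN 16 (s.nreg 16 - 1))) ?_ ?_).mono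
    (by omega) fun _ h _ => h
  · refine Run.cond (by simp [BExp.ok, NExp.ok]; omega) ?_ ?_
    · simp only [BExp.holds, NExp.eval]
      intro hle
      refine Run.of_wp ?_ (b := 3000 * (n + 1) + 50) (by simp [Cmd.maxCost])
      obtain ⟨⟨j1, j2, j3, j4, j5, j6, j7⟩, i2, i3, i4, i5, i6, i7, i8, i9⟩ := hI
      refine ⟨rfl, lo, hi, ⟨⟨j1, j2, j3, j4, by simpa [State.putN] using j5, by simpa [State.putN] using j6,
        by simpa [State.putN] using j7⟩, by simpa [State.putN] using i2, by simpa [State.putN] using i3, i4, i5,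
        by simpa [State.putN] using i6, by simpa [State.putN] using i7, by simp [State.putN]; omega, ?_⟩⟩
      simp [State.putN, Nat.sub_eq_zero_of_le hle]
    · simp only [BExp.holds, NExp.eval, not_le]
      intro hlt
      exact probe_run hs hN hf hf' hhi₀ hd ha hI hlt hb
  · rintro s' ⟨h16, hI'⟩ -
    refine Run.of_wp ⟨by simp [NExp.ok]; omega, ?_⟩ (by decide)
    simp only [NExp.eval, h16]
    exact ⟨hI', by simp [State.putN]; omega⟩

/-- Entries to the left of the final window are at most `lo'`, those to its right at least `hi'`;
ties are harmless because the bracket is open. After `B` rounds the window holds at most `N / 2 ^ B`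
entries. -/
theorem bisect_run (hs : Solvable c S W n x p q) {f : ℕ → ℝ} {N B : ℕ} {lo hi : ℝ}
    (hN : N < S) (hB : B < W) (hf : ∀ a b, a ≤ b → b < N → f a ≤ f b) (hf' : ∀ a < N, lo < f a ∧ f a < hi)
    {s : State} (hd : Holds n x p q s) (ha : s.rarr 5 = f) (h5 : s.nreg 5 = N) (h16 : s.nreg 16 = B)
    (hbr : Bracket c n x p q lo hi s) :
    Run c S W bisect ((B + 1) * (3000 * (n + 1) + 100)) s (fun s' => ∃ lo' hi', Bracket c n x p q lo' hi' s' ∧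
      lo ≤ lo' ∧ hi' ≤ hi ∧ ∃ l h, (h - l) * 2 ^ B ≤ N ∧ ∀ a < N, lo' < f a → f a < hi' → l ≤ a ∧ a < h) := by
  have hS := hs.size
  have hW := hs.word
  refine (Run.seq (b := 4) (b' := B * (3000 * (n + 1) + 60 + 3 + 1) + 3 + 1) (R := fun s' =>
    BisectInv c n x p q f N B lo hi lo hi s' ∧ s'.nreg 16 = B) (Run.of_wp ?_ (by decide)) ?_).mono
    (Q := fun s' => (∃ lo' hi', BisectInv c n x p q f N B lo hi lo' hi' s') ∧ s'.nreg 16 < 1) ?_ ?_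
  · simp [wp, NExp.ok, NExp.eval, State.putN, h16, h5]
    obtain ⟨j1, j2, j3, j4, j5, j6, j7⟩ := hbr
    refine ⟨by omega, by omega, ⟨⟨j1, j2, j3, j4, by simpa using j5, by simpa using j6, by simpa using j7⟩, ?_, ?_, le_rfl,
      le_rfl, ?_, ?_, ?_, ?_⟩⟩ <;> simp [h16]
    intro a h1 h2
    omega
  · rintro s₀ ⟨hI, h16₀⟩ hs₀
    have hd₀ := hd.of_same hs₀ (by decide) (by decide) (by decide) (by decide)
    refine (Run.loop (fun s' => ∃ lo' hi', BisectInv c n x p q f N B lo hi lo' hi' s')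
      (fun s => s.nreg 16) (3000 * (n + 1) + 60) ⟨lo, hi, hI⟩ ?_).mono ?_ ?_
    · rintro s₁ ⟨lo', hi', hI₁⟩ hs₁
      have hd₁ := hd₀.of_same hs₁ (by decide) (by decide) (by decide) (by decide)
      have hbl := hI₁.b_le
      refine ⟨by simp [BExp.ok, NExp.ok]; omega, fun hb => ?_⟩
      exact bisectBody_run hs hN hB hf hf' hbr.hi_le hd₁
        (by rw [hs₁.rarr 5 (by decide), hs₀.rarr 5 (by decide), ha]) hI₁
        (by simpa [BExp.holds, NExp.eval] using hb)
    · simp [h16₀, BExp.cost, NExp.cost]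
    · rintro s₁ ⟨hI₁, hb⟩ hs₁
      exact ⟨hI₁, by simpa [BExp.holds, NExp.eval] using hb⟩
  · have : (B + 1) * (3000 * (n + 1) + 100) = B * (3000 * (n + 1) + 60 + 3 + 1) + 36 * B + (3000 * (n + 1) + 100) := by ring
    omega
  · rintro s' ⟨⟨lo', hi', hI⟩, h0⟩ -
    refine ⟨lo', hi', hI.bracket, hI.lo_le, hI.hi_le, s'.nreg 14, s'.nreg 15, ?_, fun a haN h1 h2 => ⟨?_, ?_⟩⟩
    · have := hI.halved
      rwa [show s'.nreg 16 = 0 by omega, pow_zero, mul_one] at this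
    · by_contra hlt
      exact absurd (hI.below a (not_le.1 hlt)) (not_le.2 h1)
    · by_contra hlt
      exact absurd (hI.above a (not_lt.1 hlt) haN) (not_le.2 h2)

end RealRAM

/-! ### The levels of the search, and the final choice -/

namespace RealRAM

variable {c : ℕ → ℕ → ℝ} {S W n : ℕ} {x p q : ℕ → ℝ}

/-- Process one level of the grid and halve the step. -/
def level : Cmd :=
  .seq build <| .seq mergeSort <|
  .seq (.cond (.nle (.reg 3) (.const 1)) (.setN 16 (.add (.reg 4) (.const 5))) (.setN 16 (.const 4))) <|
  .seq bisect (.setN 3 (.div (.reg 3) (.const 2)))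

/-- Number of probes at the step `g`. -/
def probes (K g : ℕ) : ℕ := if g ≤ 1 then K + 5 else 4

/-- Bound for the cost of one level. -/
def levelCost (n K g : ℕ) : ℕ :=
  12400 * ((n / g + 1) * (K + 5)) + (probes K g + 1) * (3100 * (n + 1)) + 50

/-- Candidates are index pairs and may share values. The list is therefore compared as a multiset,
and counting with multiplicity carries over to the sorted array. -/
theorem card_le_of_window {g N l h : ℕ} {f : ℕ → ℝ} {lo hi lo' hi' : ℝ}
    (hlist : entries f N = (candidates n p q g lo hi).val.map fun ab => q (ab.1 * g) + p (ab.2 * g))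
    (hlo : lo ≤ lo') (hhi : hi' ≤ hi) (hwin : ∀ a < N, lo' < f a → f a < hi' → l ≤ a ∧ a < h) :
    (candidates n p q g lo' hi').card ≤ h - l := by
  classical
  have h1 : (candidates n p q g lo' hi').card =
      ((candidates n p q g lo hi).val.map fun ab => q (ab.1 * g) + p (ab.2 * g)).countP
        fun v => lo' < v ∧ v < hi' := by
    rw [Multiset.countP_map]
    have : candidates n p q g lo' hi' = (candidates n p q g lo hi).filter
        fun ab => lo' < q (ab.1 * g) + p (ab.2 * g) ∧ q (ab.1 * g) + p (ab.2 * g) < hi' := by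
      ext ab
      simp only [candidates, Finset.mem_filter]
      constructor
      · rintro ⟨h1, h2, h3⟩
        exact ⟨⟨h1, hlo.trans_lt h2, h3.trans_le hhi⟩, h2, h3⟩
      · rintro ⟨⟨h1, -⟩, h2⟩
        exact ⟨h1, h2⟩
    rw [this]
    rfl
  rw [h1, ← hlist, entries, Multiset.countP_map]
  have h2 : ((Finset.range N).filter fun a => lo' < f a ∧ f a < hi') ⊆ Finset.Ico l h := by
    intro a ha
    simp only [Finset.mem_filter, Finset.mem_range] at ha
    rw [Finset.mem_Ico]
    exact hwin a ha.1 ha.2.1 ha.2.2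
  have := Finset.card_le_card h2
  rw [Nat.card_Ico] at this
  exact this

theorem level_run (hs : Solvable c S W n x p q) {K l : ℕ} {lo hi : ℝ} (hK : n < 2 ^ K) (hK' : 2 ^ K ≤ 2 * n)
    (hl : l ≤ K) {s : State} (hd : Holds n x p q s) (h3 : s.nreg 3 = 2 ^ l) (h4 : s.nreg 4 = K)
    (hbr : Bracket c n x p q lo hi s)
    (hcard : (candidates n p q (2 ^ l) lo hi).card ≤ 16 * (n / (2 * 2 ^ l) + 1)) :
    Run c S W level (levelCost n K (2 ^ l)) s (fun s' => ∃ lo' hi', Bracket c n x p q lo' hi' s' ∧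
      s'.nreg 3 = 2 ^ l / 2 ∧
      (candidates n p q (2 ^ l) lo' hi').card * 2 ^ probes K (2 ^ l) ≤ 16 * (n / (2 * 2 ^ l) + 1)) := by
  have hS := hs.size
  have hW := hs.word
  set g := 2 ^ l with hg
  have hgpos : 0 < g := by positivity
  have hgK : g ≤ 2 ^ K := Nat.pow_le_pow_right (by norm_num) hl
  have hdiv : n / (2 * g) ≤ n / g := Nat.div_le_div_left (by omega) hgpos
  have hdivn : n / g ≤ n := Nat.div_le_self n g
  have hdiv0 := Nat.zero_le (n / g)
  have hKn : K < 2 ^ K := Nat.lt_two_pow_self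
  set N := (candidates n p q g lo hi).card with hN
  -- `N ≤ 16 * (n + 1)`, which explains the array size `16 * (n + 1) + 1`. With `n < 2 ^ K` the same
  -- bound gives `N ≤ 2 ^ (K + 4)`.
  have hNS : N < S := by omega
  have hNT : N ≤ 2 ^ (K + 4) := by
    rw [pow_add]
    omega
  have hcost : 200 * (N + 2 * (n / g + 1) + 1) + (500 * ((N + 1) * (K + 4 + 1)) + (10 +
      ((probes K g + 1) * (3000 * (n + 1) + 100) + 4))) ≤ levelCost n K g := by
    have e1 : (N + 1) * (K + 4 + 1) ≤ (17 * (n / g + 1)) * (K + 5) := Nat.mul_le_mul (by omega) (by omega)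
    have e2 : n / g + 1 ≤ (n / g + 1) * (K + 5) := Nat.le_mul_of_pos_right _ (by omega)
    have e3 : (probes K g + 1) * (3000 * (n + 1) + 100) ≤ (probes K g + 1) * (3100 * (n + 1)) :=
      Nat.mul_le_mul_left _ (by omega)
    rw [mul_assoc] at e1
    have e4 := Nat.zero_le ((n / g + 1) * (K + 5))
    unfold levelCost
    omega
  refine (Run.seq (build_run hs.p_mono hs.q_anti hgpos (by omega) hNS (by omega) (by omega) hd h3 hbr.h9 hbr.h10)
    ?_).mono (b := _ + (500 * ((N + 1) * (K + 4 + 1)) + (10 +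
      ((probes K g + 1) * (3000 * (n + 1) + 100) + 4)))) hcost fun _ h _ => h
  intro s₁ hlist₁ hs₁
  have h5 : s₁.nreg 5 = N := by
    have := congrArg Multiset.card hlist₁
    simpa [card_entries] using this
  rw [h5] at hlist₁
  refine Run.seq (mergeSort_run hNT (by omega) (by omega) hNS.le h5) ?_
  rintro s₂ ⟨hperm, hsort⟩ hs₂
  rw [hlist₁] at hperm
  have e3 : s₂.nreg 3 = g := by rw [hs₂.nreg 3 (by decide), hs₁.nreg 3 (by decide), h3]
  have e4 : s₂.nreg 4 = K := by rw [hs₂.nreg 4 (by decide), hs₁.nreg 4 (by decide), h4]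
  have e5 : s₂.nreg 5 = N := by rw [hs₂.nreg 5 (by decide), h5]
  have hd₂ := (hd.of_same hs₁ (by decide) (by decide) (by decide) (by decide)).of_same hs₂ (by decide) (by decide)
    (by decide) (by decide)
  refine Run.seq (R := fun s' => s'.nreg 16 = probes K g) (Run.of_wp ?_ (by decide)) ?_
  · simp [wp, BExp.ok, BExp.holds, NExp.ok, NExp.eval, State.putN, e3, e4, probes]
    refine ⟨by omega, fun h => ⟨by omega, by omega⟩, fun h => ⟨by omega, by omega⟩⟩
  intro s₃ h16 hs₃
  have hd₃ := hd₂.of_same hs₃ (by decide) (by decide) (by decide) (by decide)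
  have hbr₃ : Bracket c n x p q lo hi s₃ := by
    have e12 : s₃.nreg 12 = s.nreg 12 := by rw [hs₃.nreg 12 (by decide), hs₂.nreg 12 (by decide), hs₁.nreg 12 (by decide)]
    have e13 : s₃.nreg 13 = s.nreg 13 := by rw [hs₃.nreg 13 (by decide), hs₂.nreg 13 (by decide), hs₁.nreg 13 (by decide)]
    have e9 : s₃.rreg 9 = s.rreg 9 := by rw [hs₃.rreg 9 (by decide), hs₂.rreg 9 (by decide), hs₁.rreg 9 (by decide)]
    have e10 : s₃.rreg 10 = s.rreg 10 := by rw [hs₃.rreg 10 (by decide), hs₂.rreg 10 (by decide), hs₁.rreg 10 (by decide)]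
    obtain ⟨j1, j2, j3, j4, j5, j6, j7⟩ := hbr
    exact ⟨e9.trans j1, e10.trans j2, j3, j4, by rwa [e12, e13], by rwa [e13], by rwa [e12, e13]⟩
  have hf' : ∀ a < N, lo < s₂.rarr 5 a ∧ s₂.rarr 5 a < hi := by
    intro a ha
    have hmem : s₂.rarr 5 a ∈ entries (s₂.rarr 5) N := Multiset.mem_map_of_mem _ (Multiset.mem_range.2 ha)
    rw [hperm, Multiset.mem_map] at hmem
    obtain ⟨⟨u, v⟩, huv, he⟩ := hmem
    rw [← he]
    exact ((mem_candidates hgpos).1 huv).2.2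
  have hpW : probes K g < W := by
    unfold probes
    split_ifs <;> omega
  refine Run.seq (bisect_run hs hNS hpW hsort hf' hd₃ (hs₃.rarr 5 (by decide))
    (by rw [hs₃.nreg 5 (by decide), e5]) h16 hbr₃) ?_
  rintro s₄ ⟨lo', hi', hbr₄, hlo, hhi, a, b, hab, hwin⟩ hs₄
  have e3₄ : s₄.nreg 3 = g := by rw [hs₄.nreg 3 (by decide), hs₃.nreg 3 (by decide), e3]
  refine Run.of_wp ?_ (by decide)
  simp [wp, NExp.ok, NExp.eval, State.putN, e3₄]
  obtain ⟨j1, j2, j3, j4, j5, j6, j7⟩ := hbr₄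
  refine ⟨by omega, lo', hi', ⟨j1, j2, j3, j4, by simpa using j5, by simpa using j6, by simpa using j7⟩, ?_⟩
  exact (Nat.mul_le_mul_right _ (card_le_of_window hperm hlo hhi hwin)).trans (hab.trans hcard)

/-- All levels of the grid. -/
def searchLoop : Cmd := .loop (.nle (.const 1) (.reg 3)) level

/-- The invariant of `searchLoop`. -/
def SearchInv (c : ℕ → ℕ → ℝ) (n : ℕ) (x p q : ℕ → ℝ) (K : ℕ) (s : State) : Prop :=
  ∃ lo hi, Bracket c n x p q lo hi s ∧ (s.nreg 3 = 0 ∧ candidates n p q 1 lo hi = ∅ ∨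
    ∃ l ≤ K, s.nreg 3 = 2 ^ l ∧ (candidates n p q (2 ^ l) lo hi).card ≤ 16 * (n / (2 * 2 ^ l) + 1))

/-- The list lengths form a geometric series of sum `O(n)`, with a factor `O(K)` for sorting. The
probes number four on each of the `K` coarser levels and `K + 5` on the last. -/
theorem sum_levelCost_le {n K : ℕ} (hK : K ≤ n) :
    ∑ i ∈ Finset.range (K + 1), (levelCost n K (2 ^ i) + 4) ≤ 100000 * ((n + 1) * (K + 6)) := by
  have h1 : ∑ i ∈ Finset.range (K + 1), (n / 2 ^ i + 1) ≤ 3 * (n + 1) := by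
    rw [Finset.sum_add_distrib]
    have := Nat.geom_sum_le (le_refl 2) n (K + 1)
    simp at this ⊢
    omega
  have h2 : ∑ i ∈ Finset.range (K + 1), (probes K (2 ^ i) + 1) ≤ 6 * (K + 6) := by
    rw [Finset.sum_range_succ']
    have : ∀ i ∈ Finset.range K, probes K (2 ^ (i + 1)) + 1 ≤ 5 := fun i _ => by
      have : 2 ^ (i + 1) = 2 * 2 ^ i := pow_succ' 2 i
      have : 0 < 2 ^ i := by positivity
      rw [probes, if_neg (by omega)]
    have := Finset.sum_le_sum this
    simp [probes] at this ⊢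
    omega
  have h3 : ∑ i ∈ Finset.range (K + 1), (levelCost n K (2 ^ i) + 4) =
      12400 * ((∑ i ∈ Finset.range (K + 1), (n / 2 ^ i + 1)) * (K + 5)) +
      (∑ i ∈ Finset.range (K + 1), (probes K (2 ^ i) + 1)) * (3100 * (n + 1)) + 54 * (K + 1) := by
    have hterm : ∀ i ∈ Finset.range (K + 1), levelCost n K (2 ^ i) + 4 =
        12400 * ((n / 2 ^ i + 1) * (K + 5)) + (probes K (2 ^ i) + 1) * (3100 * (n + 1)) + 54 :=
      fun i _ => by rw [levelCost]
    rw [Finset.sum_congr rfl hterm, Finset.sum_add_distrib, Finset.sum_add_distrib, ← Finset.mul_sum,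
      ← Finset.sum_mul, ← Finset.sum_mul, Finset.sum_const, Finset.card_range, smul_eq_mul, mul_comm 54]
  rw [h3]
  have h4 := Nat.mul_le_mul h1 (show K + 5 ≤ K + 6 by omega)
  have h5 := Nat.mul_le_mul_right (3100 * (n + 1)) h2
  have h6 : 6 * (K + 6) * (3100 * (n + 1)) = 18600 * ((n + 1) * (K + 6)) := by ring
  have h7 : K + 1 ≤ (n + 1) * (K + 6) := (show K + 1 ≤ K + 6 by omega).trans (Nat.le_mul_of_pos_left _ (by omega))
  rw [mul_assoc 3] at h4
  omega

theorem searchLoop_run (hs : Solvable c S W n x p q) {K : ℕ} (hK : n < 2 ^ K) (hK' : 2 ^ K ≤ 2 * n)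
    {s : State} (hd : Holds n x p q s) (h3 : s.nreg 3 = 2 ^ K) (h4 : s.nreg 4 = K) {lo hi : ℝ}
    (hbr : Bracket c n x p q lo hi s) :
    Run c S W searchLoop (100000 * ((n + 1) * (K + 6)) + 4) s (fun s' => ∃ lo hi, Bracket c n x p q lo hi s' ∧
      candidates n p q 1 lo hi = ∅) := by
  have hW := hs.word
  have hinit : SearchInv c n x p q K s := by
    refine ⟨lo, hi, hbr, Or.inr ⟨K, le_rfl, h3, ?_⟩⟩
    -- As `n < 2 ^ K`, only `(0, 0)` belongs to the coarsest grid.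
    have : (candidates n p q (2 ^ K) lo hi).card ≤ 1 := by
      refine (Finset.card_le_card (Finset.filter_subset _ _)).trans ?_
      simp [Nat.div_eq_of_lt hK]
    have := Nat.zero_le (n / (2 * 2 ^ K))
    omega
  -- `Nat.size (2 ^ l) = l + 1` is the number of levels that remain, and `Nat.size 0 = 0` when the
  -- search is over.
  refine (Run.loop_potential (SearchInv c n x p q K)
    (fun s => ∑ i ∈ Finset.range (Nat.size (s.nreg 3)), (levelCost n K (2 ^ i) + 4))
    (fun s => levelCost n K (s.nreg 3)) hinit ?_).mono ?_ ?_
  · rintro s₁ ⟨lo, hi, hbr₁, hcase⟩ hs₁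
    have hd₁ := hd.of_same hs₁ (by decide) (by decide) (by decide) (by decide)
    have h4₁ : s₁.nreg 4 = K := by rw [hs₁.nreg 4 (by decide), h4]
    have hle : s₁.nreg 3 < W := by
      rcases hcase with ⟨h, -⟩ | ⟨l, hl, h, -⟩
      · omega
      · have : 2 ^ l ≤ 2 ^ K := Nat.pow_le_pow_right (by norm_num) hl
        omega
    refine ⟨by simp [BExp.ok, NExp.ok]; omega, fun hb => ?_⟩
    have hb : 1 ≤ s₁.nreg 3 := by simpa [BExp.holds, NExp.eval] using hb
    rcases hcase with ⟨h, -⟩ | ⟨l, hl, h, hcard⟩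
    · omega
    rw [h]
    refine (level_run hs hK hK' hl hd₁ h h4₁ hbr₁ hcard).mono le_rfl ?_
    rintro s₂ ⟨lo', hi', hbr₂, h3₂, hcard₂⟩ -
    cases l with
    | zero =>
      refine ⟨⟨lo', hi', hbr₂, Or.inl ⟨by simpa using h3₂, ?_⟩⟩, ?_⟩
      -- At step `1` the remaining count times `2 ^ (K + 5)` is at most `16 * (n / 2 + 1)`, which is
      -- below `2 ^ (K + 5)`; hence it is zero.
      · simp [probes, pow_add] at hcard₂
        rw [← Finset.card_eq_zero]
        have : n / 2 ≤ n := Nat.div_le_self n 2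
        by_contra hne
        have h1 : 1 ≤ (candidates n p q 1 lo' hi').card := Nat.one_le_iff_ne_zero.2 hne
        have := Nat.mul_le_mul_right (2 ^ K * 32) h1
        omega
      · simp [h3₂, BExp.cost, NExp.cost]
    | succ l =>
      have hpos : 0 < 2 ^ l := by positivity
      have hpow : 2 ^ (l + 1) = 2 * 2 ^ l := pow_succ' 2 l
      have h3' : s₂.nreg 3 = 2 ^ l := by rw [h3₂, hpow]; omega
      refine ⟨⟨lo', hi', hbr₂, Or.inr ⟨l, by omega, h3', ?_⟩⟩, ?_⟩
      -- After four probes at most `n / (2 * 2 ^ (l + 1)) + 1` candidates are left. Eight times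
      -- this, plus the linear term of the refinement, is again within the bound of the invariant
      -- for the next level.
      · have h1 := card_candidates_le hs.p_mono hs.q_anti hpos hbr₂.lo_lt_hi
        rw [probes, if_neg (by omega)] at hcard₂
        rw [← hpow] at h1 ⊢
        have : n / (2 * 2 ^ (l + 1)) ≤ n / 2 ^ (l + 1) := Nat.div_le_div_left (by omega) (by positivity)
        omega
      · rw [h3', Nat.size_pow, Nat.size_pow, Finset.sum_range_succ _ (l + 1)]
        simp only [BExp.cost, NExp.cost]
        omega
  · have : K ≤ n := by
      rcases K with _ | K
      · omega
      · have : K < 2 ^ K := Nat.lt_two_pow_self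
        rw [pow_succ] at hK'
        omega
    have := sum_levelCost_le this
    rw [h3, Nat.size_pow]
    simp only [BExp.cost, NExp.cost]
    omega
  · rintro s' ⟨⟨lo, hi, hbr', hcase⟩, hb⟩ -
    have hb : s'.nreg 3 < 1 := by simpa [BExp.holds, NExp.eval] using hb
    rcases hcase with ⟨-, h⟩ | ⟨l, -, h, -⟩
    · exact ⟨lo, hi, hbr', h⟩
    · have : 0 < 2 ^ l := by positivity
      omega

/-- Solve once more, just above the lower end of the final bracket, and choose the answer. -/
def finish : Cmd :=
  .seq (.setR 0 (.reg 9)) <| .seq solve <|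
  .cond (.rle (.reg 10) (.reg 5)) (.seq (.setN 0 (.reg 12)) (.setN 1 (.reg 13)))
    (.seq (.setN 0 (.reg 10)) (.setN 1 (.reg 11)))

theorem finish_run (hs : Solvable c S W n x p q) {lo hi : ℝ} {s : State} (hd : Holds n x p q s)
    (hbr : Bracket c n x p q lo hi s) (hno : candidates n p q 1 lo hi = ∅) :
    Run c S W finish (3000 * (n + 1) + 20) s (fun s' => s'.nreg 0 < s'.nreg 1 ∧ s'.nreg 1 ≤ n ∧
      ∀ i j r, i < j → j ≤ n → DetoursLe c n x p q r r i j →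
        DetoursLe c n x p q r r (s'.nreg 0) (s'.nreg 1)) := by
  have hS := hs.size
  have hW := hs.word
  -- No value `q k + p h` lies strictly between `lo` and `hi`, so a pair that is critical at `lo` is
  -- critical at every `r < hi`.
  have hgap : ∀ r < hi, ∀ i j, DetoursLe c n x p q r r i j → DetoursLe c n x p q lo r i j := by
    intro r hr i j h k hk l hl hlt
    refine h k hk l hl ?_
    by_contra hle
    have : (k, l) ∈ candidates n p q 1 lo hi :=
      (mem_candidates one_pos).2 (by simpa using ⟨hk, hl, hlt, (not_lt.1 hle).trans_lt hr⟩)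
    simp [hno] at this
  have hlo : ∀ i j r, i < j → j ≤ n → DetoursLe c n x p q r r i j → lo ≤ r := by
    intro i j r hij hj h
    by_contra hle
    exact hbr.infeasible i j hij hj (h.mono (not_le.1 hle).le (not_le.1 hle).le)
  refine (Run.seq (b := 2) (b' := 3000 * (n + 1) + 10) (R := fun s' => s'.rreg 0 = lo)
    (Run.of_wp ?_ (by decide)) ?_).mono (by omega) fun _ h _ => h
  · simp [wp, RExp.ok, RExp.eval, State.putR, hbr.h9]
  intro s₁ h0 hs₁
  have hd₁ := hd.of_same hs₁ (by decide) (by decide) (by decide) (by decide)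
  refine Run.seq (solve_run hs.one_le hs.p_mono hs.q_anti (by omega) (by omega) hs.x_mono hs.c_inc hs.c_dec hd₁
    (by rw [h0]; exact hbr.lo_lt_hi.trans_le hbr.hi_le)) ?_
  rintro s₂ ⟨hlt₂, hle₂, hD₂, hopt₂⟩ hs₂
  rw [h0] at hD₂ hopt₂
  have e10 : s₂.rreg 10 = hi := by rw [hs₂.rreg 10 (by decide), hs₁.rreg 10 (by decide), hbr.h10]
  have e12 : s₂.nreg 12 = s.nreg 12 := by rw [hs₂.nreg 12 (by decide), hs₁.nreg 12 (by decide)]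
  have e13 : s₂.nreg 13 = s.nreg 13 := by rw [hs₂.nreg 13 (by decide), hs₁.nreg 13 (by decide)]
  have h12 := hbr.lt
  have h13 := hbr.le
  refine Run.of_wp ?_ (b := 10) (by decide)
  simp [wp, BExp.ok, BExp.holds, NExp.ok, NExp.eval, RExp.ok, RExp.eval, State.putN, e10, e12, e13]
  refine ⟨fun hle => ⟨by omega, by omega, by omega, by omega, ?_⟩, fun hlt => ⟨by omega, by omega, by omega, by omega, ?_⟩⟩
  · intro i j r hij hj h
    rcases lt_or_ge r hi with hr | hr
    · exact absurd (hopt₂ i j r hij hj (hgap r hr i j h)) (not_le.2 (hr.trans_le hle))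
    · exact hbr.feasible.mono hr hr
  · intro i j r hij hj h
    have hlr := hlo i j r hij hj h
    rcases lt_or_ge r hi with hr | hr
    · exact hD₂.mono hlr (hopt₂ i j r hij hj (hgap r hr i j h))
    · exact hD₂.mono hlr (hlt.le.trans hr)

end RealRAM

namespace RealRAM

/-! ### Preprocessing -/

/-- `v` lies between `w` and the largest function below the cones `w a - |x a - x j|`. -/
def BelowCones (n : ℕ) (x w v : ℕ → ℝ) : Prop :=
  (∀ j ≤ n, w j ≤ v j) ∧ ∀ j ≤ n, ∃ a ≤ n, v j ≤ w a - |x a - x j|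

theorem BelowCones.refl (n : ℕ) (x w : ℕ → ℝ) : BelowCones n x w w :=
  ⟨fun _ _ => le_rfl, fun j hj => ⟨j, hj, by simp⟩⟩

/-- By the triangle inequality, a cone that lies above `v k` at `k` still lies above `v k - r` at
`i`. Propagation between neighbours thus never exceeds the hull. -/
theorem BelowCones.update {n i k : ℕ} {x w v : ℕ → ℝ} {r : ℝ} (h : BelowCones n x w v) (hk : k ≤ n)
    (hr : |x k - x i| ≤ r) : BelowCones n x w (Function.update v i (max (v i) (v k - r))) := by
  constructor
  · intro j hj
    rcases eq_or_ne j i with rfl | hne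
    · simpa using Or.inl (h.1 j hj)
    · simpa [hne] using h.1 j hj
  · intro j hj
    rcases eq_or_ne j i with rfl | hne
    · rw [Function.update_self]
      rcases max_choice (v j) (v k - r) with he | he <;> rw [he]
      · exact h.2 j hj
      · obtain ⟨a, ha, hva⟩ := h.2 k hk
        refine ⟨a, ha, ?_⟩
        have := abs_sub_le (x a) (x k) (x j)
        linarith
    · simpa [hne] using h.2 j hj

/-- `v` is the least function above `w` that is `1`-Lipschitz with respect to the positions `x`. -/
structure LipschitzHull (n : ℕ) (x w v : ℕ → ℝ) : Prop where
  below : BelowCones n x w v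
  fwd : ∀ j < n, v j - (x (j + 1) - x j) ≤ v (j + 1)
  bwd : ∀ j < n, v (j + 1) - (x (j + 1) - x j) ≤ v j

/-- Replace an entry of a real array by the maximum of its value and the value of `e`. -/
def maxStore (a : ℕ) (i : NExp) (e : RExp) : Cmd := .cond (.rle (.get a i) e) (.storeR a i e) .skip

theorem wp_maxStore {c : ℕ → ℕ → ℝ} {S W a : ℕ} {i : NExp} {e : RExp} {Q : State → Prop} {s : State}
    (hi : i.ok S W s) (hb : i.eval s < S) (he : e.ok S W s)
    (hQ : Q (s.putRA a (i.eval s) (max (s.rarr a (i.eval s)) (e.eval c s)))) :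
    wp c S W (maxStore a i e) Q s := by
  refine ⟨⟨⟨hi, hb⟩, he⟩, fun h => ⟨hi, hb, he, ?_⟩, fun h => ?_⟩
  · have h : s.rarr a (i.eval s) ≤ e.eval c s := h
    rwa [max_eq_right h] at hQ
  · have hself : s.putRA a (i.eval s) (s.rarr a (i.eval s)) = s := by simp [State.putRA]
    have h : ¬ s.rarr a (i.eval s) ≤ e.eval c s := h
    rwa [max_eq_left (le_of_lt (not_le.1 h)), hself] at hQ

/-- One round of `forward`. -/
def forwardBody : Cmd :=
  .seq (maxStore 1 (.add (.reg 6) (.const 1)) (.sub (.get 1 (.reg 6)) (.get 0 (.reg 6)))) <|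
  .seq (.storeR 2 (.add (.reg 6) (.const 1)) (.add (.get 2 (.reg 6)) (.get 0 (.reg 6)))) <|
  .setN 6 (.add (.reg 6) (.const 1))

/-- Compute the positions, and propagate the vertex weights to the right. -/
def forward : Cmd := .loop (.nle (.add (.reg 6) (.const 1)) (.reg 2)) forwardBody

/-- The invariant of `forward`. -/
structure ForwardInv (n : ℕ) (x w : ℕ → ℝ) (s : State) : Prop where
  le : s.nreg 6 ≤ n
  pos : ∀ j ≤ s.nreg 6, s.rarr 2 j = x j
  below : BelowCones n x w (s.rarr 1)
  fwd : ∀ j < s.nreg 6, s.rarr 1 j - (x (j + 1) - x j) ≤ s.rarr 1 (j + 1)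

variable {c : ℕ → ℕ → ℝ} {S W n : ℕ} {x w : ℕ → ℝ}

theorem forward_run (hS : n + 2 ≤ S) (hW : n + 2 ≤ W) {s : State} (h2 : s.nreg 2 = n) (h6 : s.nreg 6 = 0)
    (hw : s.rarr 1 = w) (hx0 : s.rarr 2 0 = x 0) (hδ : ∀ i < n, s.rarr 0 i = x (i + 1) - x i)
    (hmono : ∀ i < n, x i ≤ x (i + 1)) :
    Run c S W forward (100 * (n + 1)) s (fun s' => ForwardInv n x w s' ∧ s'.nreg 6 = n) := by
  have hinit : ForwardInv n x w s := by
    refine ⟨by omega, fun j hj => ?_, hw ▸ BelowCones.refl n x w, fun j hj => by omega⟩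
    rw [show j = 0 by omega, hx0]
  refine (Run.loop (ForwardInv n x w) (fun s => n - s.nreg 6) 60 hinit ?_).mono ?_ ?_
  · intro s₁ hi hs₁
    have h2₁ : s₁.nreg 2 = n := by rw [hs₁.nreg 2 (by decide), h2]
    have hδ₁ : ∀ i < n, s₁.rarr 0 i = x (i + 1) - x i := by rw [hs₁.rarr 0 (by decide)]; exact hδ
    have hle := hi.le
    refine ⟨by simp [BExp.ok, NExp.ok, NExp.eval]; omega, fun hb => ?_⟩
    have hlt : s₁.nreg 6 < n := by simpa [BExp.holds, NExp.eval, h2₁] using hb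
    have hd := hδ₁ _ hlt
    have hm := hmono _ hlt
    refine Run.of_wp (wp_maxStore (by simp [NExp.ok, NExp.eval]; omega) (by simp [NExp.eval]; omega)
      (by simp [RExp.ok, NExp.ok, NExp.eval]; omega) ?_) (by decide)
    simp only [wp, NExp.ok, RExp.ok, NExp.eval, RExp.eval, State.putN, State.putRA]
    refine ⟨by omega, by omega, by simp; omega, by omega, ⟨?_, ?_, ?_, ?_⟩, by simp; omega⟩
    · simp; omega
    · intro j hj
      simp at hj ⊢
      rcases eq_or_ne j (s₁.nreg 6 + 1) with rfl | hne
      · simp [hi.pos _ le_rfl, hd]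
      · simpa [hne] using hi.pos j (by omega)
    · have := hi.below.update (i := s₁.nreg 6 + 1) (k := s₁.nreg 6) hle (r := x (s₁.nreg 6 + 1) - x (s₁.nreg 6))
        (by rw [abs_sub_comm, abs_of_nonneg (by linarith)])
      simpa [hd] using this
    · intro j hj
      simp at hj ⊢
      rcases eq_or_ne j (s₁.nreg 6) with rfl | hne
      · rw [Function.update_of_ne (by omega), Function.update_self, hd, ← sub_le_iff_le_add]
        exact le_max_right _ _
      · have := hi.fwd j (by omega)
        rw [Function.update_of_ne (by omega), Function.update_of_ne (by omega)]
        linarith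
  · simp [BExp.cost, NExp.cost]; omega
  · rintro s' ⟨hi, hb⟩ hs'
    have h2' : s'.nreg 2 = n := by rw [hs'.nreg 2 (by decide), h2]
    have := hi.le
    simp [BExp.holds, NExp.eval, h2'] at hb
    exact ⟨hi, by omega⟩

/-- One round of `backward`. -/
def backwardBody : Cmd :=
  .seq (.setN 6 (.sub (.reg 6) (.const 1))) <|
  maxStore 1 (.reg 6) (.sub (.get 1 (.add (.reg 6) (.const 1))) (.get 0 (.reg 6)))

/-- Propagate the vertex weights to the left. -/
def backward : Cmd := .loop (.nle (.const 1) (.reg 6)) backwardBody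

/-- The invariant of `backward`. -/
structure BackwardInv (n : ℕ) (x w : ℕ → ℝ) (s : State) : Prop where
  le : s.nreg 6 ≤ n
  below : BelowCones n x w (s.rarr 1)
  fwd : ∀ j < n, s.rarr 1 j - (x (j + 1) - x j) ≤ s.rarr 1 (j + 1)
  bwd : ∀ j < n, s.nreg 6 ≤ j → s.rarr 1 (j + 1) - (x (j + 1) - x j) ≤ s.rarr 1 j

/-- The pass to the left does not spoil the inequalities of the pass to the right: raising an entry
to its right neighbour minus a nonnegative length preserves them. So two passes suffice. -/
theorem backward_run (hS : n + 2 ≤ S) (hW : n + 2 ≤ W) {s : State} (h6 : s.nreg 6 = n)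
    (hf : ForwardInv n x w s) (hδ : ∀ i < n, s.rarr 0 i = x (i + 1) - x i)
    (hmono : ∀ i < n, x i ≤ x (i + 1)) :
    Run c S W backward (100 * (n + 1)) s (fun s' => LipschitzHull n x w (s'.rarr 1) ∧ s'.nreg 6 = 0) := by
  have hinit : BackwardInv n x w s :=
    ⟨hf.le, hf.below, fun j hj => hf.fwd j (by omega), fun j hj hj' => by omega⟩
  refine (Run.loop (BackwardInv n x w) (fun s => s.nreg 6) 60 hinit ?_).mono ?_ ?_
  · intro s₁ hi hs₁
    have hδ₁ : ∀ i < n, s₁.rarr 0 i = x (i + 1) - x i := by rw [hs₁.rarr 0 (by decide)]; exact hδ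
    have hle := hi.le
    refine ⟨by simp [BExp.ok, NExp.ok]; omega, fun hb => ?_⟩
    have hlt : 1 ≤ s₁.nreg 6 := by simpa [BExp.holds, NExp.eval] using hb
    obtain ⟨m, hm6⟩ : ∃ m, s₁.nreg 6 = m + 1 := ⟨s₁.nreg 6 - 1, by omega⟩
    have hd := hδ₁ m (by omega)
    have hm := hmono m (by omega)
    refine Run.of_wp ⟨by simp [NExp.ok]; omega, wp_maxStore ?_ ?_ ?_ ?_⟩ (by decide)
    · simp [NExp.ok, NExp.eval, State.putN]; omega
    · simp [NExp.eval, State.putN]; omega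
    · simp [RExp.ok, NExp.ok, NExp.eval, State.putN]; omega
    · simp only [RExp.eval, NExp.eval, State.putN, State.putRA, hm6]
      simp only [Function.update_self, Nat.add_sub_cancel, hd]
      refine ⟨⟨by simp; omega, ?_, ?_, ?_⟩, by simp⟩
      · have := hi.below.update (i := m) (k := m + 1) (by omega) (r := x (m + 1) - x m)
          (by rw [abs_of_nonneg (by linarith)])
        simpa using this
      · intro j hj
        have := hi.fwd j hj
        simp only [Function.update_self]
        rcases eq_or_ne j m with rfl | hne
        · rw [Function.update_self, Function.update_of_ne (by omega)]
          rcases max_choice (s₁.rarr 1 j) (s₁.rarr 1 (j + 1) - (x (j + 1) - x j)) with he | he <;> rw [he] <;>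
            linarith
        · rw [Function.update_of_ne hne]
          rcases eq_or_ne (j + 1) m with rfl | hne'
          · rw [Function.update_self]; exact this.trans (le_max_left _ _)
          · rw [Function.update_of_ne hne']; exact this
      · intro j hj hj'
        simp at hj'
        simp only [Function.update_self]
        rcases eq_or_ne j m with rfl | hne
        · simp
        · rw [Function.update_of_ne hne, Function.update_of_ne (by omega)]
          exact hi.bwd j hj (by omega)
  · simp [BExp.cost, NExp.cost]; omega
  · rintro s' ⟨hi, hb⟩ -
    simp [BExp.holds, NExp.eval] at hb
    exact ⟨⟨hi.below, hi.fwd, fun j hj => hi.bwd j hj (by omega)⟩, hb⟩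

/-- Fill the arrays of `p` and `q`. -/
def fill : Cmd := .loop (.nle (.reg 6) (.reg 2)) <|
  .seq (.storeR 3 (.reg 6) (.add (.get 1 (.reg 6)) (.get 2 (.reg 6)))) <|
  .seq (.storeR 4 (.reg 6) (.sub (.get 1 (.reg 6)) (.get 2 (.reg 6)))) <|
  .setN 6 (.add (.reg 6) (.const 1))

theorem fill_run (hS : n + 2 ≤ S) (hW : n + 2 ≤ W) {s : State} {v : ℕ → ℝ} (h2 : s.nreg 2 = n)
    (h6 : s.nreg 6 = 0) (hv : s.rarr 1 = v) (hx : ∀ j ≤ n, s.rarr 2 j = x j) :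
    Run c S W fill (100 * (n + 1)) s (Holds n x (fun k => v k + x k) (fun k => v k - x k)) := by
  refine (Run.loop (fun s => s.nreg 6 ≤ n + 1 ∧ (∀ j < s.nreg 6, s.rarr 3 j = v j + x j) ∧
    ∀ j < s.nreg 6, s.rarr 4 j = v j - x j) (fun s => n + 1 - s.nreg 6) 60 ?_ ?_).mono ?_ ?_
  · refine ⟨by omega, fun j hj => by omega, fun j hj => by omega⟩
  · rintro s₁ ⟨hle, hp, hq⟩ hs₁
    have h2₁ : s₁.nreg 2 = n := by rw [hs₁.nreg 2 (by decide), h2]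
    have hv₁ : s₁.rarr 1 = v := by rw [hs₁.rarr 1 (by decide), hv]
    have hx₁ : ∀ j ≤ n, s₁.rarr 2 j = x j := by rw [hs₁.rarr 2 (by decide)]; exact hx
    refine ⟨by simp [BExp.ok, NExp.ok]; omega, fun hb => ?_⟩
    have hlt : s₁.nreg 6 ≤ n := by simpa [BExp.holds, NExp.eval, h2₁] using hb
    refine Run.of_wp ?_ (by decide)
    simp only [wp, NExp.ok, RExp.ok, NExp.eval, RExp.eval, State.putN, State.putRA]
    refine ⟨by omega, by omega, by omega, by omega, by omega, by omega, by omega,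
      ⟨by simp; omega, fun j hj => ?_, fun j hj => ?_⟩, by simp; omega⟩
    · simp at hj
      rcases eq_or_ne j (s₁.nreg 6) with rfl | hne
      · simp [hv₁, hx₁ _ hlt]
      · simpa [hne] using hp j (by omega)
    · simp at hj
      rcases eq_or_ne j (s₁.nreg 6) with rfl | hne
      · simp [hv₁, hx₁ _ hlt]
      · simpa [hne] using hq j (by omega)
  · simp [BExp.cost, NExp.cost]; omega
  · rintro s' ⟨⟨hle, hp, hq⟩, hb⟩ hs'
    have h2' : s'.nreg 2 = n := by rw [hs'.nreg 2 (by decide), h2]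
    simp [BExp.holds, NExp.eval, h2'] at hb
    exact ⟨h2', by rw [hs'.rarr 2 (by decide)]; exact hx, fun i hi => hp i (by omega), fun i hi => hq i (by omega)⟩

/-- Compute the least power of two above the last vertex, and its exponent. -/
def powerLoop : Cmd := .loop (.nle (.reg 3) (.reg 2)) <|
  .seq (.setN 3 (.add (.reg 3) (.reg 3))) <| .setN 4 (.add (.reg 4) (.const 1))

theorem powerLoop_run (hn : 1 ≤ n) (hW : 100 * (n + 1) ≤ W) {s : State} (h2 : s.nreg 2 = n) (h3 : s.nreg 3 = 1)
    (h4 : s.nreg 4 = 0) :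
    Run c S W powerLoop (100 * (n + 1)) s
      (fun s' => ∃ K, n < 2 ^ K ∧ 2 ^ K ≤ 2 * n ∧ s'.nreg 3 = 2 ^ K ∧ s'.nreg 4 = K) := by
  refine (Run.loop (fun s => ∃ K, 2 ^ K ≤ 2 * n ∧ s.nreg 3 = 2 ^ K ∧ s.nreg 4 = K)
    (fun s => n + 1 - s.nreg 4) 30 ⟨0, by simp; omega, by simpa using h3, h4⟩ ?_).mono ?_ ?_
  · rintro s₁ ⟨K, hK, h3₁, h4₁⟩ hs₁
    have h2₁ : s₁.nreg 2 = n := by rw [hs₁.nreg 2 (by decide), h2]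
    refine ⟨by simp [BExp.ok, NExp.ok]; omega, fun hb => ?_⟩
    have hlt : 2 ^ K ≤ n := by simpa [BExp.holds, NExp.eval, h2₁, h3₁] using hb
    have hlt' : K < 2 ^ K := Nat.lt_two_pow_self
    refine Run.of_wp ?_ (by decide)
    simp only [wp, NExp.ok, NExp.eval, State.putN]
    simp [h3₁, h4₁]
    and_intros
    all_goals try omega
  · simp [BExp.cost, NExp.cost]; omega
  · rintro s' ⟨⟨K, hK, h3', h4'⟩, hb⟩ hs'
    have h2' : s'.nreg 2 = n := by rw [hs'.nreg 2 (by decide), h2]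
    simp [BExp.holds, NExp.eval, h2', h3'] at hb
    exact ⟨K, hb, hK, h3', h4'⟩

/-- Preprocessing, from the input to the first bracket of the search. -/
def prepare : Cmd :=
  .seq (.setN 2 (.sub (.reg 0) (.const 1))) <| .seq forward <| .seq backward <| .seq fill <|
  .seq (.setN 3 (.const 1)) <| .seq powerLoop <|
  .seq (.setR 10 (.add (.get 4 (.const 0)) (.get 3 (.reg 2)))) <|
  .seq (.setR 9 (.sub .zero (.reg 10))) <| .seq (.setN 12 (.const 0)) <| .setN 13 (.const 1)

/-- The outcome of the preprocessing. -/
structure Prepared (n : ℕ) (x w v : ℕ → ℝ) (s : State) : Prop where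
  hull : LipschitzHull n x w v
  holds : Holds n x (fun k => v k + x k) (fun k => v k - x k) s
  power : ∃ K, n < 2 ^ K ∧ 2 ^ K ≤ 2 * n ∧ s.nreg 3 = 2 ^ K ∧ s.nreg 4 = K
  lo : s.rreg 9 = -((v 0 - x 0) + (v n + x n))
  hi : s.rreg 10 = (v 0 - x 0) + (v n + x n)
  fst : s.nreg 12 = 0
  snd : s.nreg 13 = 1

theorem prepare_run (hn : 1 ≤ n) (hS : n + 2 ≤ S) (hW : 100 * (n + 1) ≤ W) {s : State} (h0 : s.nreg 0 = n + 1)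
    (h4 : s.nreg 4 = 0) (h6 : s.nreg 6 = 0) (hw : s.rarr 1 = w) (hx0 : s.rarr 2 0 = x 0)
    (hδ : ∀ i < n, s.rarr 0 i = x (i + 1) - x i) (hmono : ∀ i < n, x i ≤ x (i + 1)) :
    Run c S W prepare (500 * (n + 1)) s (fun s' => ∃ v, Prepared n x w v s') := by
  refine Run.mono (b := 4 + (100 * (n + 1) + (100 * (n + 1) + (100 * (n + 1) + (2 + (100 * (n + 1) + 16))))))
    ?_ (by omega) fun _ h _ => h
  refine Run.seq (R := fun s' => s' = s.putN 2 n) (Run.of_wp ⟨by simp [NExp.ok]; omega, ?_⟩ (by decide)) ?_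
  · simp [NExp.eval, h0]
  rintro s₁ rfl -
  refine (forward_run (s := s.putN 2 n) (x := x) (w := w) hS (by omega) (by simp [State.putN]) h6 hw hx0 hδ hmono).seq ?_
  rintro s₂ ⟨hf, h6₂⟩ hs₂
  refine (backward_run hS (by omega) h6₂ hf (by rw [hs₂.rarr 0 (by decide)]; exact hδ) hmono).seq ?_
  rintro s₃ ⟨hv, h6₃⟩ hs₃
  have h2₃ : s₃.nreg 2 = n := by
    rw [hs₃.nreg 2 (by decide), hs₂.nreg 2 (by decide)]; simp [State.putN]
  have h4₃ : s₃.nreg 4 = 0 := by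
    rw [hs₃.nreg 4 (by decide), hs₂.nreg 4 (by decide)]; exact h4
  refine (fill_run (x := x) hS (by omega) h2₃ h6₃ rfl
    (by rw [hs₃.rarr 2 (by decide)]; exact fun j hj => hf.pos j (by omega))).seq ?_
  intro s₄ hd hs₄
  have h4₄ : s₄.nreg 4 = 0 := by rw [hs₄.nreg 4 (by decide), h4₃]
  refine Run.seq (R := fun s' => s' = s₄.putN 3 1) (Run.of_wp ⟨by simp [NExp.ok]; omega, by simp [NExp.eval]⟩ (by decide)) ?_
  rintro s₅ rfl -
  refine (powerLoop_run hn hW (by simpa [State.putN] using hd.hn) (by simp [State.putN])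
    (by simpa [State.putN] using h4₄)).seq ?_
  rintro s₆ hK hs₆
  have hd₆ : Holds n x (fun k => s₃.rarr 1 k + x k) (fun k => s₃.rarr 1 k - x k) s₆ :=
    Holds.of_same (s := s₄.putN 3 1) ⟨by simpa [State.putN] using hd.hn, hd.hx, hd.hp, hd.hq⟩ hs₆ (by decide) (by decide)
      (by decide) (by decide)
  have e2 := hd₆.hn
  have ep := hd₆.hp n le_rfl
  have eq := hd₆.hq 0 (Nat.zero_le n)
  refine Run.of_wp ?_ (by decide)
  simp only [wp, NExp.ok, RExp.ok, NExp.eval, RExp.eval, State.putN, State.putR]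
  refine ⟨by omega, ⟨trivial, trivial⟩, by omega, by omega, s₃.rarr 1, hv, ⟨by simpa using hd₆.hn, hd₆.hx, hd₆.hp, hd₆.hq⟩,
    by simpa using hK, ?_, ?_, by simp, by simp⟩
  · simp [e2, ep, eq]
  · simp [e2, ep, eq]

end RealRAM

/-! ### Distances from walks and potentials -/

namespace WGraph

variable {V : Type} {E E' : V → V → ℝ → Prop}

theorem WalkLength.append {u v z : V} {a b : ℝ} (h : WalkLength E u v a) (h' : WalkLength E v z b) :
    WalkLength E u z (a + b) := by
  induction h with
  | nil u => simpa using h'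
  | cons e p ih => rw [add_assoc]; exact .cons e (ih h')

theorem WalkLength.single {u v : V} {a : ℝ} (h : E u v a) : WalkLength E u v a := by
  simpa using WalkLength.cons h (.nil v)

theorem WalkLength.mono {u v : V} {a : ℝ} (hE : ∀ u v a, E u v a → E' u v a) (h : WalkLength E u v a) :
    WalkLength E' u v a := by
  induction h with
  | nil u => exact .nil u
  | cons e p ih => exact .cons (hE _ _ _ e) ih

theorem WalkLength.potential {φ : V → ℝ} (hφ : ∀ u v a, E u v a → φ v ≤ φ u + a) {u v : V} {a : ℝ}
    (h : WalkLength E u v a) : φ v ≤ φ u + a := by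
  induction h with
  | nil u => simp
  | cons e p ih => linarith [hφ _ _ _ e]

theorem WalkLength.nonneg (hE : ∀ u v a, E u v a → 0 ≤ a) {u v : V} {a : ℝ} (h : WalkLength E u v a) :
    0 ≤ a := by
  simpa using h.potential (φ := fun _ => 0) fun u v a h => by simpa using hE u v a h

theorem gdist_le (hE : ∀ u v a, E u v a → 0 ≤ a) {u v : V} {a : ℝ} (h : WalkLength E u v a) :
    gdist E u v ≤ a :=
  csInf_le ⟨0, fun _ hb => WalkLength.nonneg hE hb⟩ h

/-- Lower bounds on distances come from potentials that grow along each edge by at most its weight,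
so shortest walks need no analysis. The walk is only there to make the infimum range over a nonempty
set. -/
theorem le_gdist {φ : V → ℝ} (hφ : ∀ u v a, E u v a → φ v ≤ φ u + a) {u v : V} {a : ℝ}
    (h : WalkLength E u v a) : φ v - φ u ≤ gdist E u v :=
  le_csInf ⟨a, h⟩ fun _ hb => by linarith [WalkLength.potential hφ hb]

end WGraph

/-! ### The path with a shortcut, in coordinates on the line -/

namespace WDoap

open WGraph

variable {n : ℕ} (I : WDoap n)

/-- The edge weights, as a sequence. -/
noncomputable def edge (k : ℕ) : ℝ := if h : k < n then I.δ ⟨k, h⟩ else 0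

/-- The vertex weights, as a sequence. -/
noncomputable def weight (k : ℕ) : ℝ := if h : k < n + 1 then I.w ⟨k, h⟩ else 0

/-- The distance from the first vertex. -/
noncomputable def pos (k : ℕ) : ℝ := ∑ i ∈ Finset.range k, I.edge i

theorem edge_nonneg (k : ℕ) : 0 ≤ I.edge k := by
  unfold edge
  split_ifs with h
  · exact (I.δ_pos _).le
  · exact le_rfl

theorem pos_succ (k : ℕ) : I.pos (k + 1) = I.pos k + I.edge k := Finset.sum_range_succ _ _

theorem pos_zero : I.pos 0 = 0 := Finset.sum_range_zero _

theorem pos_mono : Monotone I.pos :=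
  monotone_nat_of_le_succ fun k => by rw [pos_succ]; linarith [I.edge_nonneg k]

theorem edge_val (e : Fin n) : I.edge e = I.δ e := by simp [edge]

theorem weight_val (k : Fin (n + 1)) : I.weight k = I.w k := by
  exact dif_pos k.is_lt

theorem pathEdge_pos {u v : Fin (n + 1)} {a : ℝ} (h : PathEdge I.δ u v a) : |I.pos u - I.pos v| = a := by
  cases h with
  | fwd e =>
    rw [Fin.val_succ, Fin.val_castSucc, pos_succ, edge_val, abs_sub_comm, add_sub_cancel_left,
      abs_of_pos (I.δ_pos e)]
  | bwd e =>
    rw [Fin.val_succ, Fin.val_castSucc, pos_succ, edge_val, add_sub_cancel_left, abs_of_pos (I.δ_pos e)]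

theorem pathEdge_symm {δ : Fin n → ℝ} {u v : Fin (n + 1)} {a : ℝ} (h : PathEdge δ u v a) :
    PathEdge δ v u a := by
  cases h with
  | fwd e => exact .bwd e
  | bwd e => exact .fwd e

theorem walk_of_le (u : ℕ) (hu : u < n + 1) (v : ℕ) (huv : u ≤ v) (hv : v < n + 1) :
    WalkLength (PathEdge I.δ) ⟨u, hu⟩ ⟨v, hv⟩ (I.pos v - I.pos u) ∧
      WalkLength (PathEdge I.δ) ⟨v, hv⟩ ⟨u, hu⟩ (I.pos v - I.pos u) := by
  induction v, huv using Nat.le_induction with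
  | base => simpa using WalkLength.nil _
  | succ v huv ih =>
    obtain ⟨h1, h2⟩ := ih (by omega)
    have he : PathEdge I.δ ⟨v, by omega⟩ ⟨v + 1, hv⟩ (I.edge v) := by
      have := PathEdge.fwd (δ := I.δ) ⟨v, by omega⟩
      rwa [← edge_val] at this
    have e : I.pos (v + 1) - I.pos u = I.pos v - I.pos u + I.edge v := by rw [pos_succ]; ring
    rw [e]
    refine ⟨h1.append (.single he), ?_⟩
    have := WalkLength.cons (pathEdge_symm he) h2
    rwa [add_comm (I.edge v)] at this

theorem walk_path (u v : Fin (n + 1)) : WalkLength (PathEdge I.δ) u v |I.pos u - I.pos v| := by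
  rcases le_total u v with h | h
  · rw [abs_sub_comm, abs_of_nonneg (sub_nonneg.2 (I.pos_mono h))]
    exact (I.walk_of_le u u.2 v h v.2).1
  · rw [abs_of_nonneg (sub_nonneg.2 (I.pos_mono h))]
    exact (I.walk_of_le v v.2 u h u.2).2

theorem pathEdge_nonneg (u v : Fin (n + 1)) (a : ℝ) (h : PathEdge I.δ u v a) : 0 ≤ a := by
  rw [← I.pathEdge_pos h]; exact abs_nonneg _

theorem gdist_path (u v : Fin (n + 1)) : gdist (PathEdge I.δ) u v = |I.pos u - I.pos v| := by
  refine le_antisymm (gdist_le I.pathEdge_nonneg (I.walk_path u v)) ?_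
  have := le_gdist (φ := fun z : Fin (n + 1) => |I.pos u - I.pos z|)
    (fun y z a h => by rw [← I.pathEdge_pos h]; exact abs_sub_le _ _ _) (I.walk_path u v)
  simpa using this

theorem augDist_le_path (i j k h : Fin (n + 1)) : I.augDist i j k h ≤ |I.pos k - I.pos h| := by
  refine gdist_le ?_ ((I.walk_path k h).mono fun _ _ _ => Or.inl)
  rintro u v a (h | ⟨-, -, rfl⟩ | ⟨-, -, rfl⟩)
  exacts [I.pathEdge_nonneg u v a h, I.c_nonneg i j, I.c_nonneg i j]

theorem augDist_le_shortcut (i j k h : Fin (n + 1)) :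
    I.augDist i j k h ≤ |I.pos k - I.pos i| + (I.c i j + |I.pos j - I.pos h|) := by
  refine gdist_le ?_ (((I.walk_path k i).mono fun _ _ _ => Or.inl).append
    (.cons (Or.inr (Or.inl ⟨rfl, rfl, rfl⟩)) ((I.walk_path j h).mono fun _ _ _ => Or.inl)))
  rintro u v a (h | ⟨-, -, rfl⟩ | ⟨-, -, rfl⟩)
  exacts [I.pathEdge_nonneg u v a h, I.c_nonneg i j, I.c_nonneg i j]

/-- The minimum of the direct route and the two routes through the shortcut is a potential in `h`.
Across the shortcut the three routes are permuted at best; using it twice gains nothing, as `c` is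
nonnegative. -/
theorem le_augDist (i j k h : Fin (n + 1)) :
    min |I.pos k - I.pos h| (min (|I.pos k - I.pos i| + I.c i j + |I.pos j - I.pos h|)
      (|I.pos k - I.pos j| + I.c i j + |I.pos i - I.pos h|)) ≤ I.augDist i j k h := by
  set φ : Fin (n + 1) → ℝ := fun h => min |I.pos k - I.pos h|
    (min (|I.pos k - I.pos i| + I.c i j + |I.pos j - I.pos h|)
      (|I.pos k - I.pos j| + I.c i j + |I.pos i - I.pos h|)) with hφ
  have hc := I.c_nonneg i j
  have key : ∀ u v a, AddEdge (PathEdge I.δ) i j (I.c i j) u v a → φ v ≤ φ u + a := by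
    rintro u v a (h | ⟨rfl, rfl, rfl⟩ | ⟨rfl, rfl, rfl⟩)
    · rw [← I.pathEdge_pos h, hφ]
      simp only [← min_add_add_right]
      refine min_le_min (abs_sub_le _ _ _) (min_le_min ?_ ?_)
      · linarith [abs_sub_le (I.pos j) (I.pos u) (I.pos v)]
      · linarith [abs_sub_le (I.pos i) (I.pos u) (I.pos v)]
    · simp only [hφ, ← min_add_add_right, sub_self, abs_zero, add_zero]
      refine le_min ?_ (le_min ?_ ?_)
      · exact (min_le_right _ _).trans (min_le_left _ _)
      · refine ((min_le_right _ _).trans (min_le_left _ _)).trans ?_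
        linarith [abs_nonneg (I.pos v - I.pos u)]
      · exact (min_le_left _ _).trans (by linarith)
    · simp only [hφ, ← min_add_add_right, sub_self, abs_zero, add_zero]
      refine le_min ?_ (le_min ?_ ?_)
      · exact (min_le_right _ _).trans (min_le_right _ _)
      · exact (min_le_left _ _).trans (by linarith)
      · refine ((min_le_right _ _).trans (min_le_right _ _)).trans ?_
        linarith [abs_nonneg (I.pos v - I.pos u)]
  have h1 := le_gdist key ((I.walk_path k h).mono fun _ _ _ => Or.inl)
  have h2 : φ k ≤ 0 := (min_le_left _ _).trans (by simp)
  have h3 : φ h - φ k ≤ I.augDist i j k h := h1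
  change φ h ≤ _
  linarith

/-- Two pairs of points on a line are matched most cheaply in their order. For `k ≤ h` and `i ≤ j`
this rules out the route that enters the shortcut at `j`. -/
theorem abs_add_abs_le_of_le {a b c d : ℝ} (hab : a ≤ b) (hcd : c ≤ d) :
    |a - c| + |b - d| ≤ |a - d| + |b - c| := by
  rcases abs_cases (a - c) with ⟨h1, -⟩ | ⟨h1, -⟩ <;> rcases abs_cases (b - d) with ⟨h2, -⟩ | ⟨h2, -⟩ <;>
    rw [h1, h2]
  · linarith [le_abs_self (a - d), le_abs_self (b - c)]
  · linarith [neg_abs_le (a - d), le_abs_self (b - c)]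
  · linarith [neg_abs_le (a - d), le_abs_self (b - c), le_abs_self (a - d), neg_abs_le (b - c)]
  · linarith [neg_abs_le (a - d), neg_abs_le (b - c)]

theorem add_augDist_le_iff {i j k h : Fin (n + 1)} (hij : i ≤ j) (hkh : k ≤ h) (s μ : ℝ) :
    s + I.augDist i j k h ≤ μ ↔ s + (I.pos h - I.pos k) ≤ μ ∨
      s + (|I.pos k - I.pos i| + I.c i j + |I.pos h - I.pos j|) ≤ μ := by
  have e : |I.pos k - I.pos h| = I.pos h - I.pos k := by
    rw [abs_sub_comm, abs_of_nonneg (sub_nonneg.2 (I.pos_mono hkh))]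
  have hcross := abs_add_abs_le_of_le (I.pos_mono hkh) (I.pos_mono hij)
  rw [abs_sub_comm (I.pos h) (I.pos j), abs_sub_comm (I.pos h) (I.pos i)] at hcross
  rw [abs_sub_comm (I.pos h) (I.pos j)]
  constructor
  · intro hle
    by_contra! hcon
    have h1 := I.le_augDist i j k h
    have : μ - s < I.augDist i j k h := by
      refine lt_of_lt_of_le (lt_min ?_ (lt_min ?_ ?_)) h1 <;> linarith
    linarith
  · rintro (hle | hle)
    · linarith [I.augDist_le_path i j k h]
    · linarith [I.augDist_le_shortcut i j k h]

theorem oracle_val (i j : Fin (n + 1)) : I.oracle i j = I.c i j := by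
  exact dif_pos ⟨i.is_lt, j.is_lt⟩

theorem D_le_iff (hn : 1 ≤ n) {i j : Fin (n + 1)} (hij : i ≤ j) (μ : ℝ) :
    I.D i j ≤ μ ↔ ∀ k h, k < h → h ≤ n → I.weight k + I.weight h + (I.pos h - I.pos k) ≤ μ ∨
      I.weight k + I.weight h + (|I.pos k - I.pos i| + I.oracle i j + |I.pos h - I.pos j|) ≤ μ := by
  have : Nonempty {p : Fin (n + 1) × Fin (n + 1) // p.1 < p.2} :=
    ⟨⟨(0, Fin.last n), by rw [Fin.lt_def]; simp; omega⟩⟩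
  rw [D, ciSup_le_iff (Set.finite_range _).bddAbove]
  constructor
  · intro H k h hkh hh
    have := H ⟨(⟨k, by omega⟩, ⟨h, by omega⟩), hkh⟩
    rw [add_right_comm, I.add_augDist_le_iff hij (le_of_lt hkh), ← weight_val, ← weight_val, ← oracle_val] at this
    exact this
  · rintro H ⟨⟨k, h⟩, hkh⟩
    rw [add_right_comm, I.add_augDist_le_iff hij (le_of_lt hkh), ← weight_val, ← weight_val, ← oracle_val]
    exact H k h hkh (by omega)

theorem weight_nonneg (k : ℕ) : 0 ≤ I.weight k := by
  unfold weight
  split_ifs with h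
  · exact I.w_nonneg _
  · exact le_rfl

theorem weight_le_pos {k : ℕ} (hk : k ≤ n) : I.weight k ≤ I.pos k := by
  have := I.w_le_first ⟨k, by omega⟩
  rw [gdist_path, ← weight_val, Fin.val_zero, pos_zero, zero_sub, abs_neg,
    abs_of_nonneg (by rw [← I.pos_zero]; exact I.pos_mono (Nat.zero_le k))] at this
  exact this

theorem weight_le_last {k : ℕ} (hk : k ≤ n) : I.weight k ≤ I.pos n - I.pos k := by
  have := I.w_le_last ⟨k, by omega⟩
  rw [gdist_path, ← weight_val, abs_sub_comm, Fin.val_last,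
    abs_of_nonneg (sub_nonneg.2 (I.pos_mono hk))] at this
  exact this

theorem oracle_nonneg (i j : ℕ) : 0 ≤ I.oracle i j := by
  unfold oracle
  split_ifs with h
  · exact I.c_nonneg _ _
  · exact le_rfl

theorem oracle_le {i j z : ℕ} (hij : i ≠ j) (hiz : i ≠ z) (hi : i ≤ n) (hj : j ≤ n) (hz : z ≤ n) :
    I.oracle i j ≤ I.oracle i z + |I.pos z - I.pos j| := by
  rcases eq_or_ne j z with rfl | hjz
  · simp
  have := I.c_graphMetric ⟨i, by omega⟩ ⟨j, by omega⟩ ⟨z, by omega⟩ (by simpa using hij) (by simpa using hiz)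
    (by simpa using hjz)
  rwa [gdist_path, ← oracle_val, ← oracle_val] at this

end WDoap

/-! ### The Lipschitz hull and the equivalence of the two objectives -/

namespace RealRAM

theorem LipschitzHull.p_mono {n : ℕ} {x w v : ℕ → ℝ} (h : LipschitzHull n x w v) :
    MonotoneOn (fun k => v k + x k) (Set.Iic n) := by
  intro a ha b hb hab
  induction b, hab using Nat.le_induction with
  | base => exact le_rfl
  | succ b hab ih =>
    have hb' : b + 1 ≤ n := hb
    have h1 := ih (show b ≤ n by omega)
    have h2 := h.fwd b (by omega)
    simp only at h1 ⊢
    linarith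

theorem LipschitzHull.q_anti {n : ℕ} {x w v : ℕ → ℝ} (h : LipschitzHull n x w v) :
    AntitoneOn (fun k => v k - x k) (Set.Iic n) := by
  intro a ha b hb hab
  induction b, hab using Nat.le_induction with
  | base => exact le_rfl
  | succ b hab ih =>
    have hb' : b + 1 ≤ n := hb
    have h1 := ih (show b ≤ n by omega)
    have h2 := h.bwd b (by omega)
    simp only at h1 ⊢
    linarith

theorem detour_eq (c : ℕ → ℕ → ℝ) (x v : ℕ → ℝ) (i j k h : ℕ) :
    detour c x (fun k => v k + x k) (fun k => v k - x k) i j k h =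
      v k + v h + (|x k - x i| + c i j + |x h - x j|) := by
  have e : ∀ a b : ℕ, max (v a + x a - x b) (v a - x a + x b) = v a + |x a - x b| := fun a b => by
    rw [abs_eq_max_neg, ← max_add_add_left]
    congr 1 <;> ring
  simp only [detour, e]
  ring

end RealRAM

namespace WDoap

open RealRAM

variable {n : ℕ} (I : WDoap n)

/-- If `a` is joined along the path to one of the ends, the path length to that end is already at
least the weight of `a`. Otherwise `(0, a)` and `(a, n)` both use the shortcut, and their four path
pieces together have length at least `pos n`, which is at least `2 * weight a`; so the two costs sum
to at least `4 * weight a`. -/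
theorem two_mul_weight_le (hn : 1 ≤ n) {i j : Fin (n + 1)} (hij : i ≤ j) {a : ℕ} (ha : a ≤ n) :
    2 * I.weight a ≤ I.D i j := by
  have H := (I.D_le_iff hn hij _).1 le_rfl
  set μ := I.D i j
  have hc := I.oracle_nonneg i j
  have hi := I.pos_mono (Nat.zero_le i)
  have hj := I.pos_mono (show (j : ℕ) ≤ n by omega)
  have h1 := I.weight_le_pos ha
  have h2 := I.weight_le_last ha
  have h0 := I.pos_zero
  have hμ : 0 ≤ μ := by
    have hw0 := I.weight_nonneg 0
    have hwn := I.weight_nonneg n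
    have hx := I.pos_mono (Nat.zero_le n)
    rcases H 0 n (by omega) le_rfl with h | h
    · linarith
    · linarith [abs_nonneg (I.pos 0 - I.pos i), abs_nonneg (I.pos n - I.pos j)]
  rcases Nat.eq_zero_or_pos a with rfl | ha0
  · linarith
  rcases Nat.eq_or_lt_of_le ha with rfl | han
  · linarith
  have hw0 := I.weight_nonneg 0
  have hwn := I.weight_nonneg n
  rcases H 0 a ha0 ha with h | h
  · linarith
  rcases H a n han le_rfl with h' | h'
  · linarith
  linarith [neg_abs_le (I.pos 0 - I.pos i), neg_abs_le (I.pos a - I.pos j), le_abs_self (I.pos n - I.pos j),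
    le_abs_self (I.pos a - I.pos i)]

/-- Each value `v k` is dominated by the cone of some vertex `a`. By the triangle inequality,
neither the path cost nor the detour of a hull pair exceeds that of the pair of apexes; the converse
holds since `weight ≤ v`. -/
theorem D_le_iff_detoursLe (hn : 1 ≤ n) {v : ℕ → ℝ} (hv : LipschitzHull n I.pos I.weight v)
    {i j : Fin (n + 1)} (hij : i ≤ j) (μ : ℝ) :
    I.D i j ≤ μ ↔ DetoursLe I.oracle n I.pos (fun k => v k + I.pos k) (fun k => v k - I.pos k) μ μ i j := by
  constructor
  · intro hD k hk h hh hlt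
    have H := (I.D_le_iff hn hij _).1 hD
    obtain ⟨a, ha, hva⟩ := hv.below.2 k hk
    obtain ⟨b, hb, hvb⟩ := hv.below.2 h hh
    have hwa := (I.two_mul_weight_le hn hij ha).trans hD
    have hwb := (I.two_mul_weight_le hn hij hb).trans hD
    -- `DetoursLe` ranges over all ordered pairs, whereas `D` looks only at `k < h`. Apexes with `b
    -- ≤ a` would give a value of at most `weight a + weight b ≤ μ`, so the pair would not be
    -- critical.
    have hab : a < b := by
      by_contra! hba
      have := I.pos_mono hba
      simp only at hlt
      linarith [le_abs_self (I.pos a - I.pos k), neg_abs_le (I.pos b - I.pos h)]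
    rw [detour_eq]
    rcases H a b hab hb with h' | h'
    · simp only at hlt
      linarith [le_abs_self (I.pos a - I.pos k), neg_abs_le (I.pos b - I.pos h)]
    · have h1 := abs_sub_le (I.pos k) (I.pos a) (I.pos i)
      have h2 := abs_sub_le (I.pos h) (I.pos b) (I.pos j)
      rw [abs_sub_comm (I.pos k) (I.pos a)] at h1
      rw [abs_sub_comm (I.pos h) (I.pos b)] at h2
      linarith
  · intro H
    rw [I.D_le_iff hn hij]
    intro k h hkh hh
    have hk := hv.below.1 k (by omega)
    have hh' := hv.below.1 h hh
    by_cases hlt : μ < v k - I.pos k + (v h + I.pos h)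
    · have := H k (by omega) h hh hlt
      rw [detour_eq] at this
      exact Or.inr (by linarith)
    · exact Or.inl (by linarith)

end WDoap

/-! ### The complete program and its bounds -/

namespace WDoap

open RealRAM

variable {n : ℕ} (I : WDoap n)

theorem solvable (hn : 1 ≤ n) {v : ℕ → ℝ} (hv : LipschitzHull n I.pos I.weight v) {S W : ℕ}
    (hS : S = 16 * (n + 1) + 1) (hW : 100 * (n + 1) ≤ W) :
    Solvable I.oracle S W n I.pos (fun k => v k + I.pos k) (fun k => v k - I.pos k) where
  one_le := hn
  p_mono := hv.p_mono
  q_anti := hv.q_anti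
  x_mono := I.pos_mono.monotoneOn _
  c_inc i j j' hij hjj' hj' := by
    have := I.oracle_le (i := i) (j := j) (z := j') (by omega) (by omega) (by omega) (by omega) hj'
    rw [abs_of_nonneg (sub_nonneg.2 (I.pos_mono hjj'))] at this
    linarith
  c_dec i j j' hij hjj' hj' := by
    have := I.oracle_le (i := i) (j := j') (z := j) (by omega) (by omega) (by omega) (by omega) (by omega)
    rw [abs_sub_comm, abs_of_nonneg (sub_nonneg.2 (I.pos_mono hjj'))] at this
    linarith
  size := hS
  word := hW

/-- At `hi = q 0 + p n`, the largest entry, no pair is critical and every shortcut is feasible. At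
`lo = -hi < 0` the pair `(0, n)` is critical, while its detour is nonnegative. -/
theorem bracket_start (hn : 1 ≤ n) {v : ℕ → ℝ} {s : State} (h : Prepared n I.pos I.weight v s) :
    ∃ lo hi, Bracket I.oracle n I.pos (fun k => v k + I.pos k) (fun k => v k - I.pos k) lo hi s := by
  have h0 := I.pos_zero
  have hv := h.hull
  have hv0 := (I.weight_nonneg 0).trans (hv.below.1 0 (Nat.zero_le n))
  have hvn := (I.weight_nonneg n).trans (hv.below.1 n le_rfl)
  have hL : 0 < I.pos n := by
    have h1 : I.pos 1 = I.edge 0 := by rw [I.pos_succ, h0, zero_add]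
    have h2 : 0 < I.edge 0 := by
      rw [edge, dif_pos (by omega)]
      exact I.δ_pos _
    linarith [I.pos_mono hn]
  refine ⟨_, _, ⟨h.lo, h.hi, le_rfl, ?_, by rw [h.fst, h.snd]; exact one_pos, by rw [h.snd]; exact hn, ?_⟩⟩
  · intro i j hij hj H
    have := H 0 (Nat.zero_le n) n le_rfl (by simp only; linarith)
    rw [detour_eq] at this
    linarith [I.oracle_nonneg i j, abs_nonneg (I.pos 0 - I.pos i), abs_nonneg (I.pos n - I.pos j)]
  · intro k hk l hl hlt
    have h1 := hv.q_anti (Set.mem_Iic.2 (Nat.zero_le n)) (Set.mem_Iic.2 hk) (Nat.zero_le k)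
    have h2 := hv.p_mono (Set.mem_Iic.2 hl) (Set.mem_Iic.2 le_rfl) hl
    simp only at h1 h2 hlt
    linarith

/-- The program that solves the node-weighted diameter-optimal augmentation problem. -/
def program : Cmd := .seq prepare <| .seq searchLoop finish

theorem program_run (hn : 1 ≤ n) {S W : ℕ} (hS : S = 16 * (n + 1) + 1) (hW : 100 * (n + 1) ≤ W) :
    ∃ K t s', 2 ^ K ≤ 2 * n ∧ Exec I.oracle S W program I.start t s' ∧ t ≤ 104000 * ((n + 1) * (K + 6)) ∧
      I.IsOptimal (s'.nreg 0) (s'.nreg 1) := by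
  obtain ⟨t₁, s₁, hex₁, ht₁, v, hp⟩ := prepare_run (c := I.oracle) (x := I.pos) (w := I.weight) (s := I.start)
    hn (show n + 2 ≤ S by omega) hW rfl rfl rfl rfl I.pos_zero.symm
    (fun i _ => by rw [I.pos_succ, add_sub_cancel_left]; rfl) (fun i _ => I.pos_mono (Nat.le_succ i))
  have hs := I.solvable hn hp.hull hS hW
  obtain ⟨K, hK, hK', h3, h4⟩ := hp.power
  obtain ⟨lo, hi, hbr⟩ := I.bracket_start hn hp
  obtain ⟨t₂, s₂, hex₂, ht₂, hlt, hle, hopt⟩ := (searchLoop_run hs hK hK' hp.holds h3 h4 hbr).seq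
    (q := finish) (b' := 3000 * (n + 1) + 20) (Q := fun s' => s'.nreg 0 < s'.nreg 1 ∧ s'.nreg 1 ≤ n ∧
      ∀ i j r, i < j → j ≤ n →
        DetoursLe I.oracle n I.pos (fun k => v k + I.pos k) (fun k => v k - I.pos k) r r i j →
        DetoursLe I.oracle n I.pos (fun k => v k + I.pos k) (fun k => v k - I.pos k) r r (s'.nreg 0) (s'.nreg 1))
    (fun s' ⟨lo, hi, hbr', hno⟩ hsame => finish_run hs
      (hp.holds.of_same hsame (by decide) (by decide) (by decide) (by decide)) hbr' hno)
  refine ⟨K, _, s₂, hK', .seq hex₁ hex₂, ?_, ⟨s₂.nreg 0, by omega⟩, ⟨s₂.nreg 1, by omega⟩, rfl, rfl, hlt, ?_⟩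
  · have : n + 1 ≤ (n + 1) * (K + 6) := Nat.le_mul_of_pos_right _ (by omega)
    omega
  · intro i' j' hij'
    rw [I.D_le_iff_detoursLe hn hp.hull (le_of_lt hlt)]
    refine hopt i' j' _ hij' (by omega) ?_
    exact (I.D_le_iff_detoursLe hn hp.hull (le_of_lt hij') _).1 le_rfl

end WDoap

/-- With `1 / 2 ≤ log 2 ≤ log (n + 1)`, half of `K + 6` is at most `7 log 2 + log (n + 1) ≤ 8 log (n
+ 1)`. -/
theorem exponent_le_log {n K : ℕ} (hn : 1 ≤ n) (hK : 2 ^ K ≤ 2 * n) :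
    ((K + 6 : ℕ) : ℝ) ≤ 16 * Real.log ((n + 1 : ℕ) : ℝ) := by
  have h2 : (1 / 2 : ℝ) ≤ Real.log 2 := by linarith [Real.log_two_gt_d9]
  have hlog : Real.log 2 ≤ Real.log ((n + 1 : ℕ) : ℝ) :=
    Real.log_le_log two_pos (by exact_mod_cast (by omega : 2 ≤ n + 1))
  have h1 : (K : ℝ) * Real.log 2 ≤ Real.log 2 + Real.log ((n + 1 : ℕ) : ℝ) := by
    rw [← Real.log_pow, ← Real.log_mul two_ne_zero (by positivity)]
    refine Real.log_le_log (by positivity) ?_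
    exact_mod_cast hK.trans (by omega)
  have h3 : ((K + 6 : ℕ) : ℝ) * (1 / 2) ≤ ((K + 6 : ℕ) : ℝ) * Real.log 2 :=
    mul_le_mul_of_nonneg_left h2 (by positivity)
  push_cast at h3 hlog h1 ⊢
  linarith

/-- One program and constants `C`, `K` such that on every instance with `N = n + 1 ≥ 2` vertices
the program halts within `C · N log N` steps, uses at most `C · N` memory cells and words below
`N ^ K`, and leaves an optimal pair of indices in the word registers `0` and `1`. -/
theorem mainTheorem3 :
    ∃ (P : RealRAM.Cmd) (C K : ℕ), ∀ (n : ℕ), 1 ≤ n → ∀ I : WDoap n,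
      ∃ (S t : ℕ) (s' : RealRAM.State),
        P.space S ≤ C * (n + 1) ∧
        RealRAM.Exec I.oracle S ((n + 1) ^ K) P I.start t s' ∧
        (t : ℝ) ≤ C * (((n + 1 : ℕ) : ℝ) * Real.log ((n + 1 : ℕ) : ℝ)) ∧
        I.IsOptimal (s'.nreg 0) (s'.nreg 1) := by
  -- `36 = 2 * 18`, as `16 * (n + 1) + 2 ≤ 18 * (n + 1)`; `1664000 = 104000 * 16` combines the step
  -- bound with `exponent_le_log`; the exponent `8` suffices because `100 ≤ 2 ^ 7`.
  refine ⟨WDoap.program, 36 * WDoap.program.width + 1664000, 8, fun n hn I => ?_⟩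
  have hW : 100 * (n + 1) ≤ (n + 1) ^ 8 := by
    have : 2 ^ 7 ≤ (n + 1) ^ 7 := Nat.pow_le_pow_left (by omega) 7
    rw [pow_succ (n + 1) 7]
    exact Nat.mul_le_mul_right _ (by omega)
  obtain ⟨K, t, s', hK, hex, ht, hopt⟩ := I.program_run hn rfl hW
  refine ⟨_, t, s', ?_, hex, ?_, hopt⟩
  · have : WDoap.program.width * (16 * (n + 1) + 1 + 1) ≤ WDoap.program.width * (18 * (n + 1)) :=
      Nat.mul_le_mul_left _ (by omega)
    calc WDoap.program.space _ ≤ 2 * (WDoap.program.width * (18 * (n + 1))) := Nat.mul_le_mul_left 2 this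
      _ = 36 * WDoap.program.width * (n + 1) := by ring
      _ ≤ _ := Nat.mul_le_mul_right _ (by omega)
  · have hlog := exponent_le_log hn hK
    have hlog0 : 0 ≤ Real.log ((n + 1 : ℕ) : ℝ) := Real.log_natCast_nonneg _
    calc (t : ℝ) ≤ 104000 * (((n + 1 : ℕ) : ℝ) * ((K + 6 : ℕ) : ℝ)) := by exact_mod_cast ht
      _ ≤ 104000 * (((n + 1 : ℕ) : ℝ) * (16 * Real.log ((n + 1 : ℕ) : ℝ))) := by gcongr
      _ = 1664000 * (((n + 1 : ℕ) : ℝ) * Real.log ((n + 1 : ℕ) : ℝ)) := by ring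
      _ ≤ _ := by
        refine mul_le_mul_of_nonneg_right ?_ (by positivity)
        exact_mod_cast Nat.le_add_left _ _
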